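/- Let $R$ be a local ring and let $G$ be a finite étale group scheme over $R$ with Hopf algebra $R[G]$; representations of $G$ are $R[G]$-comodules. Assume that $G$ is a good linearly reductive group: the functor of invariants $M\mapsto M^G$ on $R[G]$-comodules is exact, and there is given a finite collection $I_G$ of finitely generated projective $R[G]$-comodules of positive rank at all points of $\operatorname{Spec}R$, containing the trivial representation $R$, such that for every $R[G]$-comodule $M$ the natural map $\bigoplus_{V\in I_G}V\otimes_R\operatorname{Hom}^G(V,M)\to M$ is an isomorphism. Let $T$ be an $R$-scheme and $\mathscr A$ a locally free sheaf of commutative $\mathcal O_T$-algebras of finite rank with an action of $G$, and let $f\colon X=\operatorname{Spec}\mathscr A\to T$, so $\mathscr A=f_*\mathcal O_X$. Assume that $\mathcal O_T\to\mathscr A$ induces an isomorphism $\mathcal O_T\simeq\mathscr A^G$ and that $\operatorname{rk}\mathscr A=\operatorname{rk}G$ at every point of $T$. Write $\operatorname{tr}_{\mathscr A}\colon\mathscr A\to\mathcal O_T$ for the trace and $\mathcal Q_{\mathscr A}$ for the cokernel of $\mathscr A\to\mathscr A^\vee$, $x\mapsto\operatorname{tr}_{\mathscr A}(x\cdot-)$.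 For a finitely generated projective representation $V$ put $\Omega_V=(\mathscr A\otimes_R V)^G$, let $$\omega_V\colon\Omega_V\otimes\Omega_{V^\vee}\to\Omega_{V\otimes V^\vee}\to\Omega_R=\mathscr A^G\simeq\mathcal O_T$$ be the map given by multiplication in $\mathscr A$ and by the evaluation $V\otimes V^\vee\to R$, let $\xi_V\colon\Omega_{V^\vee}\to(\Omega_V)^\vee$ be the induced map, and put $\mathcal Q_{\mathscr A,V}=\operatorname{Coker}\xi_V$. Then: 1. There is a $G$-equivariant isomorphism of $\mathcal O_T$-modules, with $G$ acting trivially on the sheaves $\Omega_V$, $$\operatorname{Ker}\operatorname{tr}_{\mathscr A}\simeq\bigoplus_{R\ne V\in I_G}V^\vee\otimes_R\Omega_V.$$ 2. There is an isomorphism of $\mathcal O_T$-modules $$\mathcal Q_{\mathscr A}\simeq\bigoplus_{V\in I_G}V^\vee\otimes_R\mathcal Q_{\mathscr A,V}.$$ 3. Suppose moreover that $f$ is a $G$-cover, i.e. that $\mathscr A$ and $R[G]\otimes_R\mathcal O_T$ are fppf locally on $T$ isomorphic as $R[G]$-comodules. It is known that $\Omega_V$ and $\Omega_{V^\vee}$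 are then locally free of rank $\operatorname{rk}V$, so that $\det=\bigwedge^{\operatorname{rk}V}$ for them, and $\det f_*\mathcal O_X=\bigwedge^{\operatorname{rk}G}f_*\mathcal O_X$; let $s_{f,V}\in(\det\Omega_V\otimes\det\Omega_{V^\vee})^{-1}$ be the section given by $\det\xi_V$, and let $s_f\in(\det f_*\mathcal O_X)^{-2}$ be the discriminant section, given by the determinant of $\mathscr A\to\mathscr A^\vee$, $x\mapsto\operatorname{tr}_{\mathscr A}(x\cdot-)$. There is an isomorphism of $\mathcal O_T$-modules $$(\det f_*\mathcal O_X)^{-2}\simeq\bigotimes_{V\in I_G}\bigl((\det\Omega_V)^{-1}\otimes(\det\Omega_{V^\vee})^{-1}\bigr)^{\otimes\operatorname{rk}V}$$ that sends $s_f$ to $\bigotimes_{V\in I_G}s_{f,V}^{\otimes\operatorname{rk}V}$. -/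

import Mathlib

open CategoryTheory AlgebraicGeometry TensorProduct

universe u

namespace GCov

noncomputable section

/-! ## Comodules over a Hopf algebra -/

/-- A right comodule over the `R`-coalgebra `H`; when `H = R[G]`, an action of the affine group
scheme `G = Spec H` on the `R`-module `carrier`. -/
structure Comod (R H : Type u) [CommRing R] [CommRing H] [HopfAlgebra R H] where
  carrier : Type u
  [addCommGroup : AddCommGroup carrier]
  [module : Module R carrier]
  coact : carrier →ₗ[R] carrier ⊗[R] H
  coassoc : (TensorProduct.assoc R carrier H H).toLinearMap ∘ₗ coact.rTensor H ∘ₗ coact =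
    (Coalgebra.comul (R := R) (A := H)).lTensor carrier ∘ₗ coact
  counit : (TensorProduct.rid R carrier).toLinearMap ∘ₗ
    (Coalgebra.counit (R := R) (A := H)).lTensor carrier ∘ₗ coact = LinearMap.id

attribute [instance] Comod.addCommGroup Comod.module

section Comodules

variable {R H : Type u} [CommRing R] [CommRing H] [HopfAlgebra R H]

/-- Morphisms of comodules, i.e. `G`-equivariant linear maps. -/
def Comod.Hom (M N : Comod R H) : Submodule R (M.carrier →ₗ[R] N.carrier) where
  carrier := {f | N.coact ∘ₗ f = f.rTensor H ∘ₗ M.coact}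
  zero_mem' := by simp
  add_mem' := by
    intro f g hf hg
    simp only [Set.mem_ofPred_eq] at *
    rw [LinearMap.comp_add, hf, hg, LinearMap.rTensor_add, LinearMap.add_comp]
  smul_mem' := by
    intro r f hf
    simp only [Set.mem_ofPred_eq] at *
    rw [LinearMap.comp_smul, hf, LinearMap.rTensor_smul, LinearMap.smul_comp]

/-- The invariants `M^G = {m | ρ(m) = m ⊗ 1}`. -/
def Comod.inv (M : Comod R H) : Submodule R M.carrier :=
  LinearMap.eqLocus M.coact ((TensorProduct.mk R M.carrier H).flip 1)

/-- The map induced on invariants by an equivariant map. -/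
def Comod.mapInv {M N : Comod R H} (f : Comod.Hom M N) : M.inv →ₗ[R] N.inv :=
  f.1.restrict (by
    intro m hm
    have hf : N.coact (f.1 m) = f.1.rTensor H (M.coact m) := LinearMap.congr_fun f.2 m
    have hm' : M.coact m = m ⊗ₜ[R] (1 : H) := hm
    change N.coact (f.1 m) = f.1 m ⊗ₜ[R] (1 : H)
    rw [hf, hm', LinearMap.rTensor_tmul])

variable (R H) in
/-- `G` is linearly reductive: the functor of invariants is exact. -/
def LinearlyReductive : Prop :=
  ∀ (M N P : Comod R H) (i : Comod.Hom M N) (p : Comod.Hom N P),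
    Function.Injective i.1 → Function.Exact i.1 p.1 → Function.Surjective p.1 →
      Function.Injective (Comod.mapInv i) ∧
        Function.Exact (Comod.mapInv i) (Comod.mapInv p) ∧
          Function.Surjective (Comod.mapInv p)

/-- The natural map `⨁ i, V i ⊗ Hom^G(V i, M) → M` (a finite direct sum). -/
def evalMap {ι : Type} [Fintype ι] (V : ι → Comod R H) (M : Comod R H) :
    (∀ i, (V i).carrier ⊗[R] Comod.Hom (V i) M) →ₗ[R] M.carrier :=
  ∑ i, TensorProduct.lift ((Submodule.subtype (Comod.Hom (V i) M)).flip) ∘ₗ LinearMap.proj i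

variable (R H) in
/-- A good linearly reductive group `(G, I_G)`: `G` is linearly reductive and `I_G = (V i)_i` is a
finite collection of `G`-representations, finitely generated projective of positive rank at all
points of `Spec R`, such that `⨁ i, V i ⊗ Hom^G(V i, M) → M` is an isomorphism for every
comodule `M`, and containing the trivial representation `R` (at the index `triv`). -/
structure GoodLinearlyReductive (ι : Type) [Fintype ι] where
  reductive : LinearlyReductive R H
  V : ι → Comod R H
  finite : ∀ i, Module.Finite R (V i).carrier
  projective : ∀ i, Module.Projective R (V i).carrier
  rank_pos : ∀ i (p : PrimeSpectrum R), 0 < Module.rankAtStalk (V i).carrier p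
  eval_bijective : ∀ M : Comod R H, Function.Bijective (evalMap V M)
  triv : ι
  triv_equiv : Nonempty ((V triv).carrier ≃ₗ[R] R)
  triv_coact : ∀ v : (V triv).carrier, (V triv).coact v = v ⊗ₜ[R] (1 : H)

attribute [instance] GoodLinearlyReductive.finite GoodLinearlyReductive.projective

/-- The coaction on the dual `V^∨` of a finitely generated projective comodule: the contragredient
action `(g φ)(v) = φ(g⁻¹ v)`. Under `V^∨ ⊗ H ≃ Hom(V, H)` the element `ρ^∨(φ)` is the map
`v ↦ ∑ φ(v₀) S(v₁)`. -/
def dualCoact (V : Comod R H) [Module.Finite R V.carrier] [Module.Projective R V.carrier] :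
    Module.Dual R V.carrier →ₗ[R] Module.Dual R V.carrier ⊗[R] H :=
  (dualTensorHomEquiv R V.carrier H).symm.toLinearMap ∘ₗ
    LinearMap.lcomp R H V.coact ∘ₗ
    (LinearMap.llcomp R (V.carrier ⊗[R] H) (R ⊗[R] H) H
      ((HopfAlgebra.antipode R : H →ₗ[R] H) ∘ₗ (TensorProduct.lid R H).toLinearMap)) ∘ₗ
    LinearMap.rTensorHom H

theorem dualTensorHom_dualCoact (V : Comod R H) [Module.Finite R V.carrier]
    [Module.Projective R V.carrier] (φ : Module.Dual R V.carrier) :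
    dualTensorHom R V.carrier H (dualCoact V φ) =
      ((HopfAlgebra.antipode R : H →ₗ[R] H) ∘ₗ (TensorProduct.lid R H).toLinearMap ∘ₗ
        φ.rTensor H) ∘ₗ V.coact :=
  (dualTensorHomEquiv R V.carrier H).apply_symm_apply _

/-- The pairing `(v ⊗ h, φ ⊗ k) ↦ φ(v) h k`. -/
def evH (V : Type u) [AddCommGroup V] [Module R V] :
    V ⊗[R] H →ₗ[R] Module.Dual R V ⊗[R] H →ₗ[R] H :=
  TensorProduct.curry (LinearMap.mul' R H ∘ₗ
    TensorProduct.map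
      ((LinearMap.mul' R H) ∘ₗ (Algebra.linearMap R H).rTensor H ∘ₗ
        (contractRight R V).rTensor H) LinearMap.id ∘ₗ
    (TensorProduct.assoc R (V ⊗[R] Module.Dual R V) H H).symm.toLinearMap ∘ₗ
    (TensorProduct.tensorTensorTensorComm R V H (Module.Dual R V) H).toLinearMap)

theorem evH_tmul (V : Type u) [AddCommGroup V] [Module R V] (v : V) (h : H)
    (φ : Module.Dual R V) (k : H) : evH V (v ⊗ₜ[R] h) (φ ⊗ₜ[R] k) = φ v • (h * k) := by
  simp [evH, Algebra.smul_def, mul_assoc]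

theorem evH_eq (V : Type u) [AddCommGroup V] [Module R V] (v : V) (h : H)
    (w : Module.Dual R V ⊗[R] H) : evH V (v ⊗ₜ[R] h) w = h * dualTensorHom R V H w v := by
  induction w with
  | zero => simp
  | tmul φ k => simp [evH_tmul]
  | add x y hx hy => simp [hx, hy, mul_add]

/-- The evaluation `V ⊗ V^∨ → R` is equivariant. -/
theorem evH_coact (V : Comod R H) [Module.Finite R V.carrier]
    [Module.Projective R V.carrier] (v : V.carrier) (φ : Module.Dual R V.carrier) :
    evH V.carrier (V.coact v) (dualCoact V φ) = algebraMap R H (φ v) := by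
  have key : ∀ z : V.carrier ⊗[R] H, evH V.carrier z (dualCoact V φ) =
      LinearMap.mul' R H ((HopfAlgebra.antipode R : H →ₗ[R] H).rTensor H
        ((TensorProduct.lid R (H ⊗[R] H)) (φ.rTensor (H ⊗[R] H)
          (TensorProduct.assoc R V.carrier H H (V.coact.rTensor H z))))) := by
    intro z
    induction z with
    | zero => simp
    | add x y hx hy => simp only [map_add, LinearMap.add_apply, hx, hy]
    | tmul v h =>
      rw [evH_eq, dualTensorHom_dualCoact]
      simp only [LinearMap.rTensor_tmul, LinearMap.comp_apply]
      generalize V.coact v = w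
      induction w with
      | zero => simp
      | add x y hx hy => simp only [map_add, TensorProduct.add_tmul, mul_add, hx, hy]
      | tmul a b => simp [mul_comm]
  have h2 : TensorProduct.assoc R V.carrier H H (V.coact.rTensor H (V.coact v)) =
      (Coalgebra.comul (R := R) (A := H)).lTensor V.carrier (V.coact v) :=
    LinearMap.congr_fun V.coassoc v
  have h3 : TensorProduct.rid R V.carrier
      ((Coalgebra.counit (R := R) (A := H)).lTensor V.carrier (V.coact v)) = v :=
    LinearMap.congr_fun V.counit v
  rw [key, h2]
  have h4 : ∀ z : V.carrier ⊗[R] H,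
      LinearMap.mul' R H ((HopfAlgebra.antipode R : H →ₗ[R] H).rTensor H
        ((TensorProduct.lid R (H ⊗[R] H)) (φ.rTensor (H ⊗[R] H)
          ((Coalgebra.comul (R := R) (A := H)).lTensor V.carrier z)))) =
      algebraMap R H (φ (TensorProduct.rid R V.carrier
        ((Coalgebra.counit (R := R) (A := H)).lTensor V.carrier z))) := by
    intro z
    induction z with
    | zero => simp
    | add x y hx hy => simp only [map_add, hx, hy]
    | tmul a b =>
      simp only [LinearMap.lTensor_tmul, LinearMap.rTensor_tmul, TensorProduct.lid_tmul,
        map_smul, TensorProduct.rid_tmul, HopfAlgebra.mul_antipode_rTensor_comul_apply,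
        smul_eq_mul, map_mul]
      rw [Algebra.smul_def, mul_comm]
  rw [h4, h3]

end Comodules

/-! ## Equivariant algebras over a ring -/

section EquivariantAlgebra

variable {R H : Type u} [CommRing R] [CommRing H] [HopfAlgebra R H]
variable {B A : Type u} [CommRing B] [Algebra R B] [CommRing A] [Algebra R A] [Algebra B A]
  [IsScalarTower R B A]

/-- The diagonal coaction `a ⊗ v ↦ ∑ (a₀ ⊗ v₀) ⊗ a₁ v₁` on `A ⊗ V`. -/
def diagCoact (α : A →ₗ[B] A ⊗[R] H) {V : Type u} [AddCommGroup V] [Module R V]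
    (ρ : V →ₗ[R] V ⊗[R] H) : A ⊗[R] V →ₗ[B] (A ⊗[R] V) ⊗[R] H :=
  AlgebraTensorModule.map (LinearMap.id : A ⊗[R] V →ₗ[B] A ⊗[R] V) (LinearMap.mul' R H) ∘ₗ
    (AlgebraTensorModule.tensorTensorTensorComm R R R B A H V H).toLinearMap ∘ₗ
    AlgebraTensorModule.map α ρ

/-- The invariants `(A ⊗ V)^G`, a `B`-submodule of `A ⊗ V`. -/
def invTensor (α : A →ₗ[B] A ⊗[R] H) {V : Type u} [AddCommGroup V] [Module R V]
    (ρ : V →ₗ[R] V ⊗[R] H) : Submodule B (A ⊗[R] V) where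
  carrier := {x | diagCoact α ρ x = x ⊗ₜ[R] (1 : H)}
  zero_mem' := by simp
  add_mem' := by
    intro x y hx hy
    simp only [Set.mem_ofPred_eq] at *
    rw [map_add, hx, hy, TensorProduct.add_tmul]
  smul_mem' := by
    intro b x hx
    simp only [Set.mem_ofPred_eq] at *
    rw [map_smul, hx, TensorProduct.smul_tmul']

/-- The invariants `A^G`, a `B`-submodule of `A`. -/
def invAlg (α : A →ₗ[B] A ⊗[R] H) : Submodule B A where
  carrier := {a | α a = a ⊗ₜ[R] (1 : H)}
  zero_mem' := by simp
  add_mem' := by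
    intro x y hx hy
    simp only [Set.mem_ofPred_eq] at *
    rw [map_add, hx, hy, TensorProduct.add_tmul]
  smul_mem' := by
    intro b x hx
    simp only [Set.mem_ofPred_eq] at *
    rw [map_smul, hx, TensorProduct.smul_tmul']

variable (B) in
/-- The `B`-bilinear map `A ⊗ V → A ⊗ V^∨ → A`, `(a ⊗ v, b ⊗ φ) ↦ φ(v) a b`: multiplication of
`A` combined with the evaluation `V ⊗ V^∨ → R`. -/
def mulEval (V : Type u) [AddCommGroup V] [Module R V] :
    A ⊗[R] V →ₗ[B] A ⊗[R] Module.Dual R V →ₗ[B] A :=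
  TensorProduct.curry
    ((AlgebraTensorModule.rid R B A).toLinearMap ∘ₗ
      AlgebraTensorModule.map (LinearMap.mul' B A) (contractRight R V) ∘ₗ
      (AlgebraTensorModule.tensorTensorTensorComm R R B B A V A
        (Module.Dual R V)).toLinearMap)

theorem mulEval_tmul (V : Type u) [AddCommGroup V] [Module R V] (a : A) (v : V) (b : A)
    (φ : Module.Dual R V) :
    mulEval B V (a ⊗ₜ[R] v) (b ⊗ₜ[R] φ) = φ v • (a * b) := by
  simp [mulEval]

/-- The product of invariant elements of `A ⊗ V` and `A ⊗ V^∨` lands in `A^G`. -/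
theorem mulEval_equivariant (α : A →ₐ[B] A ⊗[R] H) (V : Comod R H) [Module.Finite R V.carrier]
    [Module.Projective R V.carrier] {x : A ⊗[R] V.carrier}
    (hx : x ∈ invTensor α.toLinearMap V.coact) {y : A ⊗[R] Module.Dual R V.carrier}
    (hy : y ∈ invTensor α.toLinearMap (dualCoact V)) :
    mulEval B V.carrier x y ∈ invAlg α.toLinearMap := by
  -- `P2 ((a ⊗ v) ⊗ h) ((b ⊗ φ) ⊗ k) = φ(v) a b ⊗ h k`
  let P2 : (A ⊗[R] V.carrier) ⊗[R] H →ₗ[R] (A ⊗[R] Module.Dual R V.carrier) ⊗[R] H →ₗ[R]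
      A ⊗[R] H :=
    TensorProduct.curry
      (TensorProduct.map
        (TensorProduct.uncurry (RingHom.id R) _ _ _ ((LinearMap.restrictScalarsₗ R B _ _ R) ∘ₗ
          (mulEval B V.carrier).restrictScalars R))
        (LinearMap.mul' R H) ∘ₗ
        (TensorProduct.tensorTensorTensorComm R _ H _ H).toLinearMap)
  have hP2 : ∀ x h y k, P2 (x ⊗ₜ[R] h) (y ⊗ₜ[R] k) = mulEval B V.carrier x y ⊗ₜ[R] (h * k) := by
    intro x h y k
    simp [P2]
  have main : ∀ x y, P2 (diagCoact α.toLinearMap V.coact x)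
      (diagCoact α.toLinearMap (dualCoact V) y) = α (mulEval B V.carrier x y) := by
    intro x y
    induction x with
    | zero => simp
    | add x₁ x₂ h₁ h₂ => simp only [map_add, LinearMap.add_apply, h₁, h₂]
    | tmul a v =>
      induction y with
      | zero => simp
      | add y₁ y₂ h₁ h₂ => simp only [map_add, h₁, h₂]
      | tmul b φ =>
        have e1 : ∀ (s t : A ⊗[R] H) (z : V.carrier ⊗[R] H)
            (w : Module.Dual R V.carrier ⊗[R] H),
            P2 (AlgebraTensorModule.map (LinearMap.id : A ⊗[R] V.carrier →ₗ[B] A ⊗[R] V.carrier)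
                (LinearMap.mul' R H)
                (AlgebraTensorModule.tensorTensorTensorComm R R R B A H V.carrier H
                  (s ⊗ₜ[R] z)))
              (AlgebraTensorModule.map
                (LinearMap.id : A ⊗[R] Module.Dual R V.carrier →ₗ[B] _)
                (LinearMap.mul' R H)
                (AlgebraTensorModule.tensorTensorTensorComm R R R B A H
                  (Module.Dual R V.carrier) H (t ⊗ₜ[R] w))) =
            s * t * ((1 : A) ⊗ₜ[R] evH V.carrier z w) := by
          intro s t z w
          induction s with
          | zero => simp
          | add s₁ s₂ h₁ h₂ =>
            simp only [map_add, TensorProduct.add_tmul, LinearMap.add_apply, h₁, h₂, add_mul]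
          | tmul a h =>
          induction t with
          | zero => simp
          | add s₁ s₂ h₁ h₂ =>
            simp only [map_add, TensorProduct.add_tmul, h₁, h₂, add_mul, mul_add]
          | tmul b k =>
          induction z with
          | zero => simp
          | add s₁ s₂ h₁ h₂ =>
            simp only [map_add, TensorProduct.tmul_add, LinearMap.add_apply, h₁, h₂, mul_add]
          | tmul v l =>
          induction w with
          | zero => simp
          | add s₁ s₂ h₁ h₂ =>
            simp only [map_add, TensorProduct.tmul_add, h₁, h₂, mul_add]
          | tmul φ m =>
            simp only [AlgebraTensorModule.tensorTensorTensorComm_tmul,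
              AlgebraTensorModule.map_tmul, LinearMap.mul'_apply, LinearMap.id_apply, hP2,
              mulEval_tmul, evH_tmul, Algebra.TensorProduct.tmul_mul_tmul, mul_one,
              TensorProduct.smul_tmul, mul_smul_comm]
            congr 2
            ring
        have e2 := e1 (α a) (α b) (V.coact v) (dualCoact V φ)
        rw [evH_coact] at e2
        refine e2.trans ?_
        rw [mulEval_tmul, ← map_mul, Algebra.algebraMap_eq_smul_one, TensorProduct.tmul_smul,
          ← Algebra.TensorProduct.one_def, mul_smul_comm, mul_one,
          ← algebraMap_smul B (φ v) (a * b), map_smul, algebraMap_smul]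
  have hx' : diagCoact α.toLinearMap V.coact x = x ⊗ₜ[R] (1 : H) := hx
  have hy' : diagCoact α.toLinearMap (dualCoact V) y = y ⊗ₜ[R] (1 : H) := hy
  have := main x y
  rw [hx', hy', hP2, mul_one] at this
  exact this.symm

/-- The trace of an endomorphism of a finitely generated projective module: contraction after
`End(M) ≃ M^∨ ⊗ M` (`LinearMap.trace` is only meaningful for free modules). -/
def projTrace (B M : Type u) [CommRing B] [AddCommGroup M] [Module B M] [Module.Finite B M]
    [Module.Projective B M] : (M →ₗ[B] M) →ₗ[B] B :=
  contractLeft B M ∘ₗ (dualTensorHomEquiv B M M).symm.toLinearMap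

variable (B A) in
/-- The trace map `tr : A → B` of a `B`-algebra that is finitely generated projective as a module:
`tr(a)` is the trace of multiplication by `a`. -/
def algTrace [Module.Finite B A] [Module.Projective B A] : A →ₗ[B] B :=
  projTrace B A ∘ₗ LinearMap.mul B A

end EquivariantAlgebra

/-! ## Semilinear maps along a ring homomorphism -/

section Semilinear

variable {B B' : Type u} [CommRing B] [CommRing B'] {σ : B →+* B'}
variable {M M' : Type u} [AddCommGroup M] [Module B M] [AddCommGroup M'] [Module B' M']

/-- The `σ`-semilinear map `f : M → M'` exhibits `M'` as the base change `B' ⊗ M`. -/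
def IsBaseChangeAlong (f : M →ₛₗ[σ] M') : Prop :=
  letI : Algebra B B' := σ.toAlgebra
  letI : Module B M' := Module.compHom M' σ
  haveI : IsScalarTower B B' M' := ⟨fun b c m ↦ mul_smul (σ b) c m⟩
  IsBaseChange B' ({ toFun := f, map_add' := f.map_add, map_smul' := f.map_smulₛₗ } : M →ₗ[B] M')

/-- A linear form on `M` extends to its base change. -/
theorem IsBaseChangeAlong.exists_dual {f : M →ₛₗ[σ] M'} (hf : IsBaseChangeAlong f)
    (φ : Module.Dual B M) : ∃ φ' : Module.Dual B' M', ∀ m, φ' (f m) = σ (φ m) := by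
  let _ : Algebra B B' := σ.toAlgebra
  let _ : Module B M' := Module.compHom M' σ
  have : IsScalarTower B B' M' := ⟨fun b c m ↦ mul_smul (σ b) c m⟩
  exact ⟨IsBaseChange.lift hf (Algebra.linearMap B B' ∘ₗ φ),
    fun m ↦ IsBaseChange.lift_eq hf (Algebra.linearMap B B' ∘ₗ φ) m⟩

/-- Linear maps from a base change are determined on the original module. -/
theorem IsBaseChangeAlong.hom_ext {f : M →ₛₗ[σ] M'} (hf : IsBaseChangeAlong f) {N : Type u}
    [AddCommGroup N] [Module B' N] (g g' : M' →ₗ[B'] N) (h : ∀ m, g (f m) = g' (f m)) :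
    g = g' := by
  let _ : Algebra B B' := σ.toAlgebra
  let _ : Module B M' := Module.compHom M' σ
  have : IsScalarTower B B' M' := ⟨fun b c m ↦ mul_smul (σ b) c m⟩
  exact IsBaseChange.algHom_ext hf g g' h

/-- The trace commutes with base change. -/
theorem projTrace_baseChange [Module.Finite B M] [Module.Projective B M] [Module.Finite B' M']
    [Module.Projective B' M'] {f : M →ₛₗ[σ] M'} (hf : IsBaseChangeAlong f) (g : M →ₗ[B] M)
    (g' : M' →ₗ[B'] M') (h : ∀ m, g' (f m) = f (g m)) :
    projTrace B' M' g' = σ (projTrace B M g) := by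
  have key : ∀ w : Module.Dual B M ⊗[B] M, ∃ w' : Module.Dual B' M' ⊗[B'] M',
      (∀ m, dualTensorHom B' M' M' w' (f m) = f (dualTensorHom B M M w m)) ∧
        contractLeft B' M' w' = σ (contractLeft B M w) := by
    intro w
    induction w with
    | zero => exact ⟨0, by simp⟩
    | add x y hx hy =>
      obtain ⟨x', hx1, hx2⟩ := hx
      obtain ⟨y', hy1, hy2⟩ := hy
      exact ⟨x' + y', fun m ↦ by simp [hx1, hy1], by simp [hx2, hy2]⟩
    | tmul φ x =>
      obtain ⟨φ', hφ⟩ := hf.exists_dual φ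
      exact ⟨φ' ⊗ₜ f x, fun m ↦ by simp [hφ], by simp [hφ]⟩
  obtain ⟨w', h1, h2⟩ := key ((dualTensorHomEquiv B M M).symm g)
  have hw : dualTensorHomEquiv B M M ((dualTensorHomEquiv B M M).symm g) = g :=
    LinearEquiv.apply_symm_apply _ _
  have hw' : dualTensorHomEquiv B' M' M' w' = g' := by
    refine hf.hom_ext _ _ fun m ↦ ?_
    rw [h]
    refine (h1 m).trans ?_
    exact congrArg (fun k : M →ₗ[B] M ↦ f (k m)) hw
  have : (dualTensorHomEquiv B' M' M').symm g' = w' := by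
    rw [← hw', LinearEquiv.symm_apply_apply]
  change contractLeft B' M' ((dualTensorHomEquiv B' M' M').symm g') = _
  rw [this, h2]
  rfl

/-- The map `⋀ⁿ M → ⋀ⁿ M'`, `m₁ ∧ ⋯ ∧ mₙ ↦ f m₁ ∧ ⋯ ∧ f mₙ`, of a semilinear map `f`. -/
def extMap (n : ℕ) (f : M →ₛₗ[σ] M') : ⋀[B]^n M →ₛₗ[σ] ⋀[B']^n M' :=
  letI : Module B (⋀[B']^n M') := Module.compHom _ σ
  let g : M [⋀^Fin n]→ₗ[B] (⋀[B']^n M') :=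
    { toFun := fun m ↦ exteriorPower.ιMulti B' n (fun i ↦ f (m i))
      map_update_add' := by
        intro _ m i x y
        have h : ∀ z, (fun j ↦ f (Function.update m i z j)) =
            Function.update (fun j ↦ f (m j)) i (f z) := fun z ↦ by
          funext j
          exact Function.apply_update (fun _ ↦ f) m i z j
        rw [h, h, h, map_add, AlternatingMap.map_update_add]
      map_update_smul' := by
        intro _ m i c x
        have h : ∀ z, (fun j ↦ f (Function.update m i z j)) =
            Function.update (fun j ↦ f (m j)) i (f z) := fun z ↦ by
          funext j
          exact Function.apply_update (fun _ ↦ f) m i z j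
        rw [h, h, map_smulₛₗ, AlternatingMap.map_update_smul]
        rfl
      map_eq_zero_of_eq' := by
        intro m i j hm hij
        exact AlternatingMap.map_eq_zero_of_eq _ _ (congrArg f hm) hij }
  let l := exteriorPower.alternatingMapLinearEquiv g
  { toFun := l
    map_add' := l.map_add
    map_smul' := fun c x ↦ l.map_smul c x }

theorem extMap_ιMulti (n : ℕ) (f : M →ₛₗ[σ] M') (m : Fin n → M) :
    extMap n f (exteriorPower.ιMulti B n m) = exteriorPower.ιMulti B' n (fun i ↦ f (m i)) := by
  let _ : Module B (⋀[B']^n M') := Module.compHom _ σ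
  exact exteriorPower.alternatingMapLinearEquiv_apply_ιMulti _ _

/-- The map `⨂ M i → ⨂ M' i` of a family of semilinear maps. -/
def piTensorMap {κ : Type} {M M' : κ → Type u} [∀ i, AddCommGroup (M i)] [∀ i, Module B (M i)]
    [∀ i, AddCommGroup (M' i)] [∀ i, Module B' (M' i)] (f : ∀ i, M i →ₛₗ[σ] M' i) :
    PiTensorProduct B M →ₛₗ[σ] PiTensorProduct B' M' :=
  letI : Module B (PiTensorProduct B' M') := Module.compHom _ σ
  let g : MultilinearMap B M (PiTensorProduct B' M') :=
    { toFun := fun m ↦ PiTensorProduct.tprod B' (fun i ↦ f i (m i))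
      map_update_add' := by
        intro _ m i x y
        have h : ∀ z, (fun j ↦ f j (Function.update m i z j)) =
            Function.update (fun j ↦ f j (m j)) i (f i z) := fun z ↦ by
          funext j
          exact Function.apply_update (fun j ↦ f j) m i z j
        rw [h, h, h, map_add, MultilinearMap.map_update_add]
      map_update_smul' := by
        intro _ m i c x
        have h : ∀ z, (fun j ↦ f j (Function.update m i z j)) =
            Function.update (fun j ↦ f j (m j)) i (f i z) := fun z ↦ by
          funext j
          exact Function.apply_update (fun j ↦ f j) m i z j
        rw [h, h, map_smulₛₗ, MultilinearMap.map_update_smul]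
        rfl }
  let l := PiTensorProduct.lift g
  { toFun := l
    map_add' := l.map_add
    map_smul' := fun c x ↦ l.map_smul c x }

theorem piTensorMap_tprod {κ : Type} {M M' : κ → Type u} [∀ i, AddCommGroup (M i)]
    [∀ i, Module B (M i)] [∀ i, AddCommGroup (M' i)] [∀ i, Module B' (M' i)]
    (f : ∀ i, M i →ₛₗ[σ] M' i) (m : ∀ i, M i) :
    piTensorMap f (PiTensorProduct.tprod B m) = PiTensorProduct.tprod B' (fun i ↦ f i (m i)) := by
  let _ : Module B (PiTensorProduct B' M') := Module.compHom _ σ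
  exact PiTensorProduct.lift.tprod _

/-- The determinant of a bilinear form `β : M × N → B` in degree `n`: the linear form
`(x₁ ∧ ⋯ ∧ xₙ) ⊗ (y₁ ∧ ⋯ ∧ yₙ) ↦ det (β(xᵢ, yⱼ))` on `⋀ⁿ M ⊗ ⋀ⁿ N`. It corresponds to
`⋀ⁿ M → ⋀ⁿ (N^∨) → (⋀ⁿ N)^∨`. -/
def detForm (n : ℕ) {N : Type u} [AddCommGroup N] [Module B N] (β : M →ₗ[B] N →ₗ[B] B) :
    Module.Dual B (⋀[B]^n M ⊗[B] ⋀[B]^n N) :=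
  TensorProduct.lift (exteriorPower.pairingDual B N n ∘ₗ exteriorPower.map n β)

theorem detForm_ιMulti (n : ℕ) {N : Type u} [AddCommGroup N] [Module B N]
    (β : M →ₗ[B] N →ₗ[B] B) (x : Fin n → M) (y : Fin n → N) :
    detForm n β (exteriorPower.ιMulti B n x ⊗ₜ exteriorPower.ιMulti B n y) =
      Matrix.det (.of fun i j ↦ β (x i) (y j)) := by
  simp only [detForm, TensorProduct.lift.tmul, LinearMap.comp_apply,
    exteriorPower.map_apply_ιMulti, exteriorPower.pairingDual_ιMulti_ιMulti]
  rw [← Matrix.det_transpose]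
  rfl

theorem detForm_map (n : ℕ) {N N' : Type u} [AddCommGroup N] [Module B N] [AddCommGroup N']
    [Module B' N'] (β : M →ₗ[B] N →ₗ[B] B) (β' : M' →ₗ[B'] N' →ₗ[B'] B') (f : M →ₛₗ[σ] M')
    (g : N →ₛₗ[σ] N') (h : ∀ x y, β' (f x) (g y) = σ (β x y))
    (z : ⋀[B]^n M ⊗[B] ⋀[B]^n N) :
    detForm n β' (TensorProduct.map (extMap n f) (extMap n g) z) = σ (detForm n β z) := by
  induction z with
  | zero => simp
  | add x y hx hy => simp only [map_add, hx, hy]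
  | tmul x y =>
    have hx : x ∈ Submodule.span B (Set.range (exteriorPower.ιMulti B n)) := by
      rw [exteriorPower.ιMulti_span]; trivial
    have hy : y ∈ Submodule.span B (Set.range (exteriorPower.ιMulti B n)) := by
      rw [exteriorPower.ιMulti_span]; trivial
    induction hx using Submodule.span_induction with
    | zero => simp
    | add a b _ _ ha hb => simp only [TensorProduct.add_tmul, map_add, ha, hb]
    | smul c a _ ha => rw [← TensorProduct.smul_tmul', map_smulₛₗ, map_smul, ha, map_smul]; simp
    | mem a ha =>
      induction hy using Submodule.span_induction with
      | zero => simp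
      | add a b _ _ ha hb => simp only [TensorProduct.tmul_add, map_add, ha, hb]
      | smul c a _ ha => rw [TensorProduct.tmul_smul, map_smulₛₗ, map_smul, ha, map_smul]; simp
      | mem b hb =>
        obtain ⟨x, rfl⟩ := ha
        obtain ⟨y, rfl⟩ := hb
        rw [TensorProduct.map_tmul, extMap_ιMulti, extMap_ιMulti, detForm_ιMulti,
          detForm_ιMulti, RingHom.map_det]
        congr 1
        ext i j
        simp [h]

end Semilinear

/-! ## Sheaves of modules on an `R`-scheme, given on affine opens

A quasi-coherent sheaf on `T` is determined by its modules of sections over the affine open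
subschemes together with the restriction maps, and a morphism (an isomorphism) of quasi-coherent
sheaves is a compatible family of linear maps (isomorphisms) over the affine opens. Kernels,
cokernels, finite direct sums, tensor products and exterior powers of quasi-coherent sheaves are
computed on affine opens. -/

section Sheaves

variable {R : Type u} [CommRing R] {T : Scheme.{u}}

/-- The ring `Γ(U, O_T)` for an affine open `U` of the `R`-scheme `t : T ⟶ Spec R`. -/
def Sec (_t : T ⟶ Spec (CommRingCat.of R)) (U : T.affineOpens) : Type u := Γ(T, U.1)

variable (t : T ⟶ Spec (CommRingCat.of R))

instance (U : T.affineOpens) : CommRing (Sec t U) := inferInstanceAs (CommRing Γ(T, U.1))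

/-- The restriction map `Γ(V, O_T) → Γ(U, O_T)`. -/
def resSec {U V : T.affineOpens} (h : U ≤ V) : Sec t V →+* Sec t U :=
  (T.presheaf.map (homOfLE (show U.1 ≤ V.1 from h)).op).hom

/-- The `R`-algebra structure of `Γ(U, O_T)` given by the structure morphism `t`. -/
instance (U : T.affineOpens) : Algebra R (Sec t U) :=
  RingHom.toAlgebra ((t.appLE ⊤ U.1 le_top).hom.comp
    (Scheme.ΓSpecIso (CommRingCat.of R)).inv.hom)

theorem resSec_refl (U : T.affineOpens) (s : Sec t U) : resSec t (le_refl U) s = s := by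
  change (T.presheaf.map (𝟙 _)).hom s = s
  rw [CategoryTheory.Functor.map_id]
  rfl

theorem resSec_trans {U V W : T.affineOpens} (h : U ≤ V) (h' : V ≤ W) (s : Sec t W) :
    resSec t h (resSec t h' s) = resSec t (h.trans h') s := by
  have e : T.presheaf.map (homOfLE (show V.1 ≤ W.1 from h')).op ≫
      T.presheaf.map (homOfLE (show U.1 ≤ V.1 from h)).op =
      T.presheaf.map (homOfLE (show U.1 ≤ W.1 from h.trans h')).op := by
    rw [← Functor.map_comp]
    rfl
  exact congrArg (fun f : Γ(T, W.1) ⟶ Γ(T, U.1) ↦ f.hom s) e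

theorem resSec_algebraMap {U V : T.affineOpens} (h : U ≤ V) (r : R) :
    resSec t h (algebraMap R (Sec t V) r) = algebraMap R (Sec t U) r := by
  have e : t.appLE ⊤ V.1 le_top ≫ T.presheaf.map (homOfLE (show U.1 ≤ V.1 from h)).op =
      t.appLE ⊤ U.1 le_top := Scheme.Hom.appLE_map _ _ _
  exact congrArg (fun f : Γ(Spec (CommRingCat.of R), ⊤) ⟶ Γ(T, U.1) ↦
    f.hom ((Scheme.ΓSpecIso (CommRingCat.of R)).inv.hom r)) e

/-- A presheaf of `O_T`-modules on the affine opens of `T`. -/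
structure AffMod where
  obj : T.affineOpens → Type u
  [addCommGroup : ∀ U, AddCommGroup (obj U)]
  [moduleBase : ∀ U, Module R (obj U)]
  [module : ∀ U, Module (Sec t U) (obj U)]
  [tower : ∀ U, IsScalarTower R (Sec t U) (obj U)]
  res : ∀ {U V : T.affineOpens} (h : U ≤ V), obj V →ₛₗ[resSec t h] obj U
  res_refl : ∀ (U : T.affineOpens) (x : obj U), res (le_refl U) x = x
  res_trans : ∀ {U V W : T.affineOpens} (h : U ≤ V) (h' : V ≤ W) (x : obj W),
    res h (res h' x) = res (h.trans h') x

attribute [instance] AffMod.addCommGroup AffMod.moduleBase AffMod.module AffMod.tower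

variable {t}

namespace AffMod

/-- The restriction maps are `R`-linear. -/
def resBase (M : AffMod t) {U V : T.affineOpens} (h : U ≤ V) : M.obj V →ₗ[R] M.obj U where
  toFun := M.res h
  map_add' := (M.res h).map_add
  map_smul' := fun r x ↦ by
    rw [RingHom.id_apply, ← algebraMap_smul (Sec t V) r x, map_smulₛₗ, resSec_algebraMap,
      algebraMap_smul]

/-- Constructor supplying the induced `R`-module structures. -/
@[reducible] def ofSec (obj : T.affineOpens → Type u) [∀ U, AddCommGroup (obj U)]
    [∀ U, Module (Sec t U) (obj U)]
    (res : ∀ {U V : T.affineOpens} (h : U ≤ V), obj V →ₛₗ[resSec t h] obj U)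
    (res_refl : ∀ (U : T.affineOpens) (x : obj U), res (le_refl U) x = x)
    (res_trans : ∀ {U V W : T.affineOpens} (h : U ≤ V) (h' : V ≤ W) (x : obj W),
      res h (res h' x) = res (h.trans h') x) : AffMod t :=
  letI : ∀ U, Module R (obj U) := fun U ↦ Module.compHom (obj U) (algebraMap R (Sec t U))
  haveI : ∀ U, IsScalarTower R (Sec t U) (obj U) := fun U ↦ ⟨fun r s x ↦ by
    rw [Algebra.smul_def, mul_smul]; rfl⟩
  { obj := obj, res := res, res_refl := res_refl, res_trans := res_trans }

/-- Morphisms. -/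
structure Hom (M N : AffMod t) where
  app : ∀ U, M.obj U →ₗ[Sec t U] N.obj U
  naturality : ∀ {U V : T.affineOpens} (h : U ≤ V) (x : M.obj V),
    app U (M.res h x) = N.res h (app V x)

/-- Isomorphisms. -/
structure Iso (M N : AffMod t) where
  app : ∀ U, M.obj U ≃ₗ[Sec t U] N.obj U
  naturality : ∀ {U V : T.affineOpens} (h : U ≤ V) (x : M.obj V),
    app U (M.res h x) = N.res h (app V x)

variable (t) in
/-- The structure sheaf. -/
def structureSheaf : AffMod t where
  obj := fun U ↦ Sec t U
  res := fun h ↦ (resSec t h).toSemilinearMap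
  res_refl := resSec_refl t
  res_trans := resSec_trans t

/-- The kernel of a morphism. -/
def ker {M N : AffMod t} (f : Hom M N) : AffMod t where
  obj := fun U ↦ LinearMap.ker (f.app U)
  res := fun {U V} h ↦
    { toFun := fun x ↦ ⟨M.res h x.1, by
        rw [LinearMap.mem_ker, f.naturality, LinearMap.mem_ker.1 x.2, map_zero]⟩
      map_add' := fun x y ↦ Subtype.ext ((M.res h).map_add x.1 y.1)
      map_smul' := fun c x ↦ Subtype.ext ((M.res h).map_smulₛₗ c x.1) }
  res_refl := fun U x ↦ Subtype.ext (M.res_refl U x.1)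
  res_trans := fun h h' x ↦ Subtype.ext (M.res_trans h h' x.1)

/-- The inclusion of the kernel. -/
def kerIncl {M N : AffMod t} (f : Hom M N) : Hom (ker f) M where
  app := fun U ↦ (LinearMap.ker (f.app U)).subtype
  naturality := fun _ _ ↦ rfl

/-- The cokernel of a morphism. -/
def coker {M N : AffMod t} (f : Hom M N) : AffMod t where
  obj := fun U ↦ N.obj U ⧸ LinearMap.range (f.app U)
  res := fun {U V} h ↦ Submodule.mapQ _ _ (N.res h) (by
    rintro _ ⟨x, rfl⟩
    exact ⟨M.res h x, f.naturality h x⟩)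
  res_refl := fun U x ↦ by
    obtain ⟨x, rfl⟩ := Submodule.Quotient.mk_surjective _ x
    exact congrArg _ (N.res_refl U x)
  res_trans := fun h h' x ↦ by
    obtain ⟨x, rfl⟩ := Submodule.Quotient.mk_surjective _ x
    exact congrArg _ (N.res_trans h h' x)

/-- A finite direct sum, realised as a product. -/
def directSum {κ : Type} [Finite κ] (M : κ → AffMod t) : AffMod t where
  obj := fun U ↦ ∀ i, (M i).obj U
  res := fun h ↦
    { toFun := fun x i ↦ (M i).res h (x i)
      map_add' := fun _ _ ↦ funext fun i ↦ ((M i).res h).map_add _ _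
      map_smul' := fun _ _ ↦ funext fun i ↦ ((M i).res h).map_smulₛₗ _ _ }
  res_refl := fun U x ↦ funext fun i ↦ (M i).res_refl U (x i)
  res_trans := fun h h' x ↦ funext fun i ↦ (M i).res_trans h h' (x i)

/-- The tensor product over `O_T`. -/
def tensor (M N : AffMod t) : AffMod t :=
  ofSec (fun U ↦ M.obj U ⊗[Sec t U] N.obj U)
    (fun h ↦ TensorProduct.map (M.res h) (N.res h))
    (fun U x ↦ by
      induction x with
      | zero => simp
      | add x y hx hy => rw [map_add, hx, hy]
      | tmul x y => rw [TensorProduct.map_tmul, M.res_refl, N.res_refl])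
    (fun h h' x ↦ by
      induction x with
      | zero => simp
      | add x y hx hy => simp only [map_add, hx, hy]
      | tmul x y => simp only [TensorProduct.map_tmul, M.res_trans, N.res_trans])

/-- The exterior power `⋀ⁿ M`; for `M` locally free of rank `n` it is `det M`. -/
def ext (n : ℕ) (M : AffMod t) : AffMod t :=
  ofSec (fun U ↦ ⋀[Sec t U]^n (M.obj U))
    (fun h ↦ extMap n (M.res h))
    (fun U x ↦ by
      have hx : x ∈ Submodule.span (Sec t U) (Set.range (exteriorPower.ιMulti (Sec t U) n)) := by
        rw [exteriorPower.ιMulti_span]; trivial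
      induction hx using Submodule.span_induction with
      | zero => simp
      | add a b _ _ ha hb => rw [map_add, ha, hb]
      | smul c a _ ha => rw [map_smulₛₗ, ha, resSec_refl]
      | mem a ha =>
        obtain ⟨m, rfl⟩ := ha
        simp only [extMap_ιMulti, M.res_refl])
    (fun {U V W} h h' x ↦ by
      have hx : x ∈ Submodule.span (Sec t W) (Set.range (exteriorPower.ιMulti (Sec t W) n)) := by
        rw [exteriorPower.ιMulti_span]; trivial
      induction hx using Submodule.span_induction with
      | zero => simp
      | add a b _ _ ha hb => simp only [map_add, ha, hb]
      | smul c a _ ha => simp only [map_smulₛₗ, ha, resSec_trans]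
      | mem a ha =>
        obtain ⟨m, rfl⟩ := ha
        simp only [extMap_ιMulti, M.res_trans])

/-- The tensor product over `O_T` of a finite family. -/
def bigTensor {κ : Type} [Finite κ] (M : κ → AffMod t) : AffMod t :=
  ofSec (fun U ↦ PiTensorProduct (Sec t U) (fun i ↦ (M i).obj U))
    (fun h ↦ piTensorMap (fun i ↦ (M i).res h))
    (fun U x ↦ by
      induction x using PiTensorProduct.induction_on with
      | smul_tprod r m =>
        simp only [map_smulₛₗ, piTensorMap_tprod, resSec_refl, (M _).res_refl]
      | add x y hx hy => rw [map_add, hx, hy])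
    (fun h h' x ↦ by
      induction x using PiTensorProduct.induction_on with
      | smul_tprod r m =>
        simp only [map_smulₛₗ, piTensorMap_tprod, resSec_trans, (M _).res_trans]
      | add x y hx hy => simp only [map_add, hx, hy])

/-- Sections over `U` of the dual sheaf `Hom(M, O_T)`: compatible families of linear forms on the
sections of `M` over all affine opens contained in `U`. -/
@[ext]
structure DualSec (M : AffMod t) (U : T.affineOpens) where
  form : ∀ W : T.affineOpens, W ≤ U → Module.Dual (Sec t W) (M.obj W)
  compat : ∀ {W W' : T.affineOpens} (h : W' ≤ W) (hW : W ≤ U) (x : M.obj W),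
    form W' (h.trans hW) (M.res h x) = resSec t h (form W hW x)

namespace DualSec

variable {M : AffMod t} {U : T.affineOpens}

instance : Zero (DualSec M U) := ⟨⟨fun _ _ ↦ 0, fun _ _ _ ↦ by simp⟩⟩

instance : Add (DualSec M U) :=
  ⟨fun φ ψ ↦ ⟨fun W hW ↦ φ.form W hW + ψ.form W hW, fun h hW x ↦ by
    simp only [LinearMap.add_apply, φ.compat h hW, ψ.compat h hW, map_add]⟩⟩

instance : Neg (DualSec M U) := ⟨fun φ ↦ ⟨fun W hW ↦ -φ.form W hW, fun h hW x ↦ by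
    simp only [LinearMap.neg_apply, φ.compat h hW, map_neg]⟩⟩

instance : SMul (Sec t U) (DualSec M U) :=
  ⟨fun s φ ↦ ⟨fun W hW ↦ resSec t hW s • φ.form W hW, fun h hW x ↦ by
    simp only [LinearMap.smul_apply, smul_eq_mul, φ.compat h hW, map_mul, resSec_trans]⟩⟩

@[simp] theorem zero_form (W : T.affineOpens) (hW : W ≤ U) : (0 : DualSec M U).form W hW = 0 := rfl

@[simp] theorem add_form (φ ψ : DualSec M U) (W : T.affineOpens) (hW : W ≤ U) :
    (φ + ψ).form W hW = φ.form W hW + ψ.form W hW := rfl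

@[simp] theorem neg_form (φ : DualSec M U) (W : T.affineOpens) (hW : W ≤ U) :
    (-φ).form W hW = -φ.form W hW := rfl

@[simp] theorem smul_form (s : Sec t U) (φ : DualSec M U) (W : T.affineOpens) (hW : W ≤ U) :
    (s • φ).form W hW = resSec t hW s • φ.form W hW := rfl

theorem ext' {φ ψ : DualSec M U} (h : ∀ W hW, φ.form W hW = ψ.form W hW) : φ = ψ :=
  DualSec.ext (funext fun W ↦ funext fun hW ↦ h W hW)

instance : AddCommGroup (DualSec M U) where
  add_assoc := fun a b c ↦ ext' fun W hW ↦ by simp [add_assoc]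
  zero_add := fun a ↦ ext' fun W hW ↦ by simp
  add_zero := fun a ↦ ext' fun W hW ↦ by simp
  neg_add_cancel := fun a ↦ ext' fun W hW ↦ by simp
  add_comm := fun a b ↦ ext' fun W hW ↦ by simp [add_comm]
  nsmul := nsmulRec
  zsmul := zsmulRec

instance : Module (Sec t U) (DualSec M U) where
  one_smul := fun a ↦ ext' fun W hW ↦ by simp
  mul_smul := fun r s a ↦ ext' fun W hW ↦ by simp [mul_smul]
  smul_zero := fun r ↦ ext' fun W hW ↦ by simp
  smul_add := fun r a b ↦ ext' fun W hW ↦ by simp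
  add_smul := fun r s a ↦ ext' fun W hW ↦ by simp [add_smul]
  zero_smul := fun a ↦ ext' fun W hW ↦ by simp

end DualSec

/-- The dual sheaf `M^∨ = Hom(M, O_T)`. -/
def dual (M : AffMod t) : AffMod t :=
  ofSec (fun U ↦ DualSec M U)
    (fun h ↦
      { toFun := fun φ ↦ ⟨fun W hW ↦ φ.form W (hW.trans h), fun h' hW x ↦ φ.compat h' _ x⟩
        map_add' := fun _ _ ↦ rfl
        map_smul' := fun s φ ↦ DualSec.ext' fun W hW ↦ by simp [resSec_trans] })
    (fun _ _ ↦ rfl) (fun _ _ _ ↦ rfl)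

/-- `M ⊗_R V` for an `R`-module `V`. -/
def tensorBase (V : Type u) [AddCommGroup V] [Module R V] (M : AffMod t) : AffMod t where
  obj := fun U ↦ M.obj U ⊗[R] V
  res := fun h ↦
    { toFun := TensorProduct.map (M.resBase h) LinearMap.id
      map_add' := map_add _
      map_smul' := fun c x ↦ by
        induction x with
        | zero => simp
        | add x y hx hy => simp only [smul_add, map_add, hx, hy]
        | tmul x y =>
          simp only [TensorProduct.smul_tmul', TensorProduct.map_tmul]
          exact congrArg (· ⊗ₜ[R] y) ((M.res h).map_smulₛₗ c x) }
  res_refl := fun U x ↦ by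
    change TensorProduct.map (M.resBase _) LinearMap.id x = x
    induction x with
    | zero => simp
    | add x y hx hy => simp only [map_add, hx, hy]
    | tmul x y => exact congrArg (· ⊗ₜ[R] y) (M.res_refl U x)
  res_trans := fun h h' x ↦ by
    change TensorProduct.map (M.resBase _) LinearMap.id
      (TensorProduct.map (M.resBase _) LinearMap.id x) =
        TensorProduct.map (M.resBase _) LinearMap.id x
    induction x with
    | zero => simp
    | add x y hx hy => simp only [map_add, hx, hy]
    | tmul x y => exact congrArg (· ⊗ₜ[R] y) (M.res_trans h h' x)

/-- `V^∨ ⊗_R M` for an `R`-module `V` (the factors are written in the order `M ⊗ V^∨`). -/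
def twist (V : Type u) [AddCommGroup V] [Module R V] (M : AffMod t) : AffMod t :=
  tensorBase (Module.Dual R V) M

/-- The coaction of `H` on `V^∨ ⊗_R M` induced by the contragredient action on `V^∨` and the
trivial action on `M`. -/
def twistCoact {H : Type u} [CommRing H] [HopfAlgebra R H] (V : Comod R H)
    [Module.Finite R V.carrier] [Module.Projective R V.carrier] (M : AffMod t)
    (U : T.affineOpens) :
    (twist V.carrier M).obj U →ₗ[R] (twist V.carrier M).obj U ⊗[R] H :=
  show M.obj U ⊗[R] Module.Dual R V.carrier →ₗ[R]
      (M.obj U ⊗[R] Module.Dual R V.carrier) ⊗[R] H from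
    (TensorProduct.assoc R (M.obj U) (Module.Dual R V.carrier) H).symm.toLinearMap ∘ₗ
      (dualCoact V).lTensor (M.obj U)

/-- The coaction of `H` on a direct sum. -/
def directSumCoact {H : Type u} [CommRing H] [HopfAlgebra R H] {κ : Type} [Fintype κ]
    [DecidableEq κ] (M : κ → AffMod t) (U : T.affineOpens)
    (ρ : ∀ i, (M i).obj U →ₗ[R] (M i).obj U ⊗[R] H) :
    (directSum M).obj U →ₗ[R] (directSum M).obj U ⊗[R] H :=
  show (∀ i, (M i).obj U) →ₗ[R] (∀ i, (M i).obj U) ⊗[R] H from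
    ∑ i, (LinearMap.single R (fun i ↦ (M i).obj U) i).rTensor H ∘ₗ ρ i ∘ₗ LinearMap.proj i

/-- A bilinear pairing `M × N → O_T`, i.e. a morphism `M ⊗ N → O_T`. -/
structure Pairing (M N : AffMod t) where
  form : ∀ U, M.obj U →ₗ[Sec t U] N.obj U →ₗ[Sec t U] Sec t U
  compat : ∀ {U V : T.affineOpens} (h : U ≤ V) (x : M.obj V) (y : N.obj V),
    form U (M.res h x) (N.res h y) = resSec t h (form V x y)

/-- The map `N → M^∨`, `y ↦ β(-, y)`, induced by a pairing `β`. -/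
def Pairing.toDual {M N : AffMod t} (β : Pairing M N) : Hom N (dual M) where
  app := fun U ↦
    { toFun := fun y ↦ ⟨fun W hW ↦ (β.form W).flip (N.res hW y), fun h hW x ↦ by
        rw [← N.res_trans h hW]
        exact β.compat h x (N.res hW y)⟩
      map_add' := fun x y ↦ DualSec.ext' fun W hW ↦ by
        change (β.form W).flip (N.res hW (x + y)) =
          (β.form W).flip (N.res hW x) + (β.form W).flip (N.res hW y)
        rw [map_add, map_add]
      map_smul' := fun c x ↦ DualSec.ext' fun W hW ↦ by
        change (β.form W).flip (N.res hW (c • x)) =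
          resSec t hW c • (β.form W).flip (N.res hW x)
        rw [map_smulₛₗ, map_smul] }
  naturality := fun h x ↦ DualSec.ext' fun W hW ↦ by
    change (β.form W).flip (N.res hW (N.res h x)) = (β.form W).flip (N.res (hW.trans h) x)
    rw [N.res_trans]

/-- The determinant of `N → M^∨`, for `M` and `N` of rank `n`: the section over `U` of
`(det M ⊗ det N)^∨` given by `(x₁ ∧ ⋯ ∧ xₙ) ⊗ (y₁ ∧ ⋯ ∧ yₙ) ↦ det (β(xᵢ, yⱼ))`. -/
def Pairing.det {M N : AffMod t} (β : Pairing M N) (n : ℕ) (U : T.affineOpens) :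
    (dual ((ext n M).tensor (ext n N))).obj U :=
  show DualSec ((ext n M).tensor (ext n N)) U from
    ⟨fun W _ ↦ detForm n (β.form W), fun h _ z ↦
      detForm_map n _ _ (M.res h) (N.res h) (fun x y ↦ β.compat h x y) z⟩

end AffMod

end Sheaves

/-! ## Locally free sheaves of algebras with an action of `G` -/

section Algebras

variable {R : Type u} [CommRing R] {T : Scheme.{u}} (t : T ⟶ Spec (CommRingCat.of R))

/-- A quasi-coherent sheaf of commutative `O_T`-algebras that is locally free of finite rank as a
sheaf of modules, i.e. a cover `f : X = Spec A → T` with `A = f_* O_X`. -/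
structure LocFreeAlg where
  obj : T.affineOpens → Type u
  [commRing : ∀ U, CommRing (obj U)]
  [algebraBase : ∀ U, Algebra R (obj U)]
  [algebra : ∀ U, Algebra (Sec t U) (obj U)]
  [tower : ∀ U, IsScalarTower R (Sec t U) (obj U)]
  [finite : ∀ U, Module.Finite (Sec t U) (obj U)]
  [projective : ∀ U, Module.Projective (Sec t U) (obj U)]
  res : ∀ {U V : T.affineOpens} (_ : U ≤ V), obj V →+* obj U
  res_algebraMap : ∀ {U V : T.affineOpens} (h : U ≤ V) (s : Sec t V),
    res h (algebraMap (Sec t V) (obj V) s) = algebraMap (Sec t U) (obj U) (resSec t h s)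
  res_refl : ∀ (U : T.affineOpens) (x : obj U), res (le_refl U) x = x
  res_trans : ∀ {U V W : T.affineOpens} (h : U ≤ V) (h' : V ≤ W) (x : obj W),
    res h (res h' x) = res (h.trans h') x
  quasiCoherent : ∀ {U V : T.affineOpens} (h : U ≤ V),
    IsBaseChangeAlong (σ := resSec t h)
      { toFun := res h
        map_add' := map_add (res h)
        map_smul' := fun s x ↦ by
          rw [Algebra.smul_def, map_mul, res_algebraMap, ← Algebra.smul_def] }

attribute [instance] LocFreeAlg.commRing LocFreeAlg.algebraBase LocFreeAlg.algebra
  LocFreeAlg.tower LocFreeAlg.finite LocFreeAlg.projective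

variable {t}

/-- The underlying sheaf of modules. -/
def LocFreeAlg.toMod (A : LocFreeAlg t) : AffMod t where
  obj := A.obj
  res := fun h ↦
    { toFun := A.res h
      map_add' := map_add (A.res h)
      map_smul' := fun s x ↦ by
        rw [Algebra.smul_def, map_mul, A.res_algebraMap, ← Algebra.smul_def] }
  res_refl := A.res_refl
  res_trans := A.res_trans

/-- The restriction maps are `R`-linear. -/
def LocFreeAlg.resBase (A : LocFreeAlg t) {U V : T.affineOpens} (h : U ≤ V) :
    A.obj V →ₗ[R] A.obj U :=
  A.toMod.resBase h

theorem LocFreeAlg.trace_res (A : LocFreeAlg t) {U V : T.affineOpens} (h : U ≤ V) (a : A.obj V) :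
    algTrace (Sec t U) (A.obj U) (A.res h a) =
      resSec t h (algTrace (Sec t V) (A.obj V) a) :=
  projTrace_baseChange (A.quasiCoherent h) _ _ fun m ↦ ((A.res h).map_mul a m).symm

/-- The trace map `tr_A : A → O_T`. -/
def LocFreeAlg.trace (A : LocFreeAlg t) : AffMod.Hom A.toMod (AffMod.structureSheaf t) where
  app := fun U ↦ algTrace (Sec t U) (A.obj U)
  naturality := fun h a ↦ A.trace_res h a

/-- The trace pairing `(x, y) ↦ tr_A(x y)`. -/
def LocFreeAlg.tracePairing (A : LocFreeAlg t) : AffMod.Pairing A.toMod A.toMod where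
  form := fun U ↦ (LinearMap.mul (Sec t U) (A.obj U)).compr₂ (algTrace (Sec t U) (A.obj U))
  compat := fun {U V} h x y ↦
    (congrArg (algTrace (Sec t U) (A.obj U)) ((A.res h).map_mul x y).symm).trans
      (A.trace_res h _)

/-- The trace cokernel `Q_A`: the cokernel of `A → A^∨`, `x ↦ tr_A(x · -)`. -/
def LocFreeAlg.Q (A : LocFreeAlg t) : AffMod t := AffMod.coker A.tracePairing.toDual

variable (H : Type u) [CommRing H] [HopfAlgebra R H] (t) in
/-- An object of `LAlg^G T`, where `G = Spec H`: a locally free sheaf of algebras with an action of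
`G`, i.e. a coaction `A → A ⊗ H` by algebra homomorphisms. -/
structure EquivAlg extends LocFreeAlg t where
  coact : ∀ U, obj U →ₐ[Sec t U] obj U ⊗[R] H
  coact_res : ∀ {U V : T.affineOpens} (h : U ≤ V) (a : obj V),
    coact U (res h a) = (toLocFreeAlg.resBase h).rTensor H (coact V a)
  coassoc : ∀ U (a : obj U),
    TensorProduct.assoc R (obj U) H H
      (((coact U).toLinearMap.restrictScalars R).rTensor H (coact U a)) =
      (Coalgebra.comul (R := R) (A := H)).lTensor (obj U) (coact U a)
  counit : ∀ U (a : obj U),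
    TensorProduct.rid R (obj U)
      ((Coalgebra.counit (R := R) (A := H)).lTensor (obj U) (coact U a)) = a

namespace EquivAlg

variable {H : Type u} [CommRing H] [HopfAlgebra R H] (A : EquivAlg t H)

/-- `A^G = O_T`: the structure map `O_T → A` identifies `O_T` with the invariants. -/
def InvEqBase : Prop :=
  ∀ U, Function.Injective (algebraMap (Sec t U) (A.obj U)) ∧
    ∀ a : A.obj U, a ∈ invAlg (A.coact U).toLinearMap ↔
      ∃ s, algebraMap (Sec t U) (A.obj U) s = a

/-- `A` has rank `n` at every point of `T`. -/
def HasRank (n : ℕ) : Prop :=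
  ∀ U (p : PrimeSpectrum (Sec t U)), Module.rankAtStalk (A.obj U) p = n

/-- `Spec A → T` is a `G`-cover: fppf locally `A` is isomorphic, as a comodule, to the regular
representation `R[G] ⊗ O_T`. Over an affine open, an fppf covering is refined by a single
faithfully flat finitely presented algebra `C`. -/
def IsGCover : Prop :=
  ∀ U, ∃ (C : Type u) (_ : CommRing C) (_ : Algebra R C) (_ : Algebra (Sec t U) C)
    (_ : IsScalarTower R (Sec t U) C),
    Module.FaithfullyFlat (Sec t U) C ∧ Algebra.FinitePresentation (Sec t U) C ∧
    ∃ e : C ⊗[Sec t U] A.obj U ≃ₗ[C] C ⊗[R] H, ∀ x : C ⊗[Sec t U] A.obj U,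
      (e.toLinearMap.restrictScalars R).rTensor H
        ((AlgebraTensorModule.assoc R (Sec t U) C C (A.obj U) H).symm
          ((A.coact U).toLinearMap.lTensor C x)) =
      (TensorProduct.assoc R C H H).symm
        ((Coalgebra.comul (R := R) (A := H)).lTensor C (e x))

theorem diagCoact_res {V : Type u} [AddCommGroup V] [Module R V] (ρ : V →ₗ[R] V ⊗[R] H)
    {U W : T.affineOpens} (h : U ≤ W) (x : A.obj W ⊗[R] V) :
    diagCoact (A.coact U).toLinearMap ρ ((A.resBase h).rTensor V x) =
      ((A.resBase h).rTensor V).rTensor H (diagCoact (A.coact W).toLinearMap ρ x) := by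
  have e : ∀ (s : A.obj W ⊗[R] H) (z : V ⊗[R] H),
      AlgebraTensorModule.map (LinearMap.id : A.obj U ⊗[R] V →ₗ[Sec t U] A.obj U ⊗[R] V)
          (LinearMap.mul' R H)
        (AlgebraTensorModule.tensorTensorTensorComm R R R (Sec t U) (A.obj U) H V H
          ((A.resBase h).rTensor H s ⊗ₜ[R] z)) =
      ((A.resBase h).rTensor V).rTensor H
        (AlgebraTensorModule.map (LinearMap.id : A.obj W ⊗[R] V →ₗ[Sec t W] A.obj W ⊗[R] V)
          (LinearMap.mul' R H)
        (AlgebraTensorModule.tensorTensorTensorComm R R R (Sec t W) (A.obj W) H V H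
          (s ⊗ₜ[R] z))) := by
    intro s z
    induction s with
    | zero => simp
    | add a b ha hb => simp only [TensorProduct.add_tmul, map_add, ha, hb]
    | tmul a k =>
      induction z with
      | zero => simp
      | add a b ha hb => simp only [TensorProduct.tmul_add, map_add, ha, hb]
      | tmul v l => simp
  induction x with
  | zero => simp
  | add a b ha hb => simp only [map_add, ha, hb]
  | tmul a v =>
    have := e (A.coact W a) (ρ v)
    rw [← A.coact_res h a] at this
    exact this

theorem rTensor_smul {V : Type u} [AddCommGroup V] [Module R V] {U W : T.affineOpens} (h : U ≤ W)
    (c : Sec t W) (x : A.obj W ⊗[R] V) :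
    (A.resBase h).rTensor V (c • x) = resSec t h c • (A.resBase h).rTensor V x := by
  induction x with
  | zero => simp
  | add x y hx hy => simp only [smul_add, map_add, hx, hy]
  | tmul x y =>
    rw [TensorProduct.smul_tmul', LinearMap.rTensor_tmul, LinearMap.rTensor_tmul,
      TensorProduct.smul_tmul']
    exact congrArg (· ⊗ₜ[R] y) ((A.toMod.res h).map_smulₛₗ c x)

/-- `Ω_V = (A ⊗ V)^G` for a representation `(V, ρ)`. -/
def Omega (V : Type u) [AddCommGroup V] [Module R V] (ρ : V →ₗ[R] V ⊗[R] H) : AffMod t where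
  obj := fun U ↦ invTensor (A.coact U).toLinearMap ρ
  res := fun {U W} h ↦
    { toFun := fun x ↦ ⟨(A.resBase h).rTensor V x.1, by
        have hx : diagCoact (A.coact W).toLinearMap ρ x.1 = x.1 ⊗ₜ[R] (1 : H) := x.2
        change diagCoact _ _ _ = _
        rw [diagCoact_res, hx, LinearMap.rTensor_tmul]⟩
      map_add' := fun x y ↦ Subtype.ext (map_add _ x.1 y.1)
      map_smul' := fun c x ↦
        Subtype.ext (A.rTensor_smul h c x.1) }
  res_refl := fun U x ↦ Subtype.ext ((A.toMod.tensorBase V).res_refl U x.1)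
  res_trans := fun h h' x ↦ Subtype.ext ((A.toMod.tensorBase V).res_trans h h' x.1)

/-- The kernel of the trace. -/
def kerTrace : AffMod t := AffMod.ker A.trace

variable {A}

/-- The isomorphism `O_T ≃ A^G`, on sections. -/
def InvEqBase.equiv (hA : A.InvEqBase) (U : T.affineOpens) :
    Sec t U ≃ₗ[Sec t U] invAlg (A.coact U).toLinearMap :=
  LinearEquiv.ofBijective
    ((Algebra.linearMap (Sec t U) (A.obj U)).codRestrict _
      fun s ↦ ((hA U).2 _).2 ⟨s, rfl⟩)
    ⟨fun s s' h ↦ (hA U).1 (congrArg Subtype.val h), fun a ↦ by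
      obtain ⟨s, hs⟩ := ((hA U).2 _).1 a.2
      exact ⟨s, Subtype.ext hs⟩⟩

theorem InvEqBase.algebraMap_symm (hA : A.InvEqBase) (U : T.affineOpens)
    (a : invAlg (A.coact U).toLinearMap) :
    algebraMap (Sec t U) (A.obj U) ((hA.equiv U).symm a) = a.1 :=
  congrArg Subtype.val ((hA.equiv U).apply_symm_apply a)

/-- The pairing `ω_V` on sections over `U`. -/
def omegaForm (hA : A.InvEqBase) (V : Comod R H) [Module.Finite R V.carrier]
    [Module.Projective R V.carrier] (U : T.affineOpens) :
    invTensor (A.coact U).toLinearMap V.coact →ₗ[Sec t U]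
      invTensor (A.coact U).toLinearMap (dualCoact V) →ₗ[Sec t U] Sec t U :=
  LinearMap.mk₂ (Sec t U)
    (fun x y ↦ (hA.equiv U).symm
      ⟨mulEval (Sec t U) V.carrier x.1 y.1, mulEval_equivariant (A.coact U) V x.2 y.2⟩)
    (fun x x' y ↦ by
      rw [← map_add]
      exact congrArg _ (Subtype.ext (by simp)))
    (fun c x y ↦ by
      rw [← map_smul]
      exact congrArg _ (Subtype.ext (by simp)))
    (fun x y y' ↦ by
      rw [← map_add]
      exact congrArg _ (Subtype.ext (by simp)))
    (fun c x y ↦ by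
      rw [← map_smul]
      exact congrArg _ (Subtype.ext (by simp)))

theorem algebraMap_omegaForm (hA : A.InvEqBase) (V : Comod R H) [Module.Finite R V.carrier]
    [Module.Projective R V.carrier] (U : T.affineOpens)
    (x : invTensor (A.coact U).toLinearMap V.coact)
    (y : invTensor (A.coact U).toLinearMap (dualCoact V)) :
    algebraMap (Sec t U) (A.obj U) (omegaForm hA V U x y) =
      mulEval (Sec t U) V.carrier x.1 y.1 :=
  hA.algebraMap_symm U _

/-- The pairing `ω_V : Ω_V ⊗ Ω_{V^∨} → Ω_{V ⊗ V^∨} → Ω_R = A^G ≃ O_T`, given by multiplication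
in `A` and evaluation `V ⊗ V^∨ → R`. -/
def omega (hA : A.InvEqBase) (V : Comod R H) [Module.Finite R V.carrier]
    [Module.Projective R V.carrier] :
    AffMod.Pairing (A.Omega V.carrier V.coact)
      (A.Omega (Module.Dual R V.carrier) (dualCoact V)) where
  form := fun U ↦ omegaForm hA V U
  compat := fun {U W} h x y ↦ by
    apply (hA U).1
    rw [← A.res_algebraMap]
    refine (algebraMap_omegaForm hA V U _ _).trans
      (Eq.trans ?_ (congrArg (A.res h) (algebraMap_omegaForm hA V W x y)).symm)
    change mulEval (Sec t U) V.carrier ((A.resBase h).rTensor _ x.1)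
      ((A.resBase h).rTensor _ y.1) = A.resBase h (mulEval (Sec t W) V.carrier x.1 y.1)
    generalize x.1 = x'
    generalize y.1 = y'
    induction x' with
    | zero => simp
    | add a b ha hb => simp only [map_add, LinearMap.add_apply, ha, hb]
    | tmul a v =>
      induction y' with
      | zero => simp
      | add a b ha hb => simp only [map_add, ha, hb]
      | tmul b φ =>
        rw [LinearMap.rTensor_tmul, LinearMap.rTensor_tmul, mulEval_tmul, mulEval_tmul, map_smul]
        exact congrArg _ ((A.res h).map_mul a b).symm

/-- `Q_{A,V}`: the cokernel of `ξ_V : Ω_{V^∨} → (Ω_V)^∨`, the map induced by `ω_V`. -/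
def QV (hA : A.InvEqBase) (V : Comod R H) [Module.Finite R V.carrier]
    [Module.Projective R V.carrier] : AffMod t :=
  AffMod.coker (omega hA V).toDual

variable (A)

/-- The invertible sheaf `(det A)^{-2} = (det A ⊗ det A)^∨`, for `A` of rank `n`. -/
def discrSheaf (n : ℕ) : AffMod t :=
  AffMod.dual ((AffMod.ext n A.toMod).tensor (AffMod.ext n A.toMod))

/-- The discriminant section `s_f` of `(det A)^{-2}`: the determinant of `A → A^∨`,
`x ↦ tr_A(x · -)`. -/
def discr (n : ℕ) (U : T.affineOpens) : (A.discrSheaf n).obj U := A.tracePairing.det n U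

/-- The invertible sheaf `(det Ω_V ⊗ det Ω_{V^∨})^{-1}`, where `Ω_V` and `Ω_{V^∨}` have
rank `rk V`. -/
def discrSheafV (V : Comod R H) [Module.Finite R V.carrier] [Module.Projective R V.carrier] :
    AffMod t :=
  AffMod.dual ((AffMod.ext (Module.finrank R V.carrier) (A.Omega V.carrier V.coact)).tensor
    (AffMod.ext (Module.finrank R V.carrier)
      (A.Omega (Module.Dual R V.carrier) (dualCoact V))))

variable {A}

/-- The section `s_{f,V}` of `(det Ω_V ⊗ det Ω_{V^∨})^{-1}`: the determinant of `ξ_V`. -/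
def discrV (hA : A.InvEqBase) (V : Comod R H) [Module.Finite R V.carrier]
    [Module.Projective R V.carrier] (U : T.affineOpens) : (A.discrSheafV V).obj U :=
  (omega hA V).det (Module.finrank R V.carrier) U

end EquivAlg

end Algebras

end

end GCov

/-!
Since `R` is local, each `V ∈ I_G` is free, and in a basis it is given by a matrix `c` of elements
of `R[G]` with `Δ c = c ⊗ c` and `ε c = 1`. The decomposition of the regular representation says that
the entries of these matrices form a basis of `R[G]` (`GoodLinearlyReductive.matrixBasis`), so
`rk G = ∑ (rk V)²`, and the antipode is an involution, so that the entries of the dual matrices form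
a basis as well. A basis of `R[G]` of this kind decomposes every comodule explicitly, by taking
coefficients of its coaction (`MatrixBasis.proj`). Applied to `A`, where the covariants
`Ω_V = (A ⊗ V)^G` are the families of elements transforming by the dual matrix of `V`
(`omegaEquiv`), this gives `A = ⨁ V^∨ ⊗ Ω_V` and, with the dual basis, `A = ⨁ V ⊗ Ω_{V^∨}`, with
explicit inclusions and projections compatible with restriction.

The trace of `A` is equivariant (`algTrace_coact`), because it is invariant under the automorphism
`a ⊗ h ↦ α(a) (1 ⊗ h)` of `A ⊗ R[G]`. Hence it kills the nontrivial isotypic components. On the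
regular representation this says that the trace is divisible by `rk G`; as `R[G]` is étale, it
contains an element of trace `1`, so `rk G` is a unit in `R`, and Schur's lemma then shows that the
ranks of the `V` are units too. On the trivial component `A^G = O_T` the trace is multiplication
by `rk G`, so its kernel is the sum of the other components, which is the first assertion.

By Schur's lemma for the matrices `tr(a_k b_l)`, the trace pairing is the orthogonal sum, over the
basis vectors of all `V`, of the pairings `ω_V` times the unit `rk G / rk V`
(`MatrixBasis.card_mul_algTrace_mul`); rescaling the second decomposition removes the factor
(`GoodLinearlyReductive.isOrthogonalSum`). The cokernel of an orthogonal sum is the sum of the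
cokernels (`AffMod.Pairing.IsOrthogonalSum.cokerIso`), which is the second assertion.

The determinant of an orthogonal sum is the product of the determinants. To turn this into an
isomorphism of invertible sheaves that are only given by their sections over affine opens, both sides
are expanded along partitions of unity consisting of determinants of pairings
(`AffMod.ProductLine.exists_iso`); the isomorphism is characterized by its values on products of
sections, hence does not depend on these choices. What is needed is that the sheaves `Ω_V` are
locally free of rank `rk V` (`rankAtStalk_invTensor`): after the faithfully flat base change that
identifies `A` with the regular representation, `Ω_V` becomes the span of a column of `c`. The top
exterior power of a projective module of constant rank satisfies `φ(x) y = φ(y) x` for all linear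
forms `φ` (`evalSymmetric_exteriorPower`), and this replaces invertibility.
-/

set_option linter.unusedSectionVars false

namespace GCov

noncomputable section

/-! ### Isotypic decomposition of a comodule -/

section Isotypic

variable {R H : Type*} [CommRing R] [CommRing H] [HopfAlgebra R H]
variable {B M : Type*} [CommRing B] [Algebra R B] [AddCommGroup M] [Module R M] [Module B M]
  [IsScalarTower R B M]

/-- The comodule axioms for a `B`-linear coaction of `H` on a `B`-module. -/
structure IsCoaction (α : M →ₗ[B] M ⊗[R] H) : Prop where
  coassoc : ∀ a, TensorProduct.assoc R M H H ((α.restrictScalars R).rTensor H (α a)) =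
    (Coalgebra.comul (R := R) (A := H)).lTensor M (α a)
  counit : ∀ a, TensorProduct.rid R M
    ((Coalgebra.counit (R := R) (A := H)).lTensor M (α a)) = a

/-- A matrix `c` with `Δ c = c ⊗ c` (matrix product) and `ε c = 1`: the matrix of a comodule that
is free as an `R`-module, so that the basis vectors coact by `e k ↦ ∑ l, e l ⊗ c l k`. -/
structure IsMulMatrix (R : Type*) {H : Type*} [CommRing R] [CommRing H] [HopfAlgebra R H]
    {κ : Type*} [Fintype κ] [DecidableEq κ] (c : Matrix κ κ H) : Prop where
  comul : ∀ k l, Coalgebra.comul (R := R) (c k l) = ∑ m, c k m ⊗ₜ[R] c m l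
  counit : ∀ k l, Coalgebra.counit (R := R) (c k l) = (1 : Matrix κ κ R) k l

/-- The families `b` in `M` that transform by the matrix `c`, i.e. the equivariant maps into `M`
from the comodule with matrix `c`, recorded by the images of the basis vectors. -/
def isoVec {κ : Type*} [Fintype κ] (α : M →ₗ[B] M ⊗[R] H) (c : Matrix κ κ H) :
    Submodule B (κ → M) where
  carrier := {b | ∀ k, α (b k) = ∑ l, b l ⊗ₜ[R] c l k}
  zero_mem' := by simp
  add_mem' := by
    intro x y hx hy k
    simp only [Pi.add_apply, map_add, hx k, hy k, TensorProduct.add_tmul, Finset.sum_add_distrib]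
  smul_mem' := by
    intro r x hx k
    simp only [Pi.smul_apply, map_smul, hx k, Finset.smul_sum, TensorProduct.smul_tmul']

section Contraction

variable {N : Type*} [AddCommGroup N] [Module R N]

variable (B M) in
/-- The contraction `id ⊗ f : M ⊗ N → M` with a linear form `f` on `N`. -/
def coef (f : N →ₗ[R] R) : M ⊗[R] N →ₗ[B] M :=
  (AlgebraTensorModule.rid R B M).toLinearMap ∘ₗ
    AlgebraTensorModule.map (LinearMap.id : M →ₗ[B] M) f

@[simp] theorem coef_tmul (f : N →ₗ[R] R) (m : M) (h : N) : coef B M f (m ⊗ₜ[R] h) = f h • m := by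
  simp [coef]

theorem coef_rTensor {B' M' : Type*} [CommRing B'] [Algebra R B'] [AddCommGroup M'] [Module R M']
    [Module B' M'] [IsScalarTower R B' M'] (f : N →ₗ[R] R) (g : M →ₗ[R] M') (z : M ⊗[R] N) :
    coef B' M' f (g.rTensor N z) = g (coef B M f z) := by
  induction z with
  | zero => simp
  | add x y hx hy => simp only [map_add, hx, hy]
  | tmul m h => simp

theorem sum_coef_tmul {J : Type*} [Fintype J] (𝓑 : Module.Basis J R N) (z : M ⊗[R] N) :
    ∑ j, coef B M (𝓑.coord j) z ⊗ₜ[R] 𝓑 j = z := by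
  induction z with
  | zero => simp
  | add x y hx hy =>
    simp only [map_add, TensorProduct.add_tmul, Finset.sum_add_distrib, hx, hy]
  | tmul m h =>
    simp only [coef_tmul, TensorProduct.smul_tmul, ← TensorProduct.tmul_sum]
    congr 1
    exact 𝓑.sum_repr h

end Contraction

theorem counit_coef {α : M →ₗ[B] M ⊗[R] H} (hα : IsCoaction α) (a : M) :
    coef B M (Coalgebra.counit (R := R) (A := H)) (α a) = a := by
  refine Eq.trans ?_ (hα.counit a)
  generalize α a = z
  induction z with
  | zero => simp
  | add x y hx hy => simp only [map_add, hx, hy]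
  | tmul m h => simp

variable {ι : Type*} [Fintype ι] [DecidableEq ι] {κ : ι → Type*} [∀ i, Fintype (κ i)]
  [∀ i, DecidableEq (κ i)] {c : ∀ i, Matrix (κ i) (κ i) H}

/-- A basis of `H` formed by the entries of finitely many multiplicative matrices. -/
structure MatrixBasis (R : Type*) {H : Type*} [CommRing R] [CommRing H] [HopfAlgebra R H]
    {ι : Type*} {κ : ι → Type*} [∀ i, Fintype (κ i)] [∀ i, DecidableEq (κ i)]
    (c : ∀ i, Matrix (κ i) (κ i) H) where
  mul : ∀ i, IsMulMatrix R (c i)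
  basis : Module.Basis (Σ i, κ i × κ i) R H
  basis_apply : ∀ i k l, basis ⟨i, k, l⟩ = c i k l

namespace MatrixBasis

variable (𝓑 : MatrixBasis R c)
theorem coord_apply (j j' : Σ i, κ i × κ i) :
    𝓑.basis.coord j (c j'.1 j'.2.1 j'.2.2) = if j' = j then 1 else 0 := by
  rw [← 𝓑.basis_apply]
  simp [Finsupp.single_apply]

/-- The comultiplication forces the coefficients of a coaction in a basis of matrix entries to
transform by these matrices. -/
theorem coef_mem_isoVec {α : M →ₗ[B] M ⊗[R] H} (hα : IsCoaction α) (i : ι) (r : κ i) (a : M) :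
    (fun k ↦ coef B M (𝓑.basis.coord ⟨i, k, r⟩) (α a)) ∈ isoVec α (c i) := by
  intro k
  have h := hα.coassoc a
  set f := 𝓑.basis.coord ⟨i, k, r⟩ with hf
  set x : (Σ i, κ i × κ i) → M := fun j ↦ coef B M (𝓑.basis.coord j) (α a) with hx
  have hs : α a = ∑ j, x j ⊗ₜ[R] 𝓑.basis j := (sum_coef_tmul 𝓑.basis (α a)).symm
  have h1 : ∀ z : M ⊗[R] H, ((coef R H f).lTensor M)
      (TensorProduct.assoc R M H H ((α.restrictScalars R).rTensor H z)) = α (coef B M f z) := by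
    intro z
    induction z with
    | zero => simp
    | add x y hx hy => simp only [map_add, hx, hy]
    | tmul m h =>
      rw [LinearMap.rTensor_tmul, coef_tmul, LinearMap.coe_restrictScalars,
        ← algebraMap_smul B (f h) m, map_smul, algebraMap_smul]
      generalize α m = w
      induction w with
      | zero => simp
      | add x y hx hy => simp only [map_add, TensorProduct.add_tmul, hx, hy, smul_add]
      | tmul m h => simp
  rw [← h1, h, hs, map_sum, map_sum, Fintype.sum_sigma, Finset.sum_eq_single i]
  · rw [Fintype.sum_prod_type]
    refine Finset.sum_congr rfl fun k' _ ↦ ?_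
    rw [Finset.sum_eq_single r]
    · rw [LinearMap.lTensor_tmul, LinearMap.lTensor_tmul, 𝓑.basis_apply, (𝓑.mul i).comul, map_sum,
        Finset.sum_eq_single k]
      · rw [coef_tmul, hf, 𝓑.coord_apply ⟨i, k, r⟩ ⟨i, k, r⟩]
        simp
      · intro m _ hm
        rw [coef_tmul, hf, 𝓑.coord_apply ⟨i, k, r⟩ ⟨i, m, r⟩]
        simp [hm]
      · simp
    · intro l _ hl
      rw [LinearMap.lTensor_tmul, LinearMap.lTensor_tmul, 𝓑.basis_apply, (𝓑.mul i).comul, map_sum,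
        Finset.sum_eq_zero, TensorProduct.tmul_zero]
      intro m _
      rw [coef_tmul, hf, 𝓑.coord_apply ⟨i, k, r⟩ ⟨i, m, l⟩]
      simp [hl]
    · simp
  · intro i' _ hi
    refine Finset.sum_eq_zero fun kl _ ↦ ?_
    obtain ⟨k', l⟩ := kl
    rw [LinearMap.lTensor_tmul, LinearMap.lTensor_tmul, 𝓑.basis_apply, (𝓑.mul i').comul, map_sum,
      Finset.sum_eq_zero, TensorProduct.tmul_zero]
    intro m _
    rw [coef_tmul, hf, 𝓑.coord_apply ⟨i, k, r⟩ ⟨i', m, l⟩, if_neg, zero_smul]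
    rintro h
    exact hi (congrArg Sigma.fst h)
  · simp

/-- The projection of a comodule to its multiplicity space. -/
def proj {α : M →ₗ[B] M ⊗[R] H} (hα : IsCoaction α) (p : Σ i, κ i) :
    M →ₗ[B] isoVec α (c p.1) :=
  (LinearMap.pi fun k ↦ coef B M (𝓑.basis.coord ⟨p.1, k, p.2⟩) ∘ₗ α).codRestrict _
    fun a ↦ 𝓑.coef_mem_isoVec hα p.1 p.2 a

theorem proj_apply {α : M →ₗ[B] M ⊗[R] H} (hα : IsCoaction α) (p : Σ i, κ i) (a : M)
    (k : κ p.1) : (𝓑.proj hα p a).1 k = coef B M (𝓑.basis.coord ⟨p.1, k, p.2⟩) (α a) := rfl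

theorem sum_proj {α : M →ₗ[B] M ⊗[R] H} (hα : IsCoaction α) (a : M) :
    ∑ p : Σ i, κ i, (𝓑.proj hα p a).1 p.2 = a := by
  conv_rhs => rw [← counit_coef hα a, ← sum_coef_tmul (B := B) 𝓑.basis (α a), map_sum]
  rw [Fintype.sum_sigma, Fintype.sum_sigma]
  refine Finset.sum_congr rfl fun i _ ↦ ?_
  rw [Fintype.sum_prod_type]
  refine Finset.sum_congr rfl fun k _ ↦ ?_
  rw [Finset.sum_eq_single k]
  · rw [coef_tmul, 𝓑.basis_apply, (𝓑.mul i).counit, Matrix.one_apply_eq, one_smul, proj_apply]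
  · intro l _ hl
    rw [coef_tmul, 𝓑.basis_apply, (𝓑.mul i).counit, Matrix.one_apply_ne hl.symm, zero_smul]
  · simp

theorem proj_isoVec_self {α : M →ₗ[B] M ⊗[R] H} (hα : IsCoaction α) (i : ι) (r : κ i)
    (b : isoVec α (c i)) : 𝓑.proj hα ⟨i, r⟩ (b.1 r) = b := by
  refine Subtype.ext (funext fun k ↦ ?_)
  rw [proj_apply, b.2 r, map_sum, Finset.sum_eq_single k]
  · rw [coef_tmul, 𝓑.coord_apply ⟨i, k, r⟩ ⟨i, k, r⟩]
    simp
  · intro l _ hl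
    rw [coef_tmul, 𝓑.coord_apply ⟨i, k, r⟩ ⟨i, l, r⟩]
    simp [hl]
  · simp

theorem proj_isoVec_ne {α : M →ₗ[B] M ⊗[R] H} (hα : IsCoaction α) {p q : Σ i, κ i} (hpq : p ≠ q)
    (b : isoVec α (c q.1)) : 𝓑.proj hα p (b.1 q.2) = 0 := by
  refine Subtype.ext (funext fun k ↦ ?_)
  rw [proj_apply, b.2 q.2, map_sum]
  refine Finset.sum_eq_zero fun l _ ↦ ?_
  rw [coef_tmul, 𝓑.coord_apply ⟨p.1, k, p.2⟩ ⟨q.1, l, q.2⟩, if_neg, zero_smul]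
  intro h
  apply hpq
  obtain ⟨i, r⟩ := p
  obtain ⟨j, s⟩ := q
  obtain rfl : j = i := congrArg Sigma.fst h
  simp at h
  rw [h.2]

end MatrixBasis

end Isotypic

/-! ### Dual matrices -/

section DualMatrix

variable {R H : Type*} [CommRing R] [CommRing H] [HopfAlgebra R H]
variable {κ : Type*} [Fintype κ] [DecidableEq κ]

variable (R) in
/-- The matrix of the dual comodule in the dual basis. -/
def dualMatrix {κ : Type*} (c : Matrix κ κ H) : Matrix κ κ H :=
  fun k l ↦ HopfAlgebra.antipode R (c l k)

namespace IsMulMatrix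

variable {c : Matrix κ κ H}

theorem antipode_mul (hc : IsMulMatrix R c) (k l : κ) :
    ∑ m, HopfAlgebra.antipode R (c k m) * c m l = (1 : Matrix κ κ H) k l := by
  have h := HopfAlgebra.mul_antipode_rTensor_comul_apply (R := R) (c k l)
  rw [hc.comul, hc.counit] at h
  simp only [map_sum, LinearMap.rTensor_tmul, LinearMap.mul'_apply] at h
  rw [h]
  rw [Matrix.one_apply, Matrix.one_apply]
  split_ifs <;> simp

theorem mul_antipode (hc : IsMulMatrix R c) (k l : κ) :
    ∑ m, c k m * HopfAlgebra.antipode R (c m l) = (1 : Matrix κ κ H) k l := by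
  have h := HopfAlgebra.mul_antipode_lTensor_comul_apply (R := R) (c k l)
  rw [hc.comul, hc.counit] at h
  simp only [map_sum, LinearMap.lTensor_tmul, LinearMap.mul'_apply] at h
  rw [h]
  rw [Matrix.one_apply, Matrix.one_apply]
  split_ifs <;> simp

/-- The antipode is an involution on matrix coefficients, since `S c` is inverse to both `c` and
`S (S c)`. -/
theorem antipode_antipode (hc : IsMulMatrix R c) (k l : κ) :
    HopfAlgebra.antipode R (HopfAlgebra.antipode R (c k l)) = c k l := by
  set S := HopfAlgebra.antipodeAlgHom R H
  have h1 : (c.map S) * c = 1 := by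
    ext k l
    exact hc.antipode_mul k l
  have h2 : (c.map S).map S * c.map S = 1 := by
    rw [← Matrix.map_mul, h1]
    simp
  have : (c.map S).map S = c := by
    calc (c.map S).map S = (c.map S).map S * (c.map S * c) := by rw [h1, mul_one]
      _ = c := by rw [← mul_assoc, h2, one_mul]
  exact congrFun (congrFun this k) l

theorem dualMatrix_dualMatrix (hc : IsMulMatrix R c) : dualMatrix R (dualMatrix R c) = c := by
  ext k l
  exact hc.antipode_antipode k l

/-- The dual matrix is multiplicative: both `Δ (S c)` and the transposed product of `S c` with itself
are inverse to the matrix `Δ c`, so they agree. -/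
theorem dual (hc : IsMulMatrix R c) : IsMulMatrix R (dualMatrix R c) where
  comul := by
    set S := HopfAlgebra.antipodeAlgHom R H
    set D := Bialgebra.comulAlgHom R H
    let Z : Matrix κ κ (H ⊗[R] H) := .of fun k l ↦ ∑ m, S (c m l) ⊗ₜ[R] S (c k m)
    have h1 : (c.map S).map D * c.map D = 1 := by
      rw [← Matrix.map_mul, show c.map S * c = 1 from Matrix.ext hc.antipode_mul]
      simp
    have h2 : c.map D * Z = 1 := by
      ext j l
      have e : ∀ k, D (c j k) = ∑ r, c j r ⊗ₜ[R] c r k := fun k ↦ hc.comul j k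
      have e2 : ∀ r m, ∑ k, (c j r * S (c m l)) ⊗ₜ[R] (c r k * S (c k m)) =
          (c j r * S (c m l)) ⊗ₜ[R] (1 : Matrix κ κ H) r m := by
        intro r m
        rw [← TensorProduct.tmul_sum]
        exact congrArg _ (hc.mul_antipode r m)
      have e3 : ∑ r, c j r * S (c r l) = (1 : Matrix κ κ H) j l := hc.mul_antipode j l
      calc (c.map D * Z) j l
          = ∑ k, ∑ r, ∑ m, (c j r * S (c m l)) ⊗ₜ[R] (c r k * S (c k m)) := by
            simp only [Matrix.mul_apply, Matrix.map_apply, Z, e, Finset.sum_mul_sum,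
              Algebra.TensorProduct.tmul_mul_tmul, Matrix.of_apply]
        _ = ∑ r, ∑ m, (c j r * S (c m l)) ⊗ₜ[R] (1 : Matrix κ κ H) r m := by
            rw [Finset.sum_comm]
            refine Finset.sum_congr rfl fun r _ ↦ ?_
            rw [Finset.sum_comm]
            exact Finset.sum_congr rfl fun m _ ↦ e2 r m
        _ = (∑ r, c j r * S (c r l)) ⊗ₜ[R] 1 := by
            rw [TensorProduct.sum_tmul]
            refine Finset.sum_congr rfl fun r _ ↦ ?_
            rw [Finset.sum_eq_single r]
            · simp
            · intro m _ hm
              rw [Matrix.one_apply_ne hm.symm, TensorProduct.tmul_zero]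
            · simp
        _ = (1 : Matrix κ κ (H ⊗[R] H)) j l := by
            rw [e3, Matrix.one_apply, Matrix.one_apply]
            split_ifs <;> simp [Algebra.TensorProduct.one_def]
    have h3 : (c.map S).map D = Z := by
      calc (c.map S).map D = (c.map S).map D * (c.map D * Z) := by rw [h2, mul_one]
        _ = Z := by rw [← mul_assoc, h1, one_mul]
    intro k l
    exact congrFun (congrFun h3 l) k
  counit := by
    intro k l
    rw [dualMatrix, HopfAlgebra.counit_antipode, hc.counit, Matrix.one_apply, Matrix.one_apply]
    simp [eq_comm]

end IsMulMatrix

variable (R H) in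
/-- The antipode as an `R`-linear automorphism, when it is an involution. -/
def antipodeEquiv (h : ∀ x : H, HopfAlgebra.antipode R (HopfAlgebra.antipode R x) = x) :
    H ≃ₗ[R] H :=
  LinearEquiv.ofInvolutive (HopfAlgebra.antipode R) h

namespace MatrixBasis

variable {ι : Type*} {κ : ι → Type*} [∀ i, Fintype (κ i)]
  [∀ i, DecidableEq (κ i)] {c : ∀ i, Matrix (κ i) (κ i) H}

theorem antipode_antipode (𝓑 : MatrixBasis R c) (x : H) :
    HopfAlgebra.antipode R (HopfAlgebra.antipode R x) = x := by
  have : (HopfAlgebra.antipode R : H →ₗ[R] H) ∘ₗ HopfAlgebra.antipode R = LinearMap.id :=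
    𝓑.basis.ext fun ⟨i, k, l⟩ ↦ by
      rw [𝓑.basis_apply]
      exact (𝓑.mul i).antipode_antipode k l
  exact LinearMap.congr_fun this x

/-- The entries of the dual matrices form a basis as well, since the antipode is bijective. -/
def dual (𝓑 : MatrixBasis R c) : MatrixBasis R fun i ↦ dualMatrix R (c i) where
  mul := fun i ↦ (𝓑.mul i).dual
  basis := (𝓑.basis.map (antipodeEquiv R H 𝓑.antipode_antipode)).reindex
    (Equiv.sigmaCongrRight fun i ↦ Equiv.prodComm (κ i) (κ i))
  basis_apply := fun i k l ↦ by
    rw [Module.Basis.reindex_apply, Module.Basis.map_apply]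
    change HopfAlgebra.antipode R (𝓑.basis ⟨i, l, k⟩) = _
    rw [𝓑.basis_apply]
    rfl

end MatrixBasis

end DualMatrix

/-! ### Matrix coefficients form a basis of `R[G]` -/

section ComodMatrix

variable {R H : Type u} [CommRing R] [CommRing H] [HopfAlgebra R H]

/-- The matrix of a coaction in a basis: `ρ (e k) = ∑ l, e l ⊗ c l k`. -/
def coactMatrix {V κ : Type*} [AddCommGroup V] [Module R V] (ρ : V →ₗ[R] V ⊗[R] H)
    (e : Module.Basis κ R V) : Matrix κ κ H :=
  fun l k ↦ TensorProduct.lid R H ((e.coord l).rTensor H (ρ (e k)))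

section

variable {V κ : Type*} [AddCommGroup V] [Module R V] [Fintype κ]

theorem sum_tmul_coord (e : Module.Basis κ R V) (z : V ⊗[R] H) :
    ∑ l, e l ⊗ₜ[R] TensorProduct.lid R H ((e.coord l).rTensor H z) = z := by
  induction z with
  | zero => simp
  | add x y hx hy =>
    simp only [map_add, TensorProduct.tmul_add, Finset.sum_add_distrib, hx, hy]
  | tmul m h =>
    simp only [LinearMap.rTensor_tmul, TensorProduct.lid_tmul, ← TensorProduct.smul_tmul,
      ← TensorProduct.sum_tmul]
    congr 1
    exact e.sum_repr m

theorem coact_basis (ρ : V →ₗ[R] V ⊗[R] H) (e : Module.Basis κ R V) (k : κ) :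
    ρ (e k) = ∑ l, e l ⊗ₜ[R] coactMatrix ρ e l k :=
  (sum_tmul_coord e _).symm

theorem coactMatrix_eq (ρ : V →ₗ[R] V ⊗[R] H) (e : Module.Basis κ R V) {c : Matrix κ κ H}
    (h : ∀ k, ρ (e k) = ∑ l, e l ⊗ₜ[R] c l k) : coactMatrix ρ e = c := by
  classical
  ext l k
  rw [coactMatrix, h, map_sum, map_sum, Finset.sum_eq_single l]
  · simp
  · intro m _ hm
    simp [hm]
  · simp

end

variable {κ : Type*} [Fintype κ] [DecidableEq κ]

theorem isMulMatrix_coactMatrix (V : Comod R H) (e : Module.Basis κ R V.carrier) :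
    IsMulMatrix R (coactMatrix V.coact e) where
  comul := by
    intro l k
    have h := LinearMap.congr_fun V.coassoc (e k)
    simp only [LinearMap.comp_apply, LinearEquiv.coe_coe] at h
    rw [coact_basis V.coact e k] at h
    simp only [map_sum, LinearMap.rTensor_tmul, LinearMap.lTensor_tmul,
      coact_basis V.coact e, TensorProduct.sum_tmul, TensorProduct.assoc_tmul] at h
    have h2 := congrArg (fun z ↦ TensorProduct.lid R (H ⊗[R] H) ((e.coord l).rTensor _ z)) h
    simp only [map_sum, LinearMap.rTensor_tmul, TensorProduct.lid_tmul, Module.Basis.coord_apply,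
      Module.Basis.repr_self, Finsupp.single_apply, ite_smul, one_smul, zero_smul,
      Finset.sum_ite_eq', Finset.mem_univ, if_true] at h2
    exact h2.symm
  counit := by
    intro l k
    have h := LinearMap.congr_fun V.counit (e k)
    simp only [LinearMap.comp_apply, LinearEquiv.coe_coe] at h
    rw [coact_basis V.coact e k] at h
    simp only [map_sum, LinearMap.lTensor_tmul, TensorProduct.rid_tmul, LinearMap.id_apply] at h
    have h2 := congrArg (e.coord l) h
    simp only [map_sum, map_smul, Module.Basis.coord_apply,
      Module.Basis.repr_self, Finsupp.single_apply, smul_eq_mul, mul_ite, mul_one, mul_zero,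
      Finset.sum_ite_eq', Finset.mem_univ, if_true] at h2
    rw [h2, Matrix.one_apply]
    simp [eq_comm]

/-- The dual representation has the dual matrix in the dual basis. -/
theorem dualCoact_dualBasis (V : Comod R H) [Module.Finite R V.carrier]
    [Module.Projective R V.carrier] (e : Module.Basis κ R V.carrier) (k : κ) :
    dualCoact V (e.dualBasis k) =
      ∑ l, e.dualBasis l ⊗ₜ[R] dualMatrix R (coactMatrix V.coact e) l k := by
  apply (dualTensorHomEquiv R V.carrier H).injective
  change dualTensorHom R V.carrier H _ = dualTensorHom R V.carrier H _
  rw [dualTensorHom_dualCoact]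
  refine e.ext fun m ↦ ?_
  simp only [LinearMap.comp_apply, coact_basis V.coact e m, map_sum, LinearMap.rTensor_tmul,
    LinearEquiv.coe_coe, TensorProduct.lid_tmul, LinearMap.sum_apply, dualTensorHom_apply,
    Module.Basis.dualBasis_apply_self, ite_smul, one_smul, zero_smul, Finset.sum_ite_eq,
    Finset.mem_univ, if_true, dualMatrix]
  rw [← map_sum, Finset.sum_ite_eq' Finset.univ k, if_pos (Finset.mem_univ _)]

variable (R H) in
/-- The regular representation `R[G]`. -/
abbrev regularComod : Comod R H where
  carrier := H
  coact := Coalgebra.comul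
  coassoc := Coalgebra.coassoc
  counit := LinearMap.ext fun x ↦ by
    simp [LinearMap.comp_apply]

/-- The matrix coefficient map `v ↦ ∑ φ(v₀) v₁` of a linear form `φ`. -/
def coefMap (V : Comod R H) (φ : Module.Dual R V.carrier) : V.carrier →ₗ[R] H :=
  (TensorProduct.lid R H).toLinearMap ∘ₗ φ.rTensor H ∘ₗ V.coact

theorem coefMap_apply (V : Comod R H) (φ : Module.Dual R V.carrier) (v : V.carrier) :
    coefMap V φ v = TensorProduct.lid R H (φ.rTensor H (V.coact v)) := rfl

theorem comul_coefMap (V : Comod R H) (φ : Module.Dual R V.carrier) :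
    Coalgebra.comul (R := R) ∘ₗ coefMap V φ = (coefMap V φ).rTensor H ∘ₗ V.coact := by
  ext v
  have h := LinearMap.congr_fun V.coassoc v
  simp only [LinearMap.comp_apply, LinearEquiv.coe_coe] at h ⊢
  have h1 : ∀ z : V.carrier ⊗[R] H, Coalgebra.comul (R := R)
      (TensorProduct.lid R H (φ.rTensor H z)) = TensorProduct.lid R (H ⊗[R] H)
        (φ.rTensor _ ((Coalgebra.comul (R := R) (A := H)).lTensor V.carrier z)) := by
    intro z
    induction z with
    | zero => simp
    | add x y hx hy => simp only [map_add, hx, hy]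
    | tmul m h => simp
  have h2 : ∀ z : V.carrier ⊗[R] H, TensorProduct.lid R (H ⊗[R] H)
        (φ.rTensor _ (TensorProduct.assoc R V.carrier H H (V.coact.rTensor H z))) =
      (coefMap V φ).rTensor H z := by
    intro z
    induction z with
    | zero => simp
    | add x y hx hy => simp only [map_add, hx, hy]
    | tmul m h =>
      rw [LinearMap.rTensor_tmul, LinearMap.rTensor_tmul, coefMap_apply]
      generalize V.coact m = w
      induction w with
      | zero => simp
      | add x y hx hy => simp only [map_add, TensorProduct.add_tmul, hx, hy]
      | tmul m h => simp [TensorProduct.smul_tmul']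
  rw [coefMap_apply, h1, ← h, h2]

theorem counit_coefMap (V : Comod R H) (φ : Module.Dual R V.carrier) :
    Coalgebra.counit (R := R) ∘ₗ coefMap V φ = φ := by
  ext v
  have h := LinearMap.congr_fun V.counit v
  simp only [LinearMap.comp_apply, LinearEquiv.coe_coe, LinearMap.id_apply] at h ⊢
  conv_rhs => rw [← h]
  rw [coefMap_apply]
  generalize V.coact v = w
  induction w with
  | zero => simp
  | add x y hx hy => simp only [map_add, hx, hy]
  | tmul m h => simp [mul_comm]

theorem coefMap_counit (V : Comod R H) (f : V.carrier →ₗ[R] H)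
    (hf : Coalgebra.comul (R := R) ∘ₗ f = f.rTensor H ∘ₗ V.coact) :
    coefMap V (Coalgebra.counit (R := R) ∘ₗ f) = f := by
  ext v
  have h : Coalgebra.comul (f v) = f.rTensor H (V.coact v) := LinearMap.congr_fun hf v
  have h2 : TensorProduct.lid R H
    ((Coalgebra.counit (R := R) (A := H)).rTensor H (Coalgebra.comul (f v))) = f v := by
    simp
  refine Eq.trans ?_ h2
  rw [h, coefMap_apply, LinearMap.rTensor_comp, LinearMap.comp_apply]

/-- Frobenius reciprocity for the regular representation: `Hom^G(V, R[G]) = V^∨`. -/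
def homRegularEquiv (V : Comod R H) :
    Comod.Hom V (regularComod R H) ≃ₗ[R] Module.Dual R V.carrier where
  toFun := fun f ↦ (Coalgebra.counit (R := R) (A := H)) ∘ₗ f.1
  map_add' := fun _ _ ↦ LinearMap.comp_add _ _ _
  map_smul' := fun _ _ ↦ LinearMap.comp_smul _ _ _
  invFun := fun φ ↦ ⟨coefMap V φ, comul_coefMap V φ⟩
  left_inv := fun f ↦ Subtype.ext (coefMap_counit V f.1 f.2)
  right_inv := fun φ ↦ counit_coefMap V φ

theorem homRegularEquiv_symm_apply (V : Comod R H) (φ : Module.Dual R V.carrier) (v : V.carrier) :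
    ((homRegularEquiv V).symm φ).1 v = coefMap V φ v := rfl

end ComodMatrix

section PeterWeyl

variable {R H : Type u} [CommRing R] [IsLocalRing R] [CommRing H] [HopfAlgebra R H]
  {ι : Type} [Fintype ι] (I : GoodLinearlyReductive R H ι)

namespace GoodLinearlyReductive

instance free_carrier (i : ι) : Module.Free R (I.V i).carrier :=
  Module.free_of_flat_of_isLocalRing

/-- The chosen basis of the representation `V i`, which is free since `R` is local. -/
abbrev vecBasis (i : ι) :
    Module.Basis (Fin (Module.finrank R (I.V i).carrier)) R (I.V i).carrier :=
  Module.finBasis R (I.V i).carrier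

/-- The matrix coefficients of `V i`. -/
def mat (i : ι) : Matrix (Fin (Module.finrank R (I.V i).carrier))
    (Fin (Module.finrank R (I.V i).carrier)) H :=
  coactMatrix (I.V i).coact (I.vecBasis i)

theorem evalMap_single [DecidableEq ι] (M : Comod R H) (i : ι) (v : (I.V i).carrier)
    (f : Comod.Hom (I.V i) M) : evalMap I.V M (Pi.single i (v ⊗ₜ[R] f)) = f.1 v := by
  rw [evalMap, LinearMap.sum_apply, Finset.sum_eq_single i]
  · simp
  · intro j _ hj
    simp [hj]
  · simp

/-- The decomposition `⨁ i, V i ⊗ Hom^G(V i, R[G]) ≃ R[G]` of the regular representation. -/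
def regularEquiv :
    (∀ i, (I.V i).carrier ⊗[R] Comod.Hom (I.V i) (regularComod R H)) ≃ₗ[R] H :=
  LinearEquiv.ofBijective (evalMap I.V (regularComod R H)) (I.eval_bijective (regularComod R H))

theorem regularEquiv_single [DecidableEq ι] (i : ι) (v : (I.V i).carrier)
    (f : Comod.Hom (I.V i) (regularComod R H)) :
    I.regularEquiv (Pi.single i (v ⊗ₜ[R] f)) = f.1 v :=
  I.evalMap_single _ i v f

/-- The basis `e k ⊗ e* l` of `V i ⊗ Hom^G(V i, R[G]) = V i ⊗ (V i)^∨`. -/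
def summandBasis (i : ι) : Module.Basis (Fin (Module.finrank R (I.V i).carrier) ×
    Fin (Module.finrank R (I.V i).carrier)) R
    ((I.V i).carrier ⊗[R] Comod.Hom (I.V i) (regularComod R H)) :=
  (I.vecBasis i).tensorProduct ((I.vecBasis i).dualBasis.map (homRegularEquiv (I.V i)).symm)

theorem summandBasis_apply (i : ι) (k l) : I.summandBasis i (k, l) =
    I.vecBasis i k ⊗ₜ[R] (homRegularEquiv (I.V i)).symm ((I.vecBasis i).dualBasis l) := by
  rw [summandBasis, Module.Basis.tensorProduct_apply, Module.Basis.map_apply]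

/-- The Peter–Weyl theorem: the matrix coefficients of the representations `V i` form a basis of
`R[G]`. This is the decomposition of the regular representation. -/
def matrixBasis [DecidableEq ι] : MatrixBasis R I.mat where
  mul := fun i ↦ isMulMatrix_coactMatrix _ _
  basis := ((Pi.basis I.summandBasis).map I.regularEquiv).reindex
    (Equiv.sigmaCongrRight fun _ ↦ Equiv.prodComm _ _)
  basis_apply := fun i k l ↦ by
    rw [Module.Basis.reindex_apply, Module.Basis.map_apply]
    change I.regularEquiv (Pi.basis I.summandBasis ⟨i, (l, k)⟩) = _
    rw [Pi.basis_apply, summandBasis_apply, regularEquiv_single, homRegularEquiv_symm_apply,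
      coefMap_apply, mat, coactMatrix, Module.Basis.coe_dualBasis]

end GoodLinearlyReductive

end PeterWeyl

/-! ### The trace of an equivariant algebra -/

section Trace

section DualBasis

variable {B M : Type u} [CommRing B] [AddCommGroup M] [Module B M] [Module.Finite B M]
  [Module.Projective B M]

variable (B M) in
theorem exists_dualBasis : ∃ (n : ℕ) (x : Fin n → M) (f : Fin n → Module.Dual B M),
    ∀ m, ∑ j, f j m • x j = m := by
  obtain ⟨n, f, g, -, -, hfg⟩ := Module.Finite.exists_comp_eq_id_of_projective B M
  refine ⟨n, fun j ↦ f (Pi.single j 1), fun j ↦ LinearMap.proj j ∘ₗ g, fun m ↦ ?_⟩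
  conv_rhs => rw [← LinearMap.id_apply (R := B) m, ← hfg, LinearMap.comp_apply,
    pi_eq_sum_univ' (g m), map_sum]
  refine Finset.sum_congr rfl fun j _ ↦ ?_
  rw [map_smul]
  rfl

theorem projTrace_eq_sum {J : Type*} [Fintype J] {x : J → M} {f : J → Module.Dual B M}
    (h : ∀ m, ∑ j, f j m • x j = m) (g : M →ₗ[B] M) :
    projTrace B M g = ∑ j, f j (g (x j)) := by
  have : (dualTensorHomEquiv B M M).symm g = ∑ j, (f j ∘ₗ g) ⊗ₜ[B] x j := by
    rw [LinearEquiv.symm_apply_eq, map_sum]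
    ext m
    rw [LinearMap.sum_apply]
    exact (h (g m)).symm
  change contractLeft B M ((dualTensorHomEquiv B M M).symm g) = _
  rw [this, map_sum]
  simp

theorem algTrace_eq_sum {B A : Type u} [CommRing B] [CommRing A] [Algebra B A] [Module.Finite B A]
    [Module.Projective B A] {J : Type*} [Fintype J] {x : J → A} {f : J → Module.Dual B A}
    (h : ∀ m, ∑ j, f j m • x j = m) (a : A) :
    algTrace B A a = ∑ j, f j (a * x j) :=
  projTrace_eq_sum h _

end DualBasis

/-- The trace in terms of a dual basis is invariant under automorphisms over the base. Here `F` and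
`x` form a dual basis of the `B`-algebra `A` with structure map `s`. -/
theorem sum_dualBasis_ringEquiv {B A J : Type*} [CommRing B] [CommRing A] [Fintype J] (s : B →+* A)
    (x : J → A) (F : J → A →+ B) (hF : ∀ j b z, F j (s b * z) = b * F j z)
    (hx : ∀ z, ∑ j, s (F j z) * x j = z) (φ : A ≃+* A) (hφ : ∀ b, φ (s b) = s b) (z : A) :
    ∑ j, F j (φ z * x j) = ∑ j, F j (z * x j) := by
  have hφ' : ∀ b, φ.symm (s b) = s b := fun b ↦ by rw [RingEquiv.symm_apply_eq, hφ]
  have hG : ∀ l w, F l (φ.symm w) = ∑ j, F j w * F l (φ.symm (x j)) := by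
    intro l w
    conv_lhs => rw [← hx w, map_sum, map_sum]
    refine Finset.sum_congr rfl fun j _ ↦ ?_
    rw [map_mul, hφ', hF]
  have hxj : ∀ j, x j = ∑ l, s (F l (φ.symm (x j))) * φ (x l) := by
    intro j
    have := congrArg φ (hx (φ.symm (x j)))
    rw [RingEquiv.apply_symm_apply, map_sum] at this
    simp only [map_mul, hφ] at this
    exact this.symm
  have h1 : ∑ l, F l (z * x l) = ∑ l, ∑ j, F j (φ z * φ (x l)) * F l (φ.symm (x j)) := by
    refine Finset.sum_congr rfl fun l _ ↦ ?_
    rw [← hG, ← map_mul, RingEquiv.symm_apply_apply]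
  rw [h1, Finset.sum_comm]
  refine Finset.sum_congr rfl fun j _ ↦ ?_
  conv_lhs => rw [hxj j, Finset.mul_sum, map_sum]
  refine Finset.sum_congr rfl fun l _ ↦ ?_
  rw [mul_left_comm, hF, mul_comm]

section Invariance

variable {R H : Type u} [CommRing R] [CommRing H] [HopfAlgebra R H]
variable {B A : Type u} [CommRing B] [Algebra R B] [CommRing A] [Algebra R A] [Algebra B A]
  [IsScalarTower R B A]

/-- The `H`-linear extension `a ⊗ h ↦ α(a) (1 ⊗ h)` of a coaction. -/
def coactExt (α : A →ₐ[R] A ⊗[R] H) : A ⊗[R] H →ₐ[R] A ⊗[R] H :=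
  Algebra.TensorProduct.lift α Algebra.TensorProduct.includeRight fun _ _ ↦ Commute.all _ _

theorem coactExt_tmul (α : A →ₐ[R] A ⊗[R] H) (a : A) (h : H) :
    coactExt α (a ⊗ₜ h) = α a * 1 ⊗ₜ h := rfl

/-- The `H`-linear extension of a coaction is an automorphism, with inverse
`a ⊗ h ↦ ∑ a₀ ⊗ S(a₁) h`. -/
def coactEquiv (α : A →ₐ[B] A ⊗[R] H) (hα : IsCoaction α.toLinearMap) :
    A ⊗[R] H ≃ₐ[R] A ⊗[R] H :=
  AlgEquiv.ofAlgHom (coactExt (α.restrictScalars R))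
    (coactExt ((Algebra.TensorProduct.map (AlgHom.id R A)
      (HopfAlgebra.antipodeAlgHom R H)).comp (α.restrictScalars R)))
    (by
      ext a
      · have h1 : ∀ z : A ⊗[R] H, coactExt (α.restrictScalars R)
            (Algebra.TensorProduct.map (AlgHom.id R A) (HopfAlgebra.antipodeAlgHom R H) z) =
          (LinearMap.mul' R H ∘ₗ (HopfAlgebra.antipode R).lTensor H).lTensor A
            (TensorProduct.assoc R A H H
              ((α.toLinearMap.restrictScalars R).rTensor H z)) := by
          intro z
          induction z with
          | zero => simp
          | add x y hx hy => simp only [map_add, hx, hy]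
          | tmul a h =>
            rw [Algebra.TensorProduct.map_tmul, coactExt_tmul, LinearMap.rTensor_tmul]
            change α a * 1 ⊗ₜ[R] (HopfAlgebra.antipodeAlgHom R H) h =
              LinearMap.lTensor A _ (TensorProduct.assoc R A H H (α a ⊗ₜ[R] h))
            generalize α a = w
            induction w with
            | zero => simp
            | add x y hx hy => simp only [map_add, TensorProduct.add_tmul, add_mul, hx, hy]
            | tmul b k => simp
        have h2 : ∀ z : A ⊗[R] H,
            (LinearMap.mul' R H ∘ₗ (HopfAlgebra.antipode R).lTensor H).lTensor A
              ((Coalgebra.comul (R := R) (A := H)).lTensor A z) =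
            (coef R A (Coalgebra.counit (R := R) (A := H)) z) ⊗ₜ[R] (1 : H) := by
          intro z
          induction z with
          | zero => simp
          | add x y hx hy => simp only [map_add, TensorProduct.add_tmul, hx, hy]
          | tmul a h =>
            simp [Algebra.algebraMap_eq_smul_one, TensorProduct.smul_tmul']
        have h3 := h1 (α a)
        have hco : TensorProduct.assoc R A H H ((α.toLinearMap.restrictScalars R).rTensor H (α a)) =
            (Coalgebra.comul (R := R) (A := H)).lTensor A (α a) := hα.coassoc a
        rw [hco, h2] at h3
        simp only [AlgHom.comp_apply, Algebra.TensorProduct.includeLeft_apply, coactExt_tmul,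
          ← Algebra.TensorProduct.one_def, mul_one]
        refine h3.trans ?_
        congr 1
        exact counit_coef (B := R) (α := α.toLinearMap.restrictScalars R)
          ⟨hα.coassoc, hα.counit⟩ a
      · simp [coactExt_tmul])
    (by
      ext a
      · have h1 : ∀ z : A ⊗[R] H, coactExt ((Algebra.TensorProduct.map (AlgHom.id R A)
            (HopfAlgebra.antipodeAlgHom R H)).comp (α.restrictScalars R)) z =
          (LinearMap.mul' R H ∘ₗ (HopfAlgebra.antipode R).rTensor H).lTensor A
            (TensorProduct.assoc R A H H
              ((α.toLinearMap.restrictScalars R).rTensor H z)) := by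
          intro z
          induction z with
          | zero => simp
          | add x y hx hy => simp only [map_add, hx, hy]
          | tmul a h =>
            rw [coactExt_tmul, LinearMap.rTensor_tmul]
            change Algebra.TensorProduct.map _ _ (α a) * 1 ⊗ₜ[R] h =
              LinearMap.lTensor A _ (TensorProduct.assoc R A H H (α a ⊗ₜ[R] h))
            generalize α a = w
            induction w with
            | zero => simp
            | add x y hx hy => simp only [map_add, TensorProduct.add_tmul, add_mul, hx, hy]
            | tmul b k => simp
        have h2 : ∀ z : A ⊗[R] H,
            (LinearMap.mul' R H ∘ₗ (HopfAlgebra.antipode R).rTensor H).lTensor A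
              ((Coalgebra.comul (R := R) (A := H)).lTensor A z) =
            (coef R A (Coalgebra.counit (R := R) (A := H)) z) ⊗ₜ[R] (1 : H) := by
          intro z
          induction z with
          | zero => simp
          | add x y hx hy => simp only [map_add, TensorProduct.add_tmul, hx, hy]
          | tmul a h =>
            simp [Algebra.algebraMap_eq_smul_one, TensorProduct.smul_tmul']
        have h3 := h1 (α a)
        have hco : TensorProduct.assoc R A H H ((α.toLinearMap.restrictScalars R).rTensor H (α a)) =
            (Coalgebra.comul (R := R) (A := H)).lTensor A (α a) := hα.coassoc a
        rw [hco, h2] at h3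
        simp only [AlgHom.comp_apply, Algebra.TensorProduct.includeLeft_apply, coactExt_tmul,
          ← Algebra.TensorProduct.one_def, mul_one]
        refine h3.trans ?_
        congr 1
        exact counit_coef (B := R) (α := α.toLinearMap.restrictScalars R)
          ⟨hα.coassoc, hα.counit⟩ a
      · simp [coactExt_tmul])

theorem coactEquiv_tmul (α : A →ₐ[B] A ⊗[R] H) (hα : IsCoaction α.toLinearMap) (a : A) (h : H) :
    coactEquiv α hα (a ⊗ₜ h) = α a * 1 ⊗ₜ h := rfl

/-- The trace is equivariant: it is invariant under the automorphism of `A ⊗ H` over `B ⊗ H`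
defined by the coaction. -/
theorem algTrace_coact [Module.Finite B A] [Module.Projective B A] (α : A →ₐ[B] A ⊗[R] H)
    (hα : IsCoaction α.toLinearMap) (a : A) :
    ((algTrace B A).restrictScalars R).rTensor H (α a) = algTrace B A a ⊗ₜ[R] (1 : H) := by
  obtain ⟨n, x, f, h⟩ := exists_dualBasis B A
  let s : B ⊗[R] H →ₐ[R] A ⊗[R] H :=
    Algebra.TensorProduct.map (IsScalarTower.toAlgHom R B A) (AlgHom.id R H)
  let F : Fin n → A ⊗[R] H →ₗ[R] B ⊗[R] H := fun j ↦ ((f j).restrictScalars R).rTensor H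
  have hF : ∀ j b z, F j (s b * z) = b * F j z := by
    intro j b z
    induction b with
    | zero => simp
    | add x y hx hy => simp only [map_add, add_mul, hx, hy]
    | tmul b h =>
      induction z with
      | zero => simp
      | add x y hx hy => simp only [map_add, mul_add, hx, hy]
      | tmul a k => simp [s, F, ← Algebra.smul_def]
  have hx : ∀ z, ∑ j, s (F j z) * (x j ⊗ₜ[R] (1 : H)) = z := by
    intro z
    induction z with
    | zero => simp
    | add x y hx hy => simp only [map_add, add_mul, Finset.sum_add_distrib, hx, hy]
    | tmul a k =>
      conv_rhs => rw [← h a, TensorProduct.sum_tmul]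
      simp [s, F, Algebra.smul_def]
  have hs : ∀ b, coactEquiv α hα (s b) = s b := by
    intro b
    induction b with
    | zero => simp
    | add x y hx hy => simp only [map_add, hx, hy]
    | tmul b h =>
      change coactEquiv α hα (algebraMap B A b ⊗ₜ h) = algebraMap B A b ⊗ₜ h
      rw [coactEquiv_tmul]
      rw [AlgHom.commutes, Algebra.TensorProduct.algebraMap_apply,
        Algebra.TensorProduct.tmul_mul_tmul, mul_one, one_mul]
  have key := sum_dualBasis_ringEquiv s.toRingHom (fun j ↦ x j ⊗ₜ[R] (1 : H))
    (fun j ↦ (F j).toAddMonoidHom) hF hx (coactEquiv α hα).toRingEquiv hs (a ⊗ₜ 1)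
  have e : ∀ z : A ⊗[R] H, ((algTrace B A).restrictScalars R).rTensor H z =
      ∑ j, F j (z * x j ⊗ₜ[R] (1 : H)) := by
    intro z
    induction z with
    | zero => simp
    | add x y hx hy => simp only [map_add, add_mul, Finset.sum_add_distrib, hx, hy]
    | tmul a k =>
      rw [LinearMap.rTensor_tmul, LinearMap.coe_restrictScalars, algTrace_eq_sum h,
        TensorProduct.sum_tmul]
      simp [F]
  have e1 : α a = coactEquiv α hα (a ⊗ₜ 1) := by
    rw [coactEquiv_tmul, ← Algebra.TensorProduct.one_def, mul_one]
  rw [e1, e]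
  refine key.trans ?_
  refine (e (a ⊗ₜ 1)).symm.trans ?_
  simp

end Invariance

/-- The trace of the identity of a projective module of constant rank. -/
theorem projTrace_id {B M : Type u} [CommRing B] [AddCommGroup M] [Module B M] [Module.Finite B M]
    [Module.Projective B M] (n : ℕ) (h : ∀ p : PrimeSpectrum B, Module.rankAtStalk M p = n) :
    projTrace B M LinearMap.id = n := by
  obtain ⟨m, x, f, hx⟩ := exists_dualBasis B M
  refine Module.eq_of_localization_maximal (fun P _ ↦ Localization.AtPrime P)
    (fun P _ ↦ Algebra.linearMap B (Localization.AtPrime P)) _ _ fun P hP ↦ ?_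
  let C := Localization.AtPrime P
  have hC : ∀ z : C ⊗[B] M,
      ∑ j, Module.Dual.baseChange C (f j) z • ((1 : C) ⊗ₜ[B] x j) = z := by
    intro z
    induction z with
    | zero => simp
    | add y z hy hz => simp only [map_add, add_smul, Finset.sum_add_distrib, hy, hz]
    | tmul c m =>
      conv_rhs => rw [← hx m, TensorProduct.tmul_sum]
      refine Finset.sum_congr rfl fun j _ ↦ ?_
      rw [Module.Dual.baseChange_apply_tmul, smul_assoc, TensorProduct.smul_tmul', smul_eq_mul,
        mul_one, TensorProduct.tmul_smul]
  have : Module.Free C (C ⊗[B] M) := Module.free_of_flat_of_isLocalRing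
  have hrk : Module.finrank C (C ⊗[B] M) = n := by
    rw [← h ⟨P, hP.isPrime⟩, Module.rankAtStalk_eq_finrank_tensorProduct]
  let b := Module.finBasis C (C ⊗[B] M)
  have h1 := projTrace_eq_sum hC LinearMap.id
  have h2 := projTrace_eq_sum (x := b) (f := b.coord) b.sum_repr LinearMap.id
  rw [h1] at h2
  simp only [LinearMap.id_apply, Module.Dual.baseChange_apply_tmul, Algebra.smul_def,
    mul_one, Module.Basis.coord_apply, Module.Basis.repr_self, Finsupp.single_eq_same,
    Finset.sum_const, Finset.card_univ, Fintype.card_fin, hrk, nsmul_eq_mul] at h2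
  rw [projTrace_eq_sum hx, map_sum, Algebra.linearMap_apply, map_natCast]
  exact h2

/-- An étale Hopf algebra contains an element of trace `1`: the idempotent that cuts out the unit
section, obtained by applying the counit to one factor of the separability idempotent. -/
theorem exists_algTrace_eq_one {R H : Type u} [CommRing R] [CommRing H] [HopfAlgebra R H]
    [Module.Finite R H] [Module.Projective R H] [Algebra.Etale R H] :
    ∃ t : H, algTrace R H t = 1 := by
  obtain ⟨e, he, he1⟩ := Algebra.FormallyUnramified.iff_exists_tensorProduct.1
    (inferInstance : Algebra.FormallyUnramified R H)
  let ε := Bialgebra.counitAlgHom R H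
  let E : H ⊗[R] H →ₐ[R] H := Algebra.TensorProduct.lift ((Algebra.ofId R H).comp ε)
    (AlgHom.id R H) fun _ _ ↦ Commute.all _ _
  have h1 : ∀ a, a * E e = ε a • E e := by
    intro a
    have := congrArg E (he a)
    rw [map_mul, map_sub, map_zero, sub_mul, sub_eq_zero] at this
    simpa [E, Algebra.smul_def, Algebra.ofId_apply] using this
  have h2 : ε (E e) = 1 := by
    have : ε.comp E = ε.comp (Algebra.TensorProduct.lmul' R) := by
      ext x <;> simp [E, Algebra.ofId_apply]
    refine (AlgHom.congr_fun this e).trans ?_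
    rw [AlgHom.comp_apply, he1, map_one]
  refine ⟨E e, ?_⟩
  have h3 : LinearMap.mul R H (E e) = dualTensorHom R H H (ε.toLinearMap ⊗ₜ E e) := by
    ext a
    rw [LinearMap.mul_apply_apply, mul_comm, h1]
    rfl
  change contractLeft R H ((dualTensorHomEquiv R H H).symm (LinearMap.mul R H (E e))) = 1
  rw [h3, ← h2]
  exact congrArg (contractLeft R H) ((dualTensorHomEquiv R H H).symm_apply_apply _)

end Trace

/-! ### Orthogonality for the trace -/

section Orthogonality

variable {R H : Type u} [CommRing R] [CommRing H] [HopfAlgebra R H]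
variable {ι : Type*} [Fintype ι] [DecidableEq ι] {κ : ι → Type*} [∀ i, Fintype (κ i)]
  [∀ i, DecidableEq (κ i)] {c : ∀ i, Matrix (κ i) (κ i) H}
variable {B : Type u} [CommRing B] [Algebra R B]

namespace MatrixBasis

theorem coef_coord (𝓑 : MatrixBasis R c) (j j' : Σ i, κ i × κ i) (b : B) :
    coef B B (𝓑.basis.coord j) (b ⊗ₜ[R] c j'.1 j'.2.1 j'.2.2) = if j' = j then b else 0 := by
  rw [coef_tmul, 𝓑.coord_apply]
  split_ifs <;> simp

/-- Multiplying the invariance of `T` by the matrix `c i` moves the antipode to the other side. -/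
theorem sum_tmul_eq (𝓑 : MatrixBasis R c) {i j : ι} {T : κ i → κ j → B}
    (hT : ∀ k l, T k l ⊗ₜ[R] (1 : H) =
      ∑ m, ∑ r, T m r ⊗ₜ[R] (dualMatrix R (c i) m k * c j r l)) (n : κ i) (l : κ j) :
    ∑ k, T k l ⊗ₜ[R] c i n k = ∑ r, T n r ⊗ₜ[R] c j r l := by
  have h : ∀ k, T k l ⊗ₜ[R] c i n k =
      ∑ m, ∑ r, T m r ⊗ₜ[R] (c i n k * HopfAlgebra.antipode R (c i k m) * c j r l) := by
    intro k
    have := congrArg (fun z : B ⊗[R] H ↦ (1 ⊗ₜ[R] c i n k) * z) (hT k l)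
    simpa [Finset.mul_sum, dualMatrix, mul_assoc] using this
  simp only [h]
  rw [Finset.sum_comm]
  have h2 : ∀ m, ∑ k, ∑ r, T m r ⊗ₜ[R]
      (c i n k * HopfAlgebra.antipode R (c i k m) * c j r l) =
      ∑ r, T m r ⊗ₜ[R] ((1 : Matrix (κ i) (κ i) H) n m * c j r l) := by
    intro m
    rw [Finset.sum_comm]
    refine Finset.sum_congr rfl fun r _ ↦ ?_
    rw [← TensorProduct.tmul_sum, ← Finset.sum_mul, (𝓑.mul i).mul_antipode]
  simp only [h2]
  rw [Finset.sum_eq_single n]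
  · simp
  · intro m _ hm
    simp [Matrix.one_apply_ne hm.symm]
  · simp

/-- Schur's lemma for different representations: a matrix `T` that is invariant for the dual of
`c i` and `c j` vanishes. -/
theorem invariant_eq_zero (𝓑 : MatrixBasis R c) {i j : ι} (hij : i ≠ j) {T : κ i → κ j → B}
    (hT : ∀ k l, T k l ⊗ₜ[R] (1 : H) =
      ∑ m, ∑ r, T m r ⊗ₜ[R] (dualMatrix R (c i) m k * c j r l)) (k : κ i) (l : κ j) :
    T k l = 0 := by
  have h := congrArg (coef B B (𝓑.basis.coord ⟨i, k, k⟩)) (𝓑.sum_tmul_eq hT k l)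
  rw [map_sum, map_sum, Finset.sum_eq_single k, Finset.sum_eq_zero] at h
  · rwa [𝓑.coef_coord ⟨i, k, k⟩ ⟨i, k, k⟩, if_pos rfl] at h
  · intro r _
    rw [𝓑.coef_coord ⟨i, k, k⟩ ⟨j, r, l⟩, if_neg]
    intro h
    exact hij (congrArg Sigma.fst h).symm
  · intro m _ hm
    rw [𝓑.coef_coord ⟨i, k, k⟩ ⟨i, k, m⟩, if_neg]
    simpa using hm
  · simp

/-- Schur's lemma for equal representations: an invariant matrix is scalar. -/
theorem invariant_apply (𝓑 : MatrixBasis R c) {i : ι} {T : κ i → κ i → B}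
    (hT : ∀ k l, T k l ⊗ₜ[R] (1 : H) =
      ∑ m, ∑ r, T m r ⊗ₜ[R] (dualMatrix R (c i) m k * c i r l)) (n k l : κ i) :
    T k l = if k = l then T n n else 0 := by
  have h := congrArg (coef B B (𝓑.basis.coord ⟨i, n, k⟩)) (𝓑.sum_tmul_eq hT n l)
  rw [map_sum, map_sum, Finset.sum_eq_single k, Finset.sum_eq_single n] at h
  · rw [𝓑.coef_coord ⟨i, n, k⟩ ⟨i, n, k⟩, if_pos rfl,
      𝓑.coef_coord ⟨i, n, k⟩ ⟨i, n, l⟩] at h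
    rw [h]
    by_cases hkl : k = l
    · subst hkl
      simp
    · rw [if_neg, if_neg hkl]
      simpa using fun h ↦ hkl h.symm
  · intro r _ hr
    rw [𝓑.coef_coord ⟨i, n, k⟩ ⟨i, r, l⟩, if_neg]
    simp [hr]
  · simp
  · intro m _ hm
    rw [𝓑.coef_coord ⟨i, n, k⟩ ⟨i, n, m⟩, if_neg]
    simpa using hm
  · simp

/-- A vector of invariants that transforms by `c j` vanishes if `c j` is not the matrix of the
trivial representation. -/
theorem invariant_vec_eq_zero (𝓑 : MatrixBasis R c) {i j : ι} (hij : i ≠ j) {k : κ i}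
    (hk : c i k k = 1) {T : κ j → B}
    (hT : ∀ l, T l ⊗ₜ[R] (1 : H) = ∑ r, T r ⊗ₜ[R] c j r l) (l : κ j) : T l = 0 := by
  have h := congrArg (coef B B (𝓑.basis.coord ⟨i, k, k⟩)) (hT l)
  rw [map_sum, ← hk, 𝓑.coef_coord ⟨i, k, k⟩ ⟨i, k, k⟩, if_pos rfl, Finset.sum_eq_zero] at h
  · exact h
  · intro r _
    rw [𝓑.coef_coord ⟨i, k, k⟩ ⟨j, r, l⟩, if_neg]
    intro h
    exact hij (congrArg Sigma.fst h).symm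

variable {A : Type u} [CommRing A] [Algebra R A] [Algebra B A]
  [IsScalarTower R B A] [Module.Finite B A] [Module.Projective B A]

theorem algTrace_vec {κ : Type*} [Fintype κ] {α : A →ₐ[B] A ⊗[R] H}
    (hα : IsCoaction α.toLinearMap) {c : Matrix κ κ H} {b : κ → A}
    (hb : b ∈ isoVec α.toLinearMap c) (l : κ) :
    algTrace B A (b l) ⊗ₜ[R] (1 : H) = ∑ r, algTrace B A (b r) ⊗ₜ[R] c r l := by
  have hb' : α (b l) = ∑ r, b r ⊗ₜ[R] c r l := hb l
  rw [← algTrace_coact α hα, hb', map_sum]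
  simp

theorem algTrace_mul_invariant {κ κ' : Type*} [Fintype κ] [Fintype κ'] {α : A →ₐ[B] A ⊗[R] H}
    (hα : IsCoaction α.toLinearMap) {c : Matrix κ κ H} {c' : Matrix κ' κ' H} {a : κ → A}
    (ha : a ∈ isoVec α.toLinearMap c) {b : κ' → A} (hb : b ∈ isoVec α.toLinearMap c')
    (k : κ) (l : κ') :
    algTrace B A (a k * b l) ⊗ₜ[R] (1 : H) =
      ∑ m, ∑ r, algTrace B A (a m * b r) ⊗ₜ[R] (c m k * c' r l) := by
  have ha' : α (a k) = ∑ m, a m ⊗ₜ[R] c m k := ha k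
  have hb' : α (b l) = ∑ r, b r ⊗ₜ[R] c' r l := hb l
  rw [← algTrace_coact α hα, map_mul, ha', hb', Finset.sum_mul_sum, map_sum]
  simp

/-- Orthogonality of isotypic components of different type. -/
theorem algTrace_mul_of_ne (𝓑 : MatrixBasis R c) {α : A →ₐ[B] A ⊗[R] H}
    (hα : IsCoaction α.toLinearMap) {i j : ι} (hij : i ≠ j) {a : κ i → A}
    (ha : a ∈ isoVec α.toLinearMap (dualMatrix R (c i))) {b : κ j → A}
    (hb : b ∈ isoVec α.toLinearMap (c j)) (k : κ i) (l : κ j) :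
    algTrace B A (a k * b l) = 0 :=
  𝓑.invariant_eq_zero hij (algTrace_mul_invariant hα ha hb) k l

/-- Schur's lemma: on isotypic components of the same type, the trace pairing is the
contraction up to the factor `1 / rk V`. -/
theorem card_mul_algTrace_mul (𝓑 : MatrixBasis R c) {α : A →ₐ[B] A ⊗[R] H}
    (hα : IsCoaction α.toLinearMap) {i : ι} {a : κ i → A}
    (ha : a ∈ isoVec α.toLinearMap (dualMatrix R (c i))) {b : κ i → A}
    (hb : b ∈ isoVec α.toLinearMap (c i)) (k l : κ i) :
    (Fintype.card (κ i) : B) * algTrace B A (a k * b l) =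
      if k = l then algTrace B A (∑ m, a m * b m) else 0 := by
  have h := 𝓑.invariant_apply (algTrace_mul_invariant hα ha hb)
  rw [h k k l]
  split_ifs
  · rw [map_sum, Finset.sum_congr rfl fun m _ ↦ (h k m m).trans (if_pos rfl), Finset.sum_const,
      Finset.card_univ, nsmul_eq_mul]
  · simp

end MatrixBasis

theorem algTrace_one {A : Type u} [CommRing A] [Algebra B A] [Module.Finite B A]
    [Module.Projective B A] (n : ℕ) (h : ∀ p : PrimeSpectrum B, Module.rankAtStalk A p = n) :
    algTrace B A 1 = n := by
  rw [← projTrace_id n h]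
  change projTrace B A (LinearMap.mul B A 1) = _
  congr 1
  ext
  simp

variable (R H) in
/-- The regular representation as an algebra with coaction. -/
theorem isCoaction_comul : IsCoaction (Bialgebra.comulAlgHom R H).toLinearMap where
  coassoc := fun a ↦ Coalgebra.coassoc_apply a
  counit := fun a ↦ by simp

end Orthogonality

section Units

variable {R H : Type u} [CommRing R] [IsLocalRing R] [CommRing H] [HopfAlgebra R H]
  {ι : Type} [Fintype ι] [DecidableEq ι] (I : GoodLinearlyReductive R H ι)

namespace GoodLinearlyReductive

theorem finrank_triv : Module.finrank R (I.V I.triv).carrier = 1 := by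
  obtain ⟨e⟩ := I.triv_equiv
  rw [e.finrank_eq, Module.finrank_self]

theorem mat_triv : I.mat I.triv = 1 := by
  refine coactMatrix_eq _ _ fun k ↦ ?_
  rw [I.triv_coact, Finset.sum_eq_single k]
  · simp
  · intro l _ hl
    simp [Matrix.one_apply_ne hl]
  · simp

theorem finrank_pos (i : ι) : 0 < Module.finrank R (I.V i).carrier := by
  have := I.rank_pos i (IsLocalRing.closedPoint R)
  rwa [Module.rankAtStalk_eq_finrank_of_free] at this

theorem finrank_eq_sum : Module.finrank R H =
    ∑ i, Module.finrank R (I.V i).carrier * Module.finrank R (I.V i).carrier := by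
  rw [Module.finrank_eq_card_basis I.matrixBasis.basis]
  simp

/-- The rank of `G` is invertible: on the regular representation the trace is `rk G` times the
projection to the invariants, and it takes the value `1` since `G` is étale. -/
theorem isUnit_finrank (I : GoodLinearlyReductive R H ι) [Module.Finite R H] [Algebra.Etale R H] :
    IsUnit (Module.finrank R H : R) := by
  have : Module.Free R H := Module.Free.of_basis I.matrixBasis.basis
  have hone : algTrace R H 1 = (Module.finrank R H : R) := algTrace_one _ fun p ↦ by
    rw [Module.rankAtStalk_eq_finrank_of_free]
    rfl
  have h : ∀ x : H, algTrace R H x ∈ Ideal.span {(Module.finrank R H : R)} := by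
    intro x
    rw [← I.matrixBasis.basis.sum_repr x, map_sum]
    refine Ideal.sum_mem _ fun ⟨i, k, l⟩ _ ↦ ?_
    rw [map_smul, I.matrixBasis.basis_apply]
    refine Ideal.mul_mem_left _ _ ?_
    by_cases hi : I.triv = i
    · subst hi
      rw [I.mat_triv, Matrix.one_apply]
      split_ifs
      · rw [hone]
        exact Ideal.subset_span rfl
      · simp
    · have hb : (fun l ↦ I.mat i k l) ∈
          isoVec (Bialgebra.comulAlgHom R H).toLinearMap (I.mat i) :=
        fun l ↦ (I.matrixBasis.mul i).comul k l
      have h0 : (0 : ℕ) < Module.finrank R (I.V I.triv).carrier := I.finrank_pos _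
      rw [I.matrixBasis.invariant_vec_eq_zero hi (k := ⟨0, h0⟩) (by rw [I.mat_triv]; simp)
        (MatrixBasis.algTrace_vec (isCoaction_comul R H) hb) l]
      exact Ideal.zero_mem _
  -- The trace ideal is the unit ideal because `H` is étale.
  obtain ⟨t, ht⟩ := exists_algTrace_eq_one (R := R) (H := H)
  have := h t
  rw [ht, Ideal.mem_span_singleton] at this
  exact isUnit_of_dvd_one this

/-- The ranks of the irreducible representations are invertible, by Schur's lemma for the regular
representation. -/
theorem isUnit_finrank_carrier (I : GoodLinearlyReductive R H ι) [Module.Finite R H]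
    [Algebra.Etale R H] (i : ι) :
    IsUnit (Module.finrank R (I.V i).carrier : R) := by
  have : Module.Free R H := Module.Free.of_basis I.matrixBasis.basis
  have hone : algTrace R H 1 = (Module.finrank R H : R) := algTrace_one _ fun p ↦ by
    rw [Module.rankAtStalk_eq_finrank_of_free]
    rfl
  -- A row of `c` and a column of its antipode have contraction `1`, so that Schur's lemma shows
  -- that `rk V` divides `tr 1 = rk G`.
  let m : Fin (Module.finrank R (I.V i).carrier) := ⟨0, I.finrank_pos i⟩
  have ha : (fun k ↦ dualMatrix R (I.mat i) m k) ∈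
      isoVec (Bialgebra.comulAlgHom R H).toLinearMap (dualMatrix R (I.mat i)) :=
    fun l ↦ (I.matrixBasis.mul i).dual.comul m l
  have hb : (fun l ↦ I.mat i m l) ∈
      isoVec (Bialgebra.comulAlgHom R H).toLinearMap (I.mat i) :=
    fun l ↦ (I.matrixBasis.mul i).comul m l
  have h := I.matrixBasis.card_mul_algTrace_mul (isCoaction_comul R H) ha hb m m
  have h1 : ∑ k, dualMatrix R (I.mat i) m k * I.mat i m k = 1 := by
    have := (I.matrixBasis.mul i).mul_antipode m m
    rw [Matrix.one_apply_eq] at this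
    rw [← this]
    exact Finset.sum_congr rfl fun k _ ↦ mul_comm _ _
  rw [if_pos rfl, h1, hone, Fintype.card_fin] at h
  exact isUnit_of_mul_isUnit_left (h.symm ▸ I.isUnit_finrank)

end GoodLinearlyReductive

end Units

/-! ### Covariants as families of elements of the algebra -/

section Omega

variable {R H : Type u} [CommRing R] [CommRing H] [HopfAlgebra R H]
variable {B A : Type u} [CommRing B] [Algebra R B] [CommRing A] [Algebra R A] [Algebra B A]
  [IsScalarTower R B A]
variable {V : Type u} [AddCommGroup V] [Module R V] {κ : Type*} [Fintype κ] [DecidableEq κ]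
  {ρ : V →ₗ[R] V ⊗[R] H} {e : Module.Basis κ R V} {c : Matrix κ κ H}

/-- The coordinates of the diagonal coaction. -/
theorem coef_diagCoact (α : A →ₐ[B] A ⊗[R] H) (hρ : ∀ k, ρ (e k) = ∑ l, e l ⊗ₜ[R] c l k)
    (x : A ⊗[R] V) (l : κ) :
    ((coef B A (e.coord l)).restrictScalars R).rTensor H (diagCoact α.toLinearMap ρ x) =
      ∑ k, α (coef B A (e.coord k) x) * 1 ⊗ₜ[R] c l k := by
  conv_lhs => rw [← sum_coef_tmul (B := B) e x, map_sum, map_sum]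
  refine Finset.sum_congr rfl fun k _ ↦ ?_
  generalize coef B A (e.coord k) x = a
  have h : ∀ s : A ⊗[R] H, ∀ m, ((coef B A (e.coord l)).restrictScalars R).rTensor H
      (AlgebraTensorModule.map (LinearMap.id : A ⊗[R] V →ₗ[B] A ⊗[R] V) (LinearMap.mul' R H)
        (AlgebraTensorModule.tensorTensorTensorComm R R R B A H V H
          (s ⊗ₜ[R] (e m ⊗ₜ[R] c m k)))) = if m = l then s * 1 ⊗ₜ[R] c l k else 0 := by
    intro s m
    induction s with
    | zero => simp
    | add x y hx hy =>
      simp only [map_add, TensorProduct.add_tmul, hx, hy]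
      split_ifs
      · rw [add_mul]
      · rw [add_zero]
    | tmul a h =>
      by_cases hm : m = l
      · subst hm
        simp
      · simp [hm]
  simp only [diagCoact, LinearMap.comp_apply, AlgebraTensorModule.map_tmul, hρ,
    TensorProduct.tmul_sum, map_sum, LinearEquiv.coe_coe, h]
  rw [Finset.sum_ite_eq' Finset.univ l, if_pos (Finset.mem_univ _)]
  rfl

/-- A linear system with the matrix `c` is solved by the antipode. -/
theorem sum_mul_matrix_iff (hc : IsMulMatrix R c) (a : κ → A) (w : κ → A ⊗[R] H) :
    (∀ l, ∑ k, w k * 1 ⊗ₜ[R] c l k = a l ⊗ₜ[R] 1) ↔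
      ∀ k, w k = ∑ l, a l ⊗ₜ[R] dualMatrix R c l k := by
  constructor
  · intro h k
    have h2 : ∀ l, a l ⊗ₜ[R] dualMatrix R c l k =
        ∑ j, w j * 1 ⊗ₜ[R] (HopfAlgebra.antipode R (c k l) * c l j) := by
      intro l
      have := congrArg (fun z : A ⊗[R] H ↦ z * 1 ⊗ₜ[R] dualMatrix R c l k) (h l)
      simp only [Finset.sum_mul, mul_assoc, Algebra.TensorProduct.tmul_mul_tmul, one_mul,
        mul_one, dualMatrix] at this
      rw [dualMatrix, ← this]
      exact Finset.sum_congr rfl fun j _ ↦ by rw [mul_comm (c l j)]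
    simp only [h2]
    rw [Finset.sum_comm]
    simp only [← Finset.mul_sum, ← TensorProduct.tmul_sum, hc.antipode_mul]
    rw [Finset.sum_eq_single k]
    · simp [← Algebra.TensorProduct.one_def]
    · intro j _ hj
      simp [Matrix.one_apply_ne hj.symm]
    · simp
  · intro h l
    have h2 : ∀ k, w k * 1 ⊗ₜ[R] c l k =
        ∑ m, a m ⊗ₜ[R] (c l k * HopfAlgebra.antipode R (c k m)) := by
      intro k
      simp only [h k, Finset.sum_mul, dualMatrix, Algebra.TensorProduct.tmul_mul_tmul, mul_one]
      exact Finset.sum_congr rfl fun m _ ↦ by rw [mul_comm]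
    simp only [h2]
    rw [Finset.sum_comm]
    simp only [← TensorProduct.tmul_sum, hc.mul_antipode]
    rw [Finset.sum_eq_single l]
    · simp
    · intro j _ hj
      simp [Matrix.one_apply_ne hj.symm]
    · simp

theorem coef_sum_tmul (e : Module.Basis κ R V) (a : κ → A) (k : κ) :
    coef B A (e.coord k) (∑ l, a l ⊗ₜ[R] e l) = a k := by
  rw [map_sum, Finset.sum_eq_single k]
  · simp
  · intro l _ hl
    simp [hl]
  · simp

/-- An element `∑ a k ⊗ e k` of `A ⊗ V` is invariant if and only if the family `a` transforms by
the matrix of the dual representation, i.e. defines an equivariant map `V^∨ → A`. -/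
theorem mem_invTensor_iff (α : A →ₐ[B] A ⊗[R] H) (hc : IsMulMatrix R c)
    (hρ : ∀ k, ρ (e k) = ∑ l, e l ⊗ₜ[R] c l k) (x : A ⊗[R] V) :
    x ∈ invTensor α.toLinearMap ρ ↔
      (fun k ↦ coef B A (e.coord k) x) ∈ isoVec α.toLinearMap (dualMatrix R c) := by
  have h1 : x ∈ invTensor α.toLinearMap ρ ↔ ∀ l,
      ∑ k, α (coef B A (e.coord k) x) * 1 ⊗ₜ[R] c l k = coef B A (e.coord l) x ⊗ₜ[R] 1 := by
    constructor
    · intro hx l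
      rw [← coef_diagCoact α hρ, show diagCoact α.toLinearMap ρ x = x ⊗ₜ[R] (1 : H) from hx]
      rfl
    · intro h
      have hinj : ∀ z w : (A ⊗[R] V) ⊗[R] H,
          (∀ l, ((coef B A (e.coord l)).restrictScalars R).rTensor H z =
            ((coef B A (e.coord l)).restrictScalars R).rTensor H w) → z = w := by
        intro z w hzw
        have hz : ∀ z : (A ⊗[R] V) ⊗[R] H, ∑ l, ((TensorProduct.mk R A V).flip (e l)).rTensor H
            (((coef B A (e.coord l)).restrictScalars R).rTensor H z) = z := by
          intro z
          induction z with
          | zero => simp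
          | add x y hx hy => simp only [map_add, Finset.sum_add_distrib, hx, hy]
          | tmul m h =>
            conv_rhs => rw [← sum_coef_tmul (B := B) e m, TensorProduct.sum_tmul]
            rfl
        rw [← hz z, ← hz w]
        exact Finset.sum_congr rfl fun l _ ↦ congrArg _ (hzw l)
      refine hinj _ _ fun l ↦ ?_
      rw [coef_diagCoact α hρ, h]
      rfl
  rw [h1]
  exact sum_mul_matrix_iff hc (fun k ↦ coef B A (e.coord k) x)
    (fun k ↦ α (coef B A (e.coord k) x))

/-- The invariant elements of `A ⊗ V` as equivariant maps `V^∨ → A`. -/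
def omegaEquiv (α : A →ₐ[B] A ⊗[R] H) (hc : IsMulMatrix R c)
    (hρ : ∀ k, ρ (e k) = ∑ l, e l ⊗ₜ[R] c l k) :
    invTensor α.toLinearMap ρ ≃ₗ[B] isoVec α.toLinearMap (dualMatrix R c) where
  toFun := fun x ↦ ⟨fun k ↦ coef B A (e.coord k) x.1, (mem_invTensor_iff α hc hρ x.1).1 x.2⟩
  map_add' := fun x y ↦ Subtype.ext (funext fun k ↦ map_add _ x.1 y.1)
  map_smul' := fun b x ↦ Subtype.ext (funext fun k ↦ map_smul _ b x.1)
  invFun := fun b ↦ ⟨∑ k, b.1 k ⊗ₜ[R] e k, by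
    rw [mem_invTensor_iff α hc hρ]
    convert b.2 using 1
    ext k
    exact coef_sum_tmul e b.1 k⟩
  left_inv := fun x ↦ Subtype.ext (sum_coef_tmul (B := B) e x.1)
  right_inv := fun b ↦ Subtype.ext (funext fun k ↦ coef_sum_tmul e b.1 k)

variable (e) in
/-- The coordinate `∑ a k ⊗ e k ↦ a k` of an invariant element of `A ⊗ V`. -/
def omegaCoord (α : A →ₐ[B] A ⊗[R] H) (ρ : V →ₗ[R] V ⊗[R] H) (k : κ) :
    invTensor α.toLinearMap ρ →ₗ[B] A :=
  coef B A (e.coord k) ∘ₗ (invTensor α.toLinearMap ρ).subtype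

theorem omegaCoord_apply (α : A →ₐ[B] A ⊗[R] H) (k : κ) (x : invTensor α.toLinearMap ρ) :
    omegaCoord e α ρ k x = coef B A (e.coord k) x.1 := rfl

theorem omegaCoord_mem (α : A →ₐ[B] A ⊗[R] H) (hc : IsMulMatrix R c)
    (hρ : ∀ k, ρ (e k) = ∑ l, e l ⊗ₜ[R] c l k) (x : invTensor α.toLinearMap ρ) :
    (fun k ↦ omegaCoord e α ρ k x) ∈ isoVec α.toLinearMap (dualMatrix R c) :=
  (omegaEquiv α hc hρ x).2

end Omega

section OmegaDecomposition

variable {R H : Type u} [CommRing R] [CommRing H] [HopfAlgebra R H]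
variable {B A : Type u} [CommRing B] [Algebra R B] [CommRing A] [Algebra R A] [Algebra B A]
  [IsScalarTower R B A]
variable {ι : Type*} [Fintype ι] [DecidableEq ι]
  {V : ι → Type u} [∀ i, AddCommGroup (V i)] [∀ i, Module R (V i)]
  {ρ : ∀ i, V i →ₗ[R] V i ⊗[R] H} {κ : ι → Type*} [∀ i, Fintype (κ i)] [∀ i, DecidableEq (κ i)]
  {e : ∀ i, Module.Basis (κ i) R (V i)} {c : ∀ i, Matrix (κ i) (κ i) H}

/-- The projection of `A` to the module of covariants `Ω_V` attached to a basis vector of `V`. -/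
def omegaProj (𝓑 : MatrixBasis R c) (hρ : ∀ i k, ρ i (e i k) = ∑ l, e i l ⊗ₜ[R] c i l k)
    (α : A →ₐ[B] A ⊗[R] H) (hα : IsCoaction α.toLinearMap) (p : Σ i, κ i) :
    A →ₗ[B] invTensor α.toLinearMap (ρ p.1) :=
  (omegaEquiv α (𝓑.mul p.1) (hρ p.1)).symm.toLinearMap ∘ₗ 𝓑.dual.proj hα p

variable (𝓑 : MatrixBasis R c) (hρ : ∀ i k, ρ i (e i k) = ∑ l, e i l ⊗ₜ[R] c i l k)
  {α : A →ₐ[B] A ⊗[R] H} (hα : IsCoaction α.toLinearMap)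

theorem omegaProj_apply (p : Σ i, κ i) (a : A) : (omegaProj 𝓑 hρ α hα p a).1 =
    ∑ k, coef B A (𝓑.dual.basis.coord ⟨p.1, k, p.2⟩) (α a) ⊗ₜ[R] e p.1 k := rfl

theorem omegaCoord_eq (i : ι) (k : κ i) (x : invTensor α.toLinearMap (ρ i)) :
    omegaCoord (e i) α (ρ i) k x = (omegaEquiv α (𝓑.mul i) (hρ i) x).1 k := rfl

theorem sum_omegaCoord_omegaProj (a : A) :
    ∑ p : Σ i, κ i, omegaCoord (e p.1) α (ρ p.1) p.2 (omegaProj 𝓑 hρ α hα p a) = a := by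
  conv_rhs => rw [← 𝓑.dual.sum_proj hα a]
  refine Finset.sum_congr rfl fun p _ ↦ ?_
  rw [omegaCoord_eq 𝓑 hρ, omegaProj, LinearMap.comp_apply, LinearEquiv.coe_coe,
    LinearEquiv.apply_symm_apply]

theorem omegaProj_omegaCoord_self (p : Σ i, κ i) (x : invTensor α.toLinearMap (ρ p.1)) :
    omegaProj 𝓑 hρ α hα p (omegaCoord (e p.1) α (ρ p.1) p.2 x) = x := by
  rw [omegaCoord_eq 𝓑 hρ, omegaProj, LinearMap.comp_apply]
  rw [show 𝓑.dual.proj hα p ((omegaEquiv α (𝓑.mul p.1) (hρ p.1) x).1 p.2) =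
    omegaEquiv α (𝓑.mul p.1) (hρ p.1) x from 𝓑.dual.proj_isoVec_self hα p.1 p.2 _]
  exact LinearEquiv.symm_apply_apply _ _

theorem omegaProj_omegaCoord_ne {p q : Σ i, κ i} (hpq : p ≠ q)
    (x : invTensor α.toLinearMap (ρ q.1)) :
    omegaProj 𝓑 hρ α hα p (omegaCoord (e q.1) α (ρ q.1) q.2 x) = 0 := by
  rw [omegaCoord_eq 𝓑 hρ, omegaProj, LinearMap.comp_apply]
  rw [show 𝓑.dual.proj hα p ((omegaEquiv α (𝓑.mul q.1) (hρ q.1) x).1 q.2) = 0 from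
    𝓑.dual.proj_isoVec_ne hα hpq _]
  exact map_zero _

end OmegaDecomposition

/-! ### The trace pairing on covariants -/

section TracePairing

variable {R H : Type u} [CommRing R] [CommRing H] [HopfAlgebra R H]
variable {B A : Type u} [CommRing B] [Algebra R B] [CommRing A] [Algebra R A] [Algebra B A]
  [IsScalarTower R B A]

theorem mulEval_eq_sum {V : Type u} [AddCommGroup V] [Module R V] {κ : Type*} [Fintype κ]
    [DecidableEq κ] (e : Module.Basis κ R V) (x : A ⊗[R] V) (y : A ⊗[R] Module.Dual R V) :
    mulEval B V x y = ∑ k, coef B A (e.coord k) x * coef B A (e.dualBasis.coord k) y := by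
  have h := sum_coef_tmul (B := B) e x
  have h' := sum_coef_tmul (B := B) e.dualBasis y
  conv_lhs => rw [← h, ← h']
  simp only [map_sum, LinearMap.sum_apply]
  refine Finset.sum_congr rfl fun k _ ↦ ?_
  rw [Finset.sum_eq_single k]
  · rw [mulEval_tmul]
    simp
  · intro l _ hl
    rw [mulEval_tmul]
    simp [hl]
  · simp

variable [IsLocalRing R] {ι : Type} [Fintype ι] [DecidableEq ι]
  (I : GoodLinearlyReductive R H ι)

namespace GoodLinearlyReductive

theorem coact_vecBasis (i : ι) (k : Fin (Module.finrank R (I.V i).carrier)) :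
    (I.V i).coact (I.vecBasis i k) = ∑ l, I.vecBasis i l ⊗ₜ[R] I.mat i l k :=
  coact_basis _ _ _

theorem dualCoact_vecBasis (i : ι) (k : Fin (Module.finrank R (I.V i).carrier)) :
    dualCoact (I.V i) ((I.vecBasis i).dualBasis k) =
      ∑ l, (I.vecBasis i).dualBasis l ⊗ₜ[R] dualMatrix R (I.mat i) l k :=
  dualCoact_dualBasis _ _ _

variable {I} {α : A →ₐ[B] A ⊗[R] H}

theorem omegaCoord_mem_isoVec {i : ι} (x : invTensor α.toLinearMap (I.V i).coact) :
    (fun k ↦ omegaCoord (I.vecBasis i) α _ k x) ∈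
      isoVec α.toLinearMap (dualMatrix R (I.mat i)) :=
  omegaCoord_mem α (I.matrixBasis.mul i) (I.coact_vecBasis i) x

theorem omegaCoord_dual_mem_isoVec {i : ι} (y : invTensor α.toLinearMap (dualCoact (I.V i))) :
    (fun k ↦ omegaCoord (I.vecBasis i).dualBasis α _ k y) ∈ isoVec α.toLinearMap (I.mat i) := by
  have := omegaCoord_mem α (I.matrixBasis.mul i).dual (I.dualCoact_vecBasis i) y
  rwa [(I.matrixBasis.mul i).dualMatrix_dualMatrix] at this

variable [Module.Finite B A] [Module.Projective B A]

theorem algTrace_omegaCoord_of_ne (hα : IsCoaction α.toLinearMap) {i j : ι} (hij : i ≠ j)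
    (x : invTensor α.toLinearMap (I.V i).coact) (y : invTensor α.toLinearMap (dualCoact (I.V j)))
    (k l) : algTrace B A (omegaCoord (I.vecBasis i) α _ k x *
      omegaCoord (I.vecBasis j).dualBasis α _ l y) = 0 :=
  I.matrixBasis.algTrace_mul_of_ne hα hij (omegaCoord_mem_isoVec x) (omegaCoord_dual_mem_isoVec y)
    k l

theorem finrank_mul_algTrace_omegaCoord (hα : IsCoaction α.toLinearMap) {i : ι}
    (x : invTensor α.toLinearMap (I.V i).coact) (y : invTensor α.toLinearMap (dualCoact (I.V i)))
    (k l) : (Module.finrank R (I.V i).carrier : B) * algTrace B A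
      (omegaCoord (I.vecBasis i) α _ k x * omegaCoord (I.vecBasis i).dualBasis α _ l y) =
    if k = l then algTrace B A (mulEval B (I.V i).carrier x.1 y.1) else 0 := by
  rw [mulEval_eq_sum (I.vecBasis i)]
  have := I.matrixBasis.card_mul_algTrace_mul hα (omegaCoord_mem_isoVec x)
    (omegaCoord_dual_mem_isoVec y) k l
  rwa [Fintype.card_fin] at this

/-- The trace vanishes on the isotypic components of nontrivial representations. -/
theorem algTrace_omegaCoord_eq_zero (hα : IsCoaction α.toLinearMap) {i : ι} (hi : i ≠ I.triv)
    (x : invTensor α.toLinearMap (I.V i).coact) (k) :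
    algTrace B A (omegaCoord (I.vecBasis i) α _ k x) = 0 := by
  have h0 : (0 : ℕ) < Module.finrank R (I.V I.triv).carrier := I.finrank_pos _
  refine I.matrixBasis.dual.invariant_vec_eq_zero hi.symm (k := ⟨0, h0⟩) ?_
    (MatrixBasis.algTrace_vec hα (omegaCoord_mem_isoVec x)) k
  rw [dualMatrix, I.mat_triv, Matrix.one_apply_eq, HopfAlgebra.antipode_one]

/-- The coordinates of the covariants of the trivial representation are invariants of `A`. -/
theorem omegaCoord_triv_mem (x : invTensor α.toLinearMap (I.V I.triv).coact) (k) :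
    omegaCoord (I.vecBasis I.triv) α _ k x ∈ invAlg α.toLinearMap := by
  have h : α (omegaCoord (I.vecBasis I.triv) α _ k x) = _ := omegaCoord_mem_isoVec x k
  change α (omegaCoord (I.vecBasis I.triv) α _ k x) =
    omegaCoord (I.vecBasis I.triv) α _ k x ⊗ₜ[R] (1 : H)
  rw [h, I.mat_triv, Finset.sum_eq_single k]
  · rw [dualMatrix, Matrix.one_apply_eq, HopfAlgebra.antipode_one]
  · intro l _ hl
    rw [dualMatrix, Matrix.one_apply_ne hl.symm, map_zero, TensorProduct.tmul_zero]
  · simp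

theorem algTrace_algebraMap (b : B) :
    algTrace B A (algebraMap B A b) = b * algTrace B A 1 := by
  rw [Algebra.algebraMap_eq_smul_one, map_smul, smul_eq_mul]

end GoodLinearlyReductive

end TracePairing

/-! ### Isotypic components of the algebra and the kernel of the trace -/

section CovEval

variable {R H : Type u} [CommRing R] [CommRing H] [HopfAlgebra R H]
variable {B A : Type u} [CommRing B] [Algebra R B] [CommRing A] [Algebra R A] [Algebra B A]
  [IsScalarTower R B A]
variable {V : Type u} [AddCommGroup V] [Module R V]

/-- The evaluation `(A ⊗ V)^G ⊗ V^∨ → A`. -/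
def covEval (α : A →ₐ[B] A ⊗[R] H) (ρ : V →ₗ[R] V ⊗[R] H) :
    invTensor α.toLinearMap ρ ⊗[R] Module.Dual R V →ₗ[B] A :=
  (AlgebraTensorModule.rid R B A).toLinearMap ∘ₗ
    AlgebraTensorModule.map (LinearMap.id : A →ₗ[B] A) (contractRight R V) ∘ₗ
    (AlgebraTensorModule.assoc R R B A V (Module.Dual R V)).toLinearMap ∘ₗ
    AlgebraTensorModule.map (invTensor α.toLinearMap ρ).subtype LinearMap.id

theorem covEval_tmul (α : A →ₐ[B] A ⊗[R] H) (ρ : V →ₗ[R] V ⊗[R] H)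
    (x : invTensor α.toLinearMap ρ) (φ : Module.Dual R V) :
    covEval α ρ (x ⊗ₜ φ) = coef B A φ x.1 := by
  obtain ⟨x, hx⟩ := x
  simp only [covEval, LinearMap.comp_apply, AlgebraTensorModule.map_tmul, Submodule.subtype_apply,
    LinearMap.id_apply]
  clear hx
  induction x with
  | zero => simp
  | add x y hx hy => simp only [map_add, TensorProduct.add_tmul, hx, hy]
  | tmul a v => simp

theorem covEval_tmul_dualBasis {κ : Type*} [Fintype κ] [DecidableEq κ] (α : A →ₐ[B] A ⊗[R] H)
    (ρ : V →ₗ[R] V ⊗[R] H) (e : Module.Basis κ R V)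
    (x : invTensor α.toLinearMap ρ) (k : κ) :
    covEval α ρ (x ⊗ₜ e.dualBasis k) = omegaCoord e α ρ k x := by
  rw [covEval_tmul, omegaCoord_apply, Module.Basis.coe_dualBasis]

theorem covEval_eq_sum {κ : Type*} [Fintype κ] [DecidableEq κ] (α : A →ₐ[B] A ⊗[R] H)
    (ρ : V →ₗ[R] V ⊗[R] H) (e : Module.Basis κ R V)
    (z : invTensor α.toLinearMap ρ ⊗[R] Module.Dual R V) :
    covEval α ρ z = ∑ k, omegaCoord e α ρ k
      (coef B (invTensor α.toLinearMap ρ) (e.dualBasis.coord k) z) := by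
  conv_lhs => rw [← sum_coef_tmul (B := B) (M := invTensor α.toLinearMap ρ) e.dualBasis z]
  rw [map_sum]
  exact Finset.sum_congr rfl fun k _ ↦ covEval_tmul_dualBasis α ρ e _ k

/-- The evaluation is equivariant for the dual representation on `V^∨` and the trivial action on
the covariants. -/
theorem covEval_coact {κ : Type*} [Fintype κ] [DecidableEq κ] (α : A →ₐ[B] A ⊗[R] H)
    (V : Comod R H) [Module.Finite R V.carrier] [Module.Projective R V.carrier]
    (e : Module.Basis κ R V.carrier)
    (z : invTensor α.toLinearMap V.coact ⊗[R] Module.Dual R V.carrier) :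
    α (covEval α V.coact z) = ((covEval α V.coact).restrictScalars R).rTensor H
      ((TensorProduct.assoc R _ _ H).symm ((dualCoact V).lTensor _ z)) := by
  rw [← sum_coef_tmul (B := B) (M := invTensor α.toLinearMap V.coact) e.dualBasis z]
  simp only [map_sum]
  refine Finset.sum_congr rfl fun k _ ↦ ?_
  generalize coef B (invTensor α.toLinearMap V.coact) (e.dualBasis.coord k) z = x
  rw [covEval_tmul_dualBasis, LinearMap.lTensor_tmul, dualCoact_dualBasis, TensorProduct.tmul_sum,
    map_sum, map_sum]
  refine (omegaCoord_mem α (isMulMatrix_coactMatrix V e) (coact_basis V.coact e) x k).trans ?_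
  refine Finset.sum_congr rfl fun l _ ↦ ?_
  rw [TensorProduct.assoc_symm_tmul, LinearMap.rTensor_tmul, LinearMap.coe_restrictScalars,
    covEval_tmul_dualBasis]

end CovEval

section KerTrace

variable {R H : Type u} [CommRing R] [IsLocalRing R] [CommRing H] [HopfAlgebra R H]
  {ι : Type} [Fintype ι] [DecidableEq ι] (I : GoodLinearlyReductive R H ι)
variable {B A : Type u} [CommRing B] [Algebra R B] [CommRing A] [Algebra R A] [Algebra B A]
  [IsScalarTower R B A] [Module.Finite B A] [Module.Projective B A]
  {α : A →ₐ[B] A ⊗[R] H} (hα : IsCoaction α.toLinearMap)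

namespace GoodLinearlyReductive

/-- The index set of the decomposition of `A`: a representation `V i` and a vector of its basis. -/
abbrev Idx : Type := Σ i : ι, Fin (Module.finrank R (I.V i).carrier)

/-- The coordinate function `Ω_V → A` of a basis vector of `V`. -/
abbrev coordV (α : A →ₐ[B] A ⊗[R] H) (p : I.Idx) :
    invTensor α.toLinearMap (I.V p.1).coact →ₗ[B] A :=
  omegaCoord (I.vecBasis p.1) α (I.V p.1).coact p.2

/-- The projection `A → Ω_V` of a basis vector of `V`. -/
abbrev projV (p : I.Idx) : A →ₗ[B] invTensor α.toLinearMap (I.V p.1).coact :=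
  omegaProj I.matrixBasis I.coact_vecBasis α hα p

theorem sum_coordV_projV (a : A) : ∑ p : I.Idx, I.coordV α p (I.projV hα p a) = a :=
  sum_omegaCoord_omegaProj I.matrixBasis I.coact_vecBasis hα a

theorem projV_coordV_self (p : I.Idx) (x : invTensor α.toLinearMap (I.V p.1).coact) :
    I.projV hα p (I.coordV α p x) = x :=
  omegaProj_omegaCoord_self I.matrixBasis I.coact_vecBasis hα p x

theorem projV_coordV_ne {p q : I.Idx} (hpq : p ≠ q) (x : invTensor α.toLinearMap (I.V q.1).coact) :
    I.projV hα p (I.coordV α q x) = 0 :=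
  omegaProj_omegaCoord_ne I.matrixBasis I.coact_vecBasis hα hpq x

variable {I}

theorem coordV_triv_eq_zero
    (hinv : ∀ a ∈ invAlg α.toLinearMap, ∃ b, algebraMap B A b = a)
    (hone : IsUnit (algTrace B A 1)) (k)
    (x : invTensor α.toLinearMap (I.V I.triv).coact)
    (hx : algTrace B A (I.coordV α ⟨I.triv, k⟩ x) = 0) : I.coordV α ⟨I.triv, k⟩ x = 0 := by
  obtain ⟨b, hb⟩ := hinv _ (omegaCoord_triv_mem (I := I) (α := α) x k)
  change algTrace B A (omegaCoord (I.vecBasis I.triv) _ _ k x) = 0 at hx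
  rw [← hb, algTrace_algebraMap, hone.mul_left_eq_zero] at hx
  change omegaCoord (I.vecBasis I.triv) _ _ k x = 0
  rw [← hb, hx, map_zero]

/-- The trivial component of an element of trace zero vanishes. -/
theorem projV_triv_eq_zero
    (hinv : ∀ a ∈ invAlg α.toLinearMap, ∃ b, algebraMap B A b = a)
    (hone : IsUnit (algTrace B A 1)) {a : A} (ha : algTrace B A a = 0) (k) :
    I.projV hα ⟨I.triv, k⟩ a = 0 := by
  have h0 : I.coordV α ⟨I.triv, k⟩ (I.projV hα ⟨I.triv, k⟩ a) = 0 := by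
    refine coordV_triv_eq_zero hinv hone k _ ?_
    rw [← ha]
    conv_rhs => rw [← I.sum_coordV_projV hα a]
    rw [map_sum, Fintype.sum_sigma, Finset.sum_eq_single I.triv]
    · have hs : Subsingleton (Fin (Module.finrank R (I.V I.triv).carrier)) := by
        rw [I.finrank_triv]
        infer_instance
      rw [Finset.sum_eq_single k]
      · intro l _ hl
        exact absurd (Subsingleton.elim l k) hl
      · simp
    · intro i _ hi
      exact Finset.sum_eq_zero fun k _ ↦ algTrace_omegaCoord_eq_zero hα hi _ k
    · simp
  rw [← I.projV_coordV_self hα ⟨I.triv, k⟩ (I.projV hα ⟨I.triv, k⟩ a), h0, map_zero]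

theorem algTrace_covEval (hα : IsCoaction α.toLinearMap) {i : ι} (hi : i ≠ I.triv)
    (z : invTensor α.toLinearMap (I.V i).coact ⊗[R] Module.Dual R (I.V i).carrier) :
    algTrace B A (covEval α (I.V i).coact z) = 0 := by
  rw [covEval_eq_sum α _ (I.vecBasis i), map_sum]
  exact Finset.sum_eq_zero fun k _ ↦ algTrace_omegaCoord_eq_zero hα hi _ k

variable (I)

/-- The component `a ↦ ∑ k, P k (a) ⊗ e* k` of the isotypic decomposition of `A`. -/
def isoComp (i : ι) :
    A →ₗ[B] invTensor α.toLinearMap (I.V i).coact ⊗[R] Module.Dual R (I.V i).carrier :=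
  ∑ k, (AlgebraTensorModule.mk R B _ _).flip ((I.vecBasis i).dualBasis k) ∘ₗ I.projV hα ⟨i, k⟩

theorem isoComp_apply (i : ι) (a : A) : I.isoComp hα i a =
    ∑ k, I.projV hα ⟨i, k⟩ a ⊗ₜ[R] (I.vecBasis i).dualBasis k := by
  rw [isoComp, LinearMap.sum_apply]
  rfl

theorem sum_covEval_isoComp (a : A) :
    ∑ i, covEval α (I.V i).coact (I.isoComp hα i a) = a := by
  conv_rhs => rw [← I.sum_coordV_projV hα a, Fintype.sum_sigma]
  refine Finset.sum_congr rfl fun i _ ↦ ?_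
  rw [isoComp_apply, map_sum]
  exact Finset.sum_congr rfl fun k _ ↦ covEval_tmul_dualBasis α _ _ _ k

theorem isoComp_covEval_self (i : ι)
    (z : invTensor α.toLinearMap (I.V i).coact ⊗[R] Module.Dual R (I.V i).carrier) :
    I.isoComp hα i (covEval α (I.V i).coact z) = z := by
  conv_rhs => rw [← sum_coef_tmul (B := B) (M := invTensor α.toLinearMap (I.V i).coact)
    (I.vecBasis i).dualBasis z]
  rw [isoComp_apply, covEval_eq_sum α _ (I.vecBasis i)]
  refine Finset.sum_congr rfl fun k _ ↦ ?_
  congr 1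
  rw [map_sum, Finset.sum_eq_single k]
  · exact I.projV_coordV_self hα ⟨i, k⟩ _
  · intro l _ hl
    exact I.projV_coordV_ne hα (p := ⟨i, k⟩) (q := ⟨i, l⟩) (by simpa using hl.symm) _
  · simp

theorem isoComp_covEval_ne {i j : ι} (hij : i ≠ j)
    (z : invTensor α.toLinearMap (I.V j).coact ⊗[R] Module.Dual R (I.V j).carrier) :
    I.isoComp hα i (covEval α (I.V j).coact z) = 0 := by
  rw [isoComp_apply, covEval_eq_sum α _ (I.vecBasis j)]
  refine Finset.sum_eq_zero fun k _ ↦ ?_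
  rw [map_sum, Finset.sum_eq_zero, TensorProduct.zero_tmul]
  intro l _
  exact I.projV_coordV_ne hα (p := ⟨i, k⟩) (q := ⟨j, l⟩) (fun h ↦ hij (congrArg Sigma.fst h)) _

/-- The kernel of the trace is the sum of the isotypic components of the nontrivial
representations. -/
def kerTraceEquiv
    (hinv : ∀ a ∈ invAlg α.toLinearMap, ∃ b, algebraMap B A b = a)
    (hone : IsUnit (algTrace B A 1)) :
    LinearMap.ker (algTrace B A) ≃ₗ[B] ∀ i : {i : ι // i ≠ I.triv},
      invTensor α.toLinearMap (I.V i).coact ⊗[R] Module.Dual R (I.V i).carrier where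
  toFun := fun a i ↦ I.isoComp hα i.1 a.1
  map_add' := fun a b ↦ funext fun i ↦ map_add _ a.1 b.1
  map_smul' := fun c a ↦ funext fun i ↦ map_smul _ c a.1
  invFun := fun y ↦ ⟨∑ i : {i : ι // i ≠ I.triv}, covEval α (I.V i).coact (y i), by
    rw [LinearMap.mem_ker, map_sum]
    exact Finset.sum_eq_zero fun i _ ↦ algTrace_covEval hα i.2 _⟩
  left_inv := fun a ↦ Subtype.ext <| by
    have h := I.sum_covEval_isoComp hα a.1
    rw [← Fintype.sum_subtype_add_sum_subtype (fun i ↦ i ≠ I.triv)] at h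
    refine Eq.trans ?_ h
    rw [left_eq_add]
    refine Finset.sum_eq_zero fun ⟨i, hi⟩ _ ↦ ?_
    obtain rfl : i = I.triv := not_not.1 hi
    rw [isoComp_apply, Finset.sum_eq_zero, map_zero]
    intro k _
    rw [projV_triv_eq_zero hα hinv hone a.2, TensorProduct.zero_tmul]
  right_inv := fun y ↦ funext fun i ↦ by
    dsimp only
    rw [map_sum, Finset.sum_eq_single i]
    · exact I.isoComp_covEval_self hα _ _
    · intro j _ hj
      exact I.isoComp_covEval_ne hα (fun h ↦ hj (Subtype.ext h.symm)) _
    · simp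

end GoodLinearlyReductive

end KerTrace

/-! ### The kernel of the trace as an equivariant sheaf -/

section SheafDecomposition

variable {R H : Type u} [CommRing R] [CommRing H] [HopfAlgebra R H]
  {T : Scheme.{u}} {t : T ⟶ Spec (CommRingCat.of R)} (A : EquivAlg t H)

theorem EquivAlg.isCoaction (U : T.affineOpens) : IsCoaction (A.coact U).toLinearMap :=
  ⟨A.coassoc U, A.counit U⟩

theorem EquivAlg.algTrace_one {n : ℕ} (hrk : A.HasRank n) (U : T.affineOpens) :
    algTrace (Sec t U) (A.obj U) 1 = n :=
  GCov.algTrace_one n (hrk U)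

theorem omegaCoord_res {V : Type u} [AddCommGroup V] [Module R V] {κ : Type*} [Fintype κ]
    [DecidableEq κ] (e : Module.Basis κ R V) (ρ : V →ₗ[R] V ⊗[R] H) {U W : T.affineOpens}
    (h : U ≤ W) (k : κ) (x : (A.Omega V ρ).obj W) :
    omegaCoord e (A.coact U) ρ k ((A.Omega V ρ).res h x) =
      A.res h (omegaCoord e (A.coact W) ρ k x) :=
  coef_rTensor (e.coord k) (A.resBase h) x.1

theorem omegaProj_res {ι : Type*} [Fintype ι] [DecidableEq ι]
    {V : ι → Type u} [∀ i, AddCommGroup (V i)] [∀ i, Module R (V i)]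
    {ρ : ∀ i, V i →ₗ[R] V i ⊗[R] H} {κ : ι → Type*} [∀ i, Fintype (κ i)] [∀ i, DecidableEq (κ i)]
    {e : ∀ i, Module.Basis (κ i) R (V i)} {c : ∀ i, Matrix (κ i) (κ i) H}
    (𝓑 : MatrixBasis R c) (hρ : ∀ i k, ρ i (e i k) = ∑ l, e i l ⊗ₜ[R] c i l k)
    (p : Σ i, κ i) {U W : T.affineOpens} (h : U ≤ W) (a : A.obj W) :
    omegaProj 𝓑 hρ (A.coact U) (A.isCoaction U) p (A.res h a) =
      (A.Omega (V p.1) (ρ p.1)).res h (omegaProj 𝓑 hρ (A.coact W) (A.isCoaction W) p a) := by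
  refine Subtype.ext ?_
  change _ = (A.resBase h).rTensor (V p.1) (omegaProj 𝓑 hρ (A.coact W) (A.isCoaction W) p a).1
  rw [omegaProj_apply, omegaProj_apply, map_sum]
  refine Finset.sum_congr rfl fun k _ ↦ ?_
  rw [LinearMap.rTensor_tmul, A.coact_res]
  congr 1
  exact coef_rTensor (𝓑.dual.basis.coord ⟨p.1, k, p.2⟩) (A.resBase h) (A.coact W a)

end SheafDecomposition

section KerTraceCoaction

variable {R H : Type u} [CommRing R] [IsLocalRing R] [CommRing H] [HopfAlgebra R H]
  {ι : Type} [Fintype ι] [DecidableEq ι] (I : GoodLinearlyReductive R H ι)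
variable {B A : Type u} [CommRing B] [Algebra R B] [CommRing A] [Algebra R A] [Algebra B A]
  [IsScalarTower R B A] [Module.Finite B A] [Module.Projective B A]
  {α : A →ₐ[B] A ⊗[R] H} (hα : IsCoaction α.toLinearMap)

namespace GoodLinearlyReductive

/-- Equivariance of `kerTraceEquiv` for the dual action on `V^∨` and the trivial one on `Ω_V`. -/
theorem kerTraceEquiv_coact
    (hinv : ∀ a ∈ invAlg α.toLinearMap, ∃ b, algebraMap B A b = a)
    (hone : IsUnit (algTrace B A 1))
    (y : ∀ i : {i : ι // i ≠ I.triv},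
      invTensor α.toLinearMap (I.V i).coact ⊗[R] Module.Dual R (I.V i).carrier) :
    α (((LinearMap.ker (algTrace B A)).subtype) ((I.kerTraceEquiv hα hinv hone).symm y)) =
      (((LinearMap.ker (algTrace B A)).subtype ∘ₗ
        (I.kerTraceEquiv hα hinv hone).symm.toLinearMap).restrictScalars R).rTensor H
      ((∑ i, (LinearMap.single R (fun i : {i : ι // i ≠ I.triv} ↦
        invTensor α.toLinearMap (I.V i).coact ⊗[R] Module.Dual R (I.V i).carrier) i).rTensor H ∘ₗ
        ((TensorProduct.assoc R _ _ H).symm.toLinearMap ∘ₗ (dualCoact (I.V i)).lTensor _) ∘ₗ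
          LinearMap.proj i :
        (∀ i : {i : ι // i ≠ I.triv},
      invTensor α.toLinearMap (I.V i).coact ⊗[R] Module.Dual R (I.V i).carrier) →ₗ[R] _) y) := by
  have hg : ∀ y : ∀ i : {i : ι // i ≠ I.triv},
      invTensor α.toLinearMap (I.V i).coact ⊗[R] Module.Dual R (I.V i).carrier,
      ((LinearMap.ker (algTrace B A)).subtype ((I.kerTraceEquiv hα hinv hone).symm y)) =
        ∑ i : {i : ι // i ≠ I.triv}, covEval α (I.V i).coact (y i) := fun y ↦ rfl
  have hgi : ∀ i : {i : ι // i ≠ I.triv},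
      (((LinearMap.ker (algTrace B A)).subtype ∘ₗ
        (I.kerTraceEquiv hα hinv hone).symm.toLinearMap).restrictScalars R) ∘ₗ
        LinearMap.single R _ i = (covEval α (I.V i).coact).restrictScalars R := by
    intro i
    refine LinearMap.ext fun z ↦ ?_
    refine (hg _).trans ?_
    rw [Finset.sum_eq_single i]
    · rw [LinearMap.single_apply, Pi.single_eq_same]
      rfl
    · intro j _ hj
      rw [LinearMap.single_apply, Pi.single_eq_of_ne hj, map_zero]
    · simp
  rw [hg, map_sum, LinearMap.sum_apply, map_sum]
  refine Finset.sum_congr rfl fun i _ ↦ ?_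
  rw [covEval_coact α (I.V i) (I.vecBasis i), ← hgi, LinearMap.rTensor_comp]
  rfl

end GoodLinearlyReductive

end KerTraceCoaction

section KerTraceIso

variable {R H : Type u} [CommRing R] [IsLocalRing R] [CommRing H] [HopfAlgebra R H]
  [Module.Finite R H] [Algebra.Etale R H]
  {ι : Type} [Fintype ι] [DecidableEq ι] (I : GoodLinearlyReductive R H ι)
  {T : Scheme.{u}} {t : T ⟶ Spec (CommRingCat.of R)} (A : EquivAlg t H)

namespace GoodLinearlyReductive

theorem isoComp_res (i : ι) {U W : T.affineOpens} (h : U ≤ W) (a : A.obj W) :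
    I.isoComp (A.isCoaction U) i (A.res h a) =
      (AffMod.twist (I.V i).carrier (A.Omega (I.V i).carrier (I.V i).coact)).res h
        (I.isoComp (A.isCoaction W) i a) := by
  refine Eq.trans ?_ (congrArg ((AffMod.twist (I.V i).carrier
    (A.Omega (I.V i).carrier (I.V i).coact)).res h) (I.isoComp_apply (A.isCoaction W) i a)).symm
  rw [isoComp_apply]
  refine Eq.trans ?_ (map_sum _ _ _).symm
  refine Finset.sum_congr rfl fun k _ ↦ ?_
  exact congrArg (· ⊗ₜ[R] (I.vecBasis i).dualBasis k)
    (omegaProj_res A I.matrixBasis I.coact_vecBasis ⟨i, k⟩ h a)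

variable {A} in
theorem isUnit_algTrace_one (I : GoodLinearlyReductive R H ι) (hrk : A.HasRank (Module.finrank R H)) (U : T.affineOpens) :
    IsUnit (algTrace (Sec t U) (A.obj U) 1) := by
  rw [A.algTrace_one hrk]
  have := I.isUnit_finrank.map (algebraMap R (Sec t U))
  rwa [map_natCast] at this

variable {A} in
/-- The isomorphism `Ker tr ≃ ⨁ V^∨ ⊗ Ω_V` over the nontrivial representations. -/
def kerTraceIso (hA : A.InvEqBase) (hrk : A.HasRank (Module.finrank R H)) :
    AffMod.Iso A.kerTrace (AffMod.directSum fun i : {i : ι // i ≠ I.triv} ↦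
      AffMod.twist (I.V i).carrier (A.Omega (I.V i).carrier (I.V i).coact)) where
  app := fun U ↦ I.kerTraceEquiv (B := Sec t U) (A := A.obj U) (α := A.coact U) (A.isCoaction U)
    (fun a ha ↦ ((hA U).2 a).1 ha) (I.isUnit_algTrace_one hrk U)
  naturality := fun h x ↦ funext fun i ↦ I.isoComp_res A i h x.1

theorem kerTraceIso_equivariant (hA : A.InvEqBase) (hrk : A.HasRank (Module.finrank R H))
    (U : T.affineOpens) (y) :
    A.coact U ((AffMod.kerIncl A.trace).app U (((I.kerTraceIso hA hrk).app U).symm y)) =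
      (((AffMod.kerIncl A.trace).app U ∘ₗ
        ((I.kerTraceIso hA hrk).app U).symm.toLinearMap).restrictScalars R).rTensor H
          (AffMod.directSumCoact _ U
            (fun i : {i : ι // i ≠ I.triv} ↦ AffMod.twistCoact (I.V i) _ U) y) := by
  refine I.kerTraceEquiv_coact (B := Sec t U) (A := A.obj U) (α := A.coact U) (A.isCoaction U)
    (fun a ha ↦ ((hA U).2 a).1 ha) (I.isUnit_algTrace_one hrk U) y

end GoodLinearlyReductive

end KerTraceIso

/-! ### Orthogonal sums of pairings of sheaves -/

section DirectSumDecomposition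

variable {R : Type u} [CommRing R] {T : Scheme.{u}} {t : T ⟶ Spec (CommRingCat.of R)}

namespace AffMod

/-- The map `N^∨ → M^∨` dual to a morphism `M → N`. -/
def Hom.dualMap {M N : AffMod t} (f : Hom M N) : Hom (dual N) (dual M) where
  app := fun U ↦
    { toFun := fun φ ↦ ⟨fun W hW ↦ DualSec.form φ W hW ∘ₗ f.app W, fun h hW x ↦ by
        rw [LinearMap.comp_apply, f.naturality]
        exact DualSec.compat φ h hW _⟩
      map_add' := fun _ _ ↦ rfl
      map_smul' := fun _ _ ↦ rfl }
  naturality := fun _ _ ↦ rfl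

/-- A decomposition of the sheaf `M` as a finite direct sum of the sheaves `N p`, given by the
inclusions and the projections. -/
structure Decomposition {κ : Type} [Fintype κ] (M : AffMod t) (N : κ → AffMod t) where
  incl : ∀ p, Hom (N p) M
  proj : ∀ p, Hom M (N p)
  sum_incl_proj : ∀ U (x : M.obj U), ∑ p, (incl p).app U ((proj p).app U x) = x
  proj_incl_self : ∀ U p (x : (N p).obj U), (proj p).app U ((incl p).app U x) = x
  proj_incl_ne : ∀ U {p q}, p ≠ q → ∀ x : (N q).obj U, (proj p).app U ((incl q).app U x) = 0

variable {κ : Type} [Fintype κ] {M M' : AffMod t} {N N' : κ → AffMod t}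

/-- The pairing `β` is the orthogonal sum of the pairings `γ p` for the given decompositions of its
two arguments. -/
structure Pairing.IsOrthogonalSum (β : Pairing M M') (γ : ∀ p, Pairing (N p) (N' p))
    (D : Decomposition M N) (D' : Decomposition M' N') : Prop where
  form_self : ∀ U p (x : (N p).obj U) (y : (N' p).obj U),
    β.form U ((D.incl p).app U x) ((D'.incl p).app U y) = (γ p).form U x y
  form_ne : ∀ U {p q}, p ≠ q → ∀ (x : (N p).obj U) (y : (N' q).obj U),
    β.form U ((D.incl p).app U x) ((D'.incl q).app U y) = 0

namespace Pairing.IsOrthogonalSum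

variable {β : Pairing M M'} {γ : ∀ p, Pairing (N p) (N' p)}
  {D : Decomposition M N} {D' : Decomposition M' N'}

theorem form_incl_left (h : β.IsOrthogonalSum γ D D') (U p) (x : (N p).obj U) (y : M'.obj U) :
    β.form U ((D.incl p).app U x) y = (γ p).form U x ((D'.proj p).app U y) := by
  conv_lhs => rw [← D'.sum_incl_proj U y]
  rw [map_sum, Finset.sum_eq_single p, h.form_self]
  · intro q _ hq
    exact h.form_ne U hq.symm _ _
  · simp

theorem form_incl_right (h : β.IsOrthogonalSum γ D D') (U p) (x : M.obj U) (y : (N' p).obj U) :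
    β.form U x ((D'.incl p).app U y) = (γ p).form U ((D.proj p).app U x) y := by
  conv_lhs => rw [← D.sum_incl_proj U x]
  rw [map_sum, LinearMap.sum_apply, Finset.sum_eq_single p, h.form_self]
  · intro q _ hq
    exact h.form_ne U hq _ _
  · simp

theorem dualMap_toDual (h : β.IsOrthogonalSum γ D D') (U p) (y : M'.obj U) :
    (D.incl p).dualMap.app U (β.toDual.app U y) =
      (γ p).toDual.app U ((D'.proj p).app U y) := by
  refine DualSec.ext' fun W hW ↦ LinearMap.ext fun x ↦ ?_
  refine (h.form_incl_left W p x (M'.res hW y)).trans ?_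
  rw [(D'.proj p).naturality]
  rfl

theorem toDual_incl (h : β.IsOrthogonalSum γ D D') (U p) (y : (N' p).obj U) :
    β.toDual.app U ((D'.incl p).app U y) =
      (D.proj p).dualMap.app U ((γ p).toDual.app U y) := by
  refine DualSec.ext' fun W hW ↦ LinearMap.ext fun x ↦ ?_
  exact (congrArg (β.form W x) ((D'.incl p).naturality hW y).symm).trans
    (h.form_incl_right W p x ((N' p).res hW y))

end Pairing.IsOrthogonalSum

theorem Decomposition.sum_dualMap (D : Decomposition M N) (U) (φ : (dual M).obj U) :
    ∑ p, (D.proj p).dualMap.app U ((D.incl p).dualMap.app U φ) = φ := by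
  refine DualSec.ext' fun W hW ↦ LinearMap.ext fun x ↦ ?_
  let ev : DualSec M U →+ Sec t W :=
    { toFun := fun φ ↦ φ.form W hW x, map_zero' := rfl, map_add' := fun _ _ ↦ rfl }
  refine (map_sum ev _ _).trans ?_
  refine (map_sum (DualSec.form φ W hW) _ _).symm.trans ?_
  rw [D.sum_incl_proj]

theorem Decomposition.dualMap_self (D : Decomposition M N) (U p) (φ : (dual (N p)).obj U) :
    (D.incl p).dualMap.app U ((D.proj p).dualMap.app U φ) = φ :=
  DualSec.ext' fun W hW ↦ LinearMap.ext fun x ↦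
    congrArg (DualSec.form φ W hW) (D.proj_incl_self W p x)

theorem Decomposition.dualMap_ne (D : Decomposition M N) (U) {p q} (hpq : p ≠ q)
    (φ : (dual (N q)).obj U) :
    (D.incl p).dualMap.app U ((D.proj q).dualMap.app U φ) = 0 :=
  DualSec.ext' fun W hW ↦ LinearMap.ext fun x ↦
    (congrArg (DualSec.form φ W hW) (D.proj_incl_ne W hpq.symm x)).trans (map_zero _)

/-- The projection from `M^∨` to the sum of the cokernels of `N' p → (N p)^∨`. -/
def toCoker (D : Decomposition M N) (γ : ∀ p, Pairing (N p) (N' p)) (U) :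
    (dual M).obj U →ₗ[Sec t U] (directSum fun p ↦ coker (γ p).toDual).obj U where
  toFun := fun φ p ↦ Submodule.mkQ _ ((D.incl p).dualMap.app U φ)
  map_add' := fun φ ψ ↦ funext fun p ↦ by
    rw [map_add, map_add]
    rfl
  map_smul' := fun c φ ↦ funext fun p ↦ by
    rw [map_smul, map_smul]
    rfl

theorem toCoker_surjective (D : Decomposition M N) (γ : ∀ p, Pairing (N p) (N' p)) (U) :
    Function.Surjective (toCoker D γ U) := by
  intro z
  choose ψ hψ using fun p ↦ Submodule.mkQ_surjective _ (z p)
  refine ⟨∑ p, (D.proj p).dualMap.app U (ψ p), funext fun q ↦ ?_⟩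
  refine Eq.trans ?_ (hψ q)
  refine congrArg (Submodule.mkQ _) ?_
  rw [map_sum, Finset.sum_eq_single q, D.dualMap_self]
  · intro p _ hp
    exact D.dualMap_ne U hp.symm _
  · simp

/-- A form on `M` is represented by a section of `M'` if and only if each component is represented by
a section of `N' p`. -/
theorem Pairing.IsOrthogonalSum.ker_toCoker {β : Pairing M M'} {γ : ∀ p, Pairing (N p) (N' p)}
    {D : Decomposition M N} {D' : Decomposition M' N'} (h : β.IsOrthogonalSum γ D D') (U) :
    LinearMap.ker (toCoker D γ U) = LinearMap.range (β.toDual.app U) := by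
  refine le_antisymm (fun φ hφ ↦ ?_) ?_
  · have hp : ∀ p, ∃ y, (γ p).toDual.app U y = (D.incl p).dualMap.app U φ := fun p ↦
      (Submodule.Quotient.mk_eq_zero _).1 (congrFun (show toCoker D γ U φ = 0 from hφ) p)
    choose y hy using hp
    refine ⟨∑ p, (D'.incl p).app U (y p), ?_⟩
    rw [map_sum, ← D.sum_dualMap U φ]
    exact Finset.sum_congr rfl fun p _ ↦ by rw [h.toDual_incl, hy]
  · rintro _ ⟨y, rfl⟩
    refine LinearMap.mem_ker.2 (funext fun p ↦ (Submodule.Quotient.mk_eq_zero _).2 ?_)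
    exact ⟨_, (h.dualMap_toDual U p y).symm⟩

/-- The cokernel of an orthogonal sum of pairings is the sum of the cokernels. -/
def Pairing.IsOrthogonalSum.cokerIso {β : Pairing M M'} {γ : ∀ p, Pairing (N p) (N' p)}
    {D : Decomposition M N} {D' : Decomposition M' N'} (h : β.IsOrthogonalSum γ D D') :
    Iso (coker β.toDual) (directSum fun p ↦ coker (γ p).toDual) where
  app := fun U ↦ (Submodule.quotEquivOfEq _ _ (h.ker_toCoker U).symm).trans
    ((toCoker D γ U).quotKerEquivOfSurjective (toCoker_surjective D γ U))
  naturality := fun h x ↦ by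
    obtain ⟨φ, rfl⟩ := Submodule.Quotient.mk_surjective _ x
    rfl

variable {ι : Type} [Finite ι] {d : ι → ℕ} {V : ι → Type u} [∀ i, AddCommGroup (V i)]
  [∀ i, Module R (V i)]

/-- A sum of copies of `M i` indexed by a basis of `V i` is a sum of twists by `V i`. -/
def twistIso (e : ∀ i, Module.Basis (Fin (d i)) R (V i)) (M : ι → AffMod t) :
    Iso (directSum fun p : Σ i, Fin (d i) ↦ M p.1) (directSum fun i ↦ twist (V i) (M i)) where
  app := fun U ↦
    { toFun := fun x i ↦ (show (M i).obj U ⊗[R] Module.Dual R (V i) from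
        ∑ k, (show (M i).obj U from x ⟨i, k⟩) ⊗ₜ[R] (e i).dualBasis k)
      map_add' := fun x y ↦ funext fun i ↦ by
        refine Eq.trans ?_ Finset.sum_add_distrib
        exact Finset.sum_congr rfl fun k _ ↦ TensorProduct.add_tmul _ _ _
      map_smul' := fun c x ↦ funext fun i ↦ by
        change ∑ k, (c • show (M i).obj U from x ⟨i, k⟩) ⊗ₜ[R] (e i).dualBasis k =
          c • ∑ k, (show (M i).obj U from x ⟨i, k⟩) ⊗ₜ[R] (e i).dualBasis k
        rw [Finset.smul_sum]
        exact Finset.sum_congr rfl fun k _ ↦ (TensorProduct.smul_tmul' _ _ _).symm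
      invFun := fun z p ↦ coef (Sec t U) ((M p.1).obj U) ((e p.1).dualBasis.coord p.2) (z p.1)
      left_inv := fun x ↦ funext fun ⟨i, k⟩ ↦ by
        refine (map_sum (coef (Sec t U) ((M i).obj U) ((e i).dualBasis.coord k)) _ _).trans ?_
        rw [Finset.sum_eq_single k]
        · rw [coef_tmul, Module.Basis.coord_apply, Module.Basis.repr_self, Finsupp.single_eq_same,
            one_smul]
        · intro l _ hl
          rw [coef_tmul, Module.Basis.coord_apply, Module.Basis.repr_self,
            Finsupp.single_eq_of_ne hl.symm, zero_smul]
        · simp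
      right_inv := fun z ↦ funext fun i ↦
        sum_coef_tmul (B := Sec t U) (M := (M i).obj U) (e i).dualBasis (z i) }
  naturality := fun {U W} h x ↦ funext fun i ↦ by
    exact (map_sum (((M i).resBase h).rTensor (Module.Dual R (V i)))
      (fun k ↦ (show (M i).obj W from x ⟨i, k⟩) ⊗ₜ[R] (e i).dualBasis k) Finset.univ).symm

/-- The composite of two isomorphisms. -/
def Iso.trans {M N P : AffMod t} (e : Iso M N) (f : Iso N P) : Iso M P where
  app := fun U ↦ (e.app U).trans (f.app U)
  naturality := fun h x ↦ (congrArg _ (e.naturality h x)).trans (f.naturality h _)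

end AffMod

end DirectSumDecomposition

/-! ### The trace cokernel -/

/-- Rescaling of the inclusions and projections of a decomposition by units of `R`. -/
def AffMod.Decomposition.smul {R : Type u} [CommRing R] {T : Scheme.{u}}
    {t : T ⟶ Spec (CommRingCat.of R)} {κ : Type} [Fintype κ] {M : AffMod t} {N : κ → AffMod t}
    (u : κ → Rˣ) (D : Decomposition M N) : Decomposition M N where
  incl := fun p ↦
    { app := fun U ↦ (u p : R) • (D.incl p).app U
      naturality := fun h x ↦ (congrArg ((u p : R) • ·) ((D.incl p).naturality h x)).trans
        ((M.resBase h).map_smul _ _).symm }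
  proj := fun p ↦
    { app := fun U ↦ ((u p)⁻¹ : Rˣ).val • (D.proj p).app U
      naturality := fun h x ↦ (congrArg (((u p)⁻¹ : Rˣ).val • ·) ((D.proj p).naturality h x)).trans
        (((N p).resBase h).map_smul _ _).symm }
  sum_incl_proj := fun U x ↦ by
    refine Eq.trans (Finset.sum_congr rfl fun p _ ↦ ?_) (D.sum_incl_proj U x)
    rw [LinearMap.smul_apply, LinearMap.smul_apply, LinearMap.map_smul_of_tower, smul_smul, Units.mul_inv,
      one_smul]
  proj_incl_self := fun U p x ↦ by
    rw [LinearMap.smul_apply, LinearMap.smul_apply, LinearMap.map_smul_of_tower, smul_smul, Units.inv_mul,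
      one_smul, D.proj_incl_self]
  proj_incl_ne := fun U p q h x ↦ by
    rw [LinearMap.smul_apply, LinearMap.smul_apply, LinearMap.map_smul_of_tower, D.proj_incl_ne U h,
      smul_zero, smul_zero]

section TraceCoord

variable {R H : Type u} [CommRing R] [IsLocalRing R] [CommRing H] [HopfAlgebra R H]
  [Module.Finite R H] [Algebra.Etale R H]
  {ι : Type} [Fintype ι] [DecidableEq ι] (I : GoodLinearlyReductive R H ι)
variable {B A : Type u} [CommRing B] [Algebra R B] [CommRing A] [Algebra R A] [Algebra B A]
  [IsScalarTower R B A] [Module.Finite B A] [Module.Projective B A]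
  {α : A →ₐ[B] A ⊗[R] H} (hα : IsCoaction α.toLinearMap)

namespace GoodLinearlyReductive

/-- The unit `rk V / rk G` of `R`. -/
def ratio (i : ι) : Rˣ := (I.isUnit_finrank_carrier i).unit * I.isUnit_finrank.unit⁻¹

theorem ratio_mul (i : ι) :
    (I.ratio i : R) * (Module.finrank R H : R) = Module.finrank R (I.V i).carrier := by
  have h := (I.isUnit_finrank).val_inv_mul
  rw [ratio, Units.val_mul, mul_assoc, h, mul_one]
  rfl

variable {I}

/-- With the factor `rk V / rk G`, the trace of a product of coordinates of covariants is `δ k l`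
times the value `b` of the pairing `ω_V`, because `tr 1 = rk G`. -/
theorem algTrace_ratio (hα : IsCoaction α.toLinearMap)
    (hone : algTrace B A 1 = (Module.finrank R H : B)) {i : ι}
    (x : invTensor α.toLinearMap (I.V i).coact) (y : invTensor α.toLinearMap (dualCoact (I.V i)))
    {b : B} (hb : algebraMap B A b = mulEval B (I.V i).carrier x.1 y.1) (k l) :
    algTrace B A (omegaCoord (I.vecBasis i) α _ k x *
      ((I.ratio i : R) • omegaCoord (I.vecBasis i).dualBasis α _ l y)) = if k = l then b else 0 := by
  have h := finrank_mul_algTrace_omegaCoord hα x y k l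
  rw [← hb, algTrace_algebraMap, hone] at h
  have hn : IsUnit (Module.finrank R H : B) := by
    simpa using I.isUnit_finrank.map (algebraMap R B)
  have hr : algebraMap R B (I.ratio i) * (Module.finrank R H : B) =
      Module.finrank R (I.V i).carrier := by
    simpa using congrArg (algebraMap R B) (I.ratio_mul i)
  rw [mul_smul_comm, LinearMap.map_smul_of_tower, Algebra.smul_def]
  refine hn.mul_right_cancel ?_
  rw [mul_right_comm, hr, h]
  split_ifs
  · rfl
  · rw [zero_mul]

variable (I)

theorem algTrace_coordV_ne (hα : IsCoaction α.toLinearMap)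
    (hone : algTrace B A 1 = (Module.finrank R H : B)) {p q : I.Idx} (hpq : p ≠ q)
    (x : invTensor α.toLinearMap (I.V p.1).coact)
    (y : invTensor α.toLinearMap (dualCoact (I.V q.1)))
    (hinv : ∀ a ∈ invAlg α.toLinearMap, ∃ b, algebraMap B A b = a) :
    algTrace B A (I.coordV α p x *
      ((I.ratio q.1 : R) • omegaCoord (I.vecBasis q.1).dualBasis α _ q.2 y)) = 0 := by
  obtain ⟨i, k⟩ := p
  obtain ⟨j, l⟩ := q
  by_cases hij : i = j
  · subst hij
    obtain ⟨b, hb⟩ := hinv _ (mulEval_equivariant α (I.V i) x.2 y.2)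
    refine (algTrace_ratio hα hone x y hb k l).trans (if_neg ?_)
    rintro rfl
    exact hpq rfl
  · rw [mul_smul_comm, LinearMap.map_smul_of_tower]
    exact (congrArg _ (algTrace_omegaCoord_of_ne hα hij x y k l)).trans (smul_zero _)

theorem algTrace_coordV_self (hα : IsCoaction α.toLinearMap)
    (hone : algTrace B A 1 = (Module.finrank R H : B)) (p : I.Idx)
    (x : invTensor α.toLinearMap (I.V p.1).coact)
    (y : invTensor α.toLinearMap (dualCoact (I.V p.1)))
    {b : B} (hb : algebraMap B A b = mulEval B (I.V p.1).carrier x.1 y.1) :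
    algTrace B A (I.coordV α p x *
      ((I.ratio p.1 : R) • omegaCoord (I.vecBasis p.1).dualBasis α _ p.2 y)) = b :=
  (algTrace_ratio hα hone x y hb p.2 p.2).trans (if_pos rfl)

end GoodLinearlyReductive

end TraceCoord

section IsotypicDecomposition

variable {R H : Type u} [CommRing R] [IsLocalRing R] [CommRing H] [HopfAlgebra R H]
  [Module.Finite R H] [Algebra.Etale R H]
  {ι : Type} [Fintype ι] [DecidableEq ι] (I : GoodLinearlyReductive R H ι)
  {T : Scheme.{u}} {t : T ⟶ Spec (CommRingCat.of R)} (A : EquivAlg t H)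

namespace GoodLinearlyReductive

/-- The decomposition of `A` into copies of the sheaves `Ω_V`, one for each basis vector
of `V`. -/
def decomposition : AffMod.Decomposition A.toMod
    fun p : I.Idx ↦ A.Omega (I.V p.1).carrier (I.V p.1).coact where
  incl := fun p ↦
    { app := fun U ↦ I.coordV (A.coact U) p
      naturality := fun h x ↦ omegaCoord_res A (I.vecBasis p.1) _ h p.2 x }
  proj := fun p ↦
    { app := fun U ↦ I.projV (A.isCoaction U) p
      naturality := fun h x ↦ omegaProj_res A I.matrixBasis I.coact_vecBasis p h x }
  sum_incl_proj := fun U x ↦ I.sum_coordV_projV (A.isCoaction U) x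
  proj_incl_self := fun U p x ↦ I.projV_coordV_self (A.isCoaction U) p x
  proj_incl_ne := fun U _ _ h x ↦ I.projV_coordV_ne (A.isCoaction U) h x

/-- The decomposition of `A` into copies of the sheaves `Ω_{V^∨}`. The inclusions carry the factor
`rk V / rk G`, which makes it dual to `decomposition` for the trace pairing. -/
def dualDecomposition : AffMod.Decomposition A.toMod
    fun p : I.Idx ↦ A.Omega (Module.Dual R (I.V p.1).carrier) (dualCoact (I.V p.1)) :=
  AffMod.Decomposition.smul (fun p ↦ I.ratio p.1)
  { incl := fun p ↦
      { app := fun U ↦ omegaCoord (I.vecBasis p.1).dualBasis (A.coact U) (dualCoact (I.V p.1)) p.2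
        naturality := fun h x ↦ omegaCoord_res A (I.vecBasis p.1).dualBasis _ h p.2 x }
    proj := fun p ↦
      { app := fun U ↦
          omegaProj I.matrixBasis.dual I.dualCoact_vecBasis (A.coact U) (A.isCoaction U) p
        naturality := fun h x ↦
          omegaProj_res A I.matrixBasis.dual I.dualCoact_vecBasis p h x }
    sum_incl_proj := fun U x ↦
      sum_omegaCoord_omegaProj I.matrixBasis.dual I.dualCoact_vecBasis (A.isCoaction U) x
    proj_incl_self := fun U p x ↦
      omegaProj_omegaCoord_self I.matrixBasis.dual I.dualCoact_vecBasis (A.isCoaction U) p x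
    proj_incl_ne := fun U _ _ h x ↦
      omegaProj_omegaCoord_ne I.matrixBasis.dual I.dualCoact_vecBasis (A.isCoaction U) h x }

variable {A} in
/-- The trace pairing is the orthogonal sum of copies of the pairings `ω_V`. -/
theorem isOrthogonalSum (hA : A.InvEqBase) (hrk : A.HasRank (Module.finrank R H)) :
    A.tracePairing.IsOrthogonalSum (fun p : I.Idx ↦ EquivAlg.omega hA (I.V p.1))
      (I.decomposition A) (I.dualDecomposition A) where
  form_self := fun U p x y ↦
    I.algTrace_coordV_self (A.isCoaction U) (A.algTrace_one hrk U) p x y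
      (EquivAlg.algebraMap_omegaForm hA (I.V p.1) U x y)
  form_ne := fun U _ _ h x y ↦ I.algTrace_coordV_ne (A.isCoaction U)
    (A.algTrace_one hrk U) h x y fun a ha ↦ ((hA U).2 a).1 ha

variable {A} in
/-- The isomorphism `Q_A ≃ ⨁ V^∨ ⊗ Q_{A,V}`. -/
def cokerIso (hA : A.InvEqBase) (hrk : A.HasRank (Module.finrank R H)) :
    AffMod.Iso A.Q (AffMod.directSum fun i : ι ↦
      AffMod.twist (I.V i).carrier (EquivAlg.QV hA (I.V i))) :=
  (I.isOrthogonalSum hA hrk).cokerIso.trans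
    (AffMod.twistIso I.vecBasis fun i ↦ EquivAlg.QV hA (I.V i))

end GoodLinearlyReductive

end IsotypicDecomposition

/-! ### Projective modules of constant rank -/

section Frames

variable {B : Type u} [CommRing B]

/-- The module `L` behaves like an invertible module for the evaluation of linear forms:
`φ(x) y = φ(y) x`. -/
def EvalSymmetric (B L : Type u) [CommRing B] [AddCommGroup L] [Module B L] : Prop :=
  ∀ (φ : Module.Dual B L) (x y : L), φ x • y = φ y • x

theorem EvalSymmetric.tensor {L L' : Type u} [AddCommGroup L] [Module B L] [AddCommGroup L']
    [Module B L'] (h : EvalSymmetric B L) (h' : EvalSymmetric B L') :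
    EvalSymmetric B (L ⊗[B] L') := by
  intro φ x y
  induction x with
  | zero => simp
  | add x₁ x₂ h₁ h₂ => rw [map_add, add_smul, smul_add, h₁, h₂]
  | tmul a b =>
    induction y with
    | zero => simp
    | add y₁ y₂ h₁ h₂ => rw [map_add, add_smul, smul_add, h₁, h₂]
    | tmul a' b' =>
      have e₁ : φ (a ⊗ₜ b) • a' = φ (a' ⊗ₜ b) • a := h (φ ∘ₗ (TensorProduct.mk B L L').flip b) a a'
      have e₂ : φ (a' ⊗ₜ b) • b' = φ (a' ⊗ₜ b') • b := h' (φ ∘ₗ TensorProduct.mk B L L' a') b b'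
      rw [TensorProduct.smul_tmul', e₁, ← TensorProduct.smul_tmul', ← TensorProduct.tmul_smul, e₂,
        TensorProduct.tmul_smul]

variable {M : Type u} [AddCommGroup M] [Module B M]

/-- If `s M` lies in the span of `x₁, …, x_d`, then `s^d ⋀^d M` lies in the span
of `x₁ ∧ ⋯ ∧ x_d`. -/
theorem pow_smul_mem_span_ιMulti {d : ℕ} {x : Fin d → M} {s : B}
    (h : ∀ y : M, s • y ∈ Submodule.span B (Set.range x)) (z : ⋀[B]^d M) :
    ∃ c : B, s ^ d • z = c • exteriorPower.ιMulti B d x := by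
  have hz : z ∈ Submodule.span B (Set.range (exteriorPower.ιMulti B d (M := M))) := by
    rw [exteriorPower.ιMulti_span]; trivial
  induction hz using Submodule.span_induction with
  | zero => exact ⟨0, by simp⟩
  | add a b _ _ ha hb =>
    obtain ⟨c, hc⟩ := ha
    obtain ⟨c', hc'⟩ := hb
    exact ⟨c + c', by rw [smul_add, hc, hc', add_smul]⟩
  | smul r a _ ha =>
    obtain ⟨c, hc⟩ := ha
    exact ⟨r * c, by rw [smul_comm, hc, mul_smul]⟩
  | mem a ha =>
    obtain ⟨y, rfl⟩ := ha
    choose c hc using fun i ↦ Submodule.mem_span_range_iff_exists_fun B |>.1 (h (y i))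
    have h1 : s ^ d • exteriorPower.ιMulti B d y = exteriorPower.ιMulti B d fun i ↦ s • y i := by
      rw [AlternatingMap.map_smul_univ (exteriorPower.ιMulti B d) (fun _ ↦ s) y]
      simp
    have h2 : (fun i ↦ s • y i) = fun i ↦ ∑ j, c i j • x j := funext fun i ↦ (hc i).symm
    have h3 := MultilinearMap.map_sum (exteriorPower.ιMulti B d (M := M)).toMultilinearMap
      fun i j ↦ c i j • x j
    suffices hmem : s ^ d • exteriorPower.ιMulti B d y ∈
        Submodule.span B {exteriorPower.ιMulti B d x} by
      obtain ⟨c, hc⟩ := Submodule.mem_span_singleton.1 hmem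
      exact ⟨c, hc.symm⟩
    rw [h1, h2]
    refine (congrArg (· ∈ _) h3).mpr (Submodule.sum_mem _ fun r _ ↦ ?_)
    rw [MultilinearMap.map_smul_univ]
    refine Submodule.smul_mem _ _ ?_
    change exteriorPower.ιMulti B d (fun i ↦ x (r i)) ∈ _
    -- A tuple without repetitions is a permutation of `x`.
    by_cases hr : Function.Injective r
    · have := AlternatingMap.map_perm (exteriorPower.ιMulti B d) x
        (Equiv.ofBijective r (Finite.injective_iff_bijective.1 hr))
      refine (congrArg (· ∈ _) this).mpr ?_
      rw [Units.smul_def]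
      exact zsmul_mem (Submodule.mem_span_singleton_self _) _
    · obtain ⟨i, j, hij, hne⟩ : ∃ i j, r i = r j ∧ i ≠ j := by
        simpa [Function.Injective] using hr
      rw [AlternatingMap.map_eq_zero_of_eq _ (fun i ↦ x (r i)) (congrArg x hij) hne]
      exact zero_mem _

/-- A finitely generated projective module of rank `d` has, at each maximal ideal `m`, vectors
`x₁, …, x_d` spanning it up to an element outside `m`, and linear forms whose determinant on these
vectors lies outside `m`. -/
theorem exists_frame_at [Module.Finite B M] [Module.Projective B M] {d : ℕ}
    (hd : ∀ p : PrimeSpectrum B, Module.rankAtStalk M p = d) (m : Ideal B) [hm : m.IsMaximal] :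
    ∃ (x : Fin d → M) (g : Fin d → Module.Dual B M),
      Matrix.det (.of fun i j ↦ g i (x j)) ∉ m ∧
        ∃ s ∉ m, ∀ y : M, s • y ∈ Submodule.span B (Set.range x) := by
  let _ : Field (B ⧸ m) := Ideal.Quotient.field m
  have hr : Module.finrank (B ⧸ m) ((B ⧸ m) ⊗[B] M) = d := by
    have h1 := Module.rankAtStalk_baseChange (R := B) (M := M) (S := B ⧸ m) ⊥
    rw [hd, Module.rankAtStalk_eq_finrank_of_free] at h1
    simpa using h1
  let b : Module.Basis (Fin d) (B ⧸ m) ((B ⧸ m) ⊗[B] M) := Module.finBasisOfFinrankEq _ _ hr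
  have hs : Function.Surjective (algebraMap B (B ⧸ m)) := Ideal.Quotient.mk_surjective
  choose x hx using fun i ↦ TensorProduct.mk_surjective B M (B ⧸ m) hs (b i)
  have hg : ∀ i, ∃ g : Module.Dual B M, Algebra.linearMap B (B ⧸ m) ∘ₗ g =
      (b.coord i).restrictScalars B ∘ₗ TensorProduct.mk B (B ⧸ m) M 1 := fun i ↦
    Module.projective_lifting_property (Algebra.linearMap B (B ⧸ m)) _ hs
  choose g hg using hg
  have hgx : ∀ i j, algebraMap B (B ⧸ m) (g i (x j)) = if i = j then 1 else 0 := fun i j ↦ by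
    refine (LinearMap.congr_fun (hg i) (x j)).trans ?_
    rw [LinearMap.comp_apply, hx]
    simp [Finsupp.single_apply, eq_comm]
  refine ⟨x, g, fun hdet ↦ ?_, ?_⟩
  · have h1 : algebraMap B (B ⧸ m) (Matrix.det (.of fun i j ↦ g i (x j))) = 0 :=
      Ideal.Quotient.eq_zero_iff_mem.2 hdet
    rw [RingHom.map_det] at h1
    have h2 : (algebraMap B (B ⧸ m)).mapMatrix (.of fun i j ↦ g i (x j)) =
        (1 : Matrix (Fin d) (Fin d) (B ⧸ m)) := by
      ext i j
      simp only [RingHom.mapMatrix_apply, Matrix.map_apply, Matrix.of_apply, hgx, Matrix.one_apply]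
    rw [h2, Matrix.det_one] at h1
    exact one_ne_zero h1
  -- Nakayama's lemma, applied to the lifts of a basis of `M / m M`.
  · have hle : (⊤ : Submodule B M) ≤ Submodule.span B (Set.range x) ⊔ m • ⊤ := by
      intro y _
      have h1 : TensorProduct.mk B (B ⧸ m) M 1 y ∈ Submodule.span B
          (Set.range fun i ↦ TensorProduct.mk B (B ⧸ m) M 1 (x i)) := by
        choose c hc using fun i ↦ hs (b.repr (TensorProduct.mk B (B ⧸ m) M 1 y) i)
        rw [← b.sum_repr (TensorProduct.mk B (B ⧸ m) M 1 y)]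
        refine Submodule.sum_mem _ fun i _ ↦ ?_
        rw [← hc, algebraMap_smul, ← hx]
        exact Submodule.smul_mem _ _ (Submodule.subset_span ⟨i, rfl⟩)
      rw [Set.range_comp' (TensorProduct.mk B (B ⧸ m) M 1) x, ← Submodule.map_span] at h1
      obtain ⟨z, hz, hzy⟩ := h1
      rw [← LinearMap.ker_tensorProductMk M]
      refine Submodule.mem_sup.2 ⟨z, hz, y - z, ?_, by abel⟩
      rw [LinearMap.mem_ker, map_sub, hzy, sub_self]
    obtain ⟨r, hr1, hr2⟩ := Submodule.exists_sub_one_mem_and_smul_le_of_fg_of_le_sup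
      Module.Finite.fg_top le_rfl hle
    refine ⟨r, fun hrm ↦ ?_, fun y ↦ ?_⟩
    · exact hm.ne_top ((Ideal.eq_top_iff_one _).2 (by simpa using m.sub_mem hrm hr1))
    · exact hr2 (Submodule.smul_mem_pointwise_smul _ _ _ trivial)

/-- The top exterior power of a projective module of constant rank. At each maximal ideal it is
spanned by a single element up to an element outside this ideal, and for multiples of one element the
identity is clear. -/
theorem evalSymmetric_exteriorPower [Module.Finite B M] [Module.Projective B M] {d : ℕ}
    (hd : ∀ p : PrimeSpectrum B, Module.rankAtStalk M p = d) : EvalSymmetric B (⋀[B]^d M) := by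
  intro φ z w
  rw [← sub_eq_zero]
  set v := φ z • w - φ w • z
  by_contra hne
  -- Otherwise the annihilator of `v` lies in a maximal ideal `m`.
  have hann : Ideal.span {v' : B | v' • v = 0} ≠ ⊤ := by
    have : Ideal.span {v' : B | v' • v = 0} ≤ LinearMap.ker (LinearMap.toSpanSingleton B _ v) :=
      Ideal.span_le.2 fun a ha ↦ ha
    intro h
    rw [h] at this
    have h1 : (1 : B) • v = 0 := this (x := 1) trivial
    exact hne (by rwa [one_smul] at h1)
  obtain ⟨m, hm, hle⟩ := Ideal.exists_le_maximal _ hann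
  obtain ⟨x, _, _, s, hs, hspan⟩ := exists_frame_at hd m
  obtain ⟨c, hc⟩ := pow_smul_mem_span_ιMulti hspan z
  obtain ⟨c', hc'⟩ := pow_smul_mem_span_ιMulti hspan w
  have hmem : s ^ d * s ^ d ∈ m := by
    refine hle (Ideal.subset_span ?_)
    change (s ^ d * s ^ d) • (φ z • w - φ w • z) = 0
    have e : (s ^ d * s ^ d) • (φ z • w - φ w • z) =
        φ (s ^ d • z) • (s ^ d • w) - φ (s ^ d • w) • (s ^ d • z) := by
      simp only [map_smul, smul_eq_mul]
      module
    rw [e, hc, hc']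
    simp only [map_smul, smul_eq_mul]
    module
  have := hm.isPrime
  rcases this.mem_or_mem hmem with h | h <;> exact hs (this.mem_of_pow_mem _ h)

/-- For modules of rank `d`, products of determinants of linear forms generate the unit ideal. -/
theorem exists_sum_det_mul_det_eq_one [Module.Finite B M] [Module.Projective B M]
    {N : Type u} [AddCommGroup N] [Module B N] [Module.Finite B N] [Module.Projective B N] {d : ℕ}
    (hM : ∀ p : PrimeSpectrum B, Module.rankAtStalk M p = d)
    (hN : ∀ p : PrimeSpectrum B, Module.rankAtStalk N p = d) :
    ∃ (K : Type u) (_ : Fintype K) (r : K → B) (x : K → Fin d → M) (y : K → Fin d → N)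
      (g : K → Fin d → Module.Dual B M) (h : K → Fin d → Module.Dual B N),
      ∑ k, r k * (Matrix.det (.of fun i j ↦ g k i (x k j)) *
        Matrix.det (.of fun i j ↦ h k i (y k j))) = 1 := by
  let Q := ((Fin d → M) × (Fin d → N)) × ((Fin d → Module.Dual B M) × (Fin d → Module.Dual B N))
  let f : Q → B := fun q ↦ Matrix.det (.of fun i j ↦ q.2.1 i (q.1.1 j)) *
    Matrix.det (.of fun i j ↦ q.2.2 i (q.1.2 j))
  have htop : Ideal.span (Set.range f) = ⊤ := by
    by_contra hne
    obtain ⟨m, hm, hle⟩ := Ideal.exists_le_maximal _ hne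
    obtain ⟨x, g, hxg, _⟩ := exists_frame_at hM m
    obtain ⟨y, h, hyh, _⟩ := exists_frame_at hN m
    rcases hm.isPrime.mem_or_mem (hle (Ideal.subset_span ⟨((x, y), (g, h)), rfl⟩)) with h' | h'
    · exact hxg h'
    · exact hyh h'
  obtain ⟨c, hc⟩ := Finsupp.mem_span_range_iff_exists_finsupp.1
    ((Ideal.eq_top_iff_one _).1 htop)
  refine ⟨c.support, inferInstance, fun q ↦ c q.1, fun q ↦ q.1.1.1, fun q ↦ q.1.1.2,
    fun q ↦ q.1.2.1, fun q ↦ q.1.2.2, ?_⟩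
  rw [← hc, Finsupp.sum]
  exact Finset.sum_coe_sort c.support fun q ↦ c q * f q

end Frames

/-! ### Tensor products of invertible sheaves -/

section ProductLine

variable {R : Type u} [CommRing R] {T : Scheme.{u}} {t : T ⟶ Spec (CommRingCat.of R)}

namespace AffMod

/-- Evaluation of sections of the dual sheaf at a section. -/
def DualSec.eval {M : AffMod t} {U : T.affineOpens} (x : M.obj U) :
    DualSec M U →ₗ[Sec t U] Sec t U where
  toFun := fun φ ↦ φ.form U le_rfl x
  map_add' := fun _ _ ↦ rfl
  map_smul' := fun c φ ↦ by
    rw [smul_form, resSec_refl]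
    rfl

/-- Restriction of sections of the dual sheaf. -/
def DualSec.res {M : AffMod t} {U V : T.affineOpens} (h : U ≤ V) :
    DualSec M V →ₛₗ[resSec t h] DualSec M U :=
  (dual M).res h

theorem DualSec.form_res {M : AffMod t} {U W : T.affineOpens} (hW : W ≤ U) (φ : DualSec M U)
    (x : M.obj U) : φ.form W hW (M.res hW x) = resSec t hW (φ.form U le_rfl x) :=
  φ.compat hW le_rfl x

theorem DualSec.sum_form {M : AffMod t} {U W : T.affineOpens} (hW : W ≤ U) {K : Type*}
    [Fintype K] (φ : K → DualSec M U) (x : M.obj W) :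
    (∑ k, φ k).form W hW x = ∑ k, (φ k).form W hW x :=
  map_sum ({ toFun := fun φ ↦ φ.form W hW x, map_zero' := rfl, map_add' := fun _ _ ↦ rfl } :
    DualSec M U →+ Sec t W) _ _

/-- Expansion of a section of the dual of an invertible sheaf along a partition of unity
`∑ ψ k (b k) = 1`. -/
theorem DualSec.eq_sum_smul {M : AffMod t} (hM : ∀ W, EvalSymmetric (Sec t W) (M.obj W))
    {U : T.affineOpens} {K : Type*} [Fintype K] {ψ : K → DualSec M U} {b : K → M.obj U}
    (hψ : ∑ k, (ψ k).form U le_rfl (b k) = 1) (φ : DualSec M U) :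
    ∑ k, φ.form U le_rfl (b k) • ψ k = φ := by
  refine ext' fun W hW ↦ LinearMap.ext fun z ↦ ?_
  rw [sum_form]
  have h1 : ∑ k, (ψ k).form W hW (M.res hW (b k)) = 1 := by
    rw [← map_one (resSec t hW), ← hψ, map_sum]
    exact Finset.sum_congr rfl fun k _ ↦ form_res hW _ _
  calc ∑ k, (φ.form U le_rfl (b k) • ψ k).form W hW z
      = ∑ k, φ.form W hW ((ψ k).form W hW z • M.res hW (b k)) := by
        refine Finset.sum_congr rfl fun k _ ↦ ?_
        rw [smul_form, LinearMap.smul_apply, map_smul, form_res, smul_eq_mul, smul_eq_mul,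
          mul_comm]
    _ = ∑ k, φ.form W hW ((ψ k).form W hW (M.res hW (b k)) • z) :=
        Finset.sum_congr rfl fun k _ ↦ by rw [hM W ((ψ k).form W hW) z (M.res hW (b k))]
    _ = φ.form W hW z := by
        rw [← map_sum, ← Finset.sum_smul, h1, one_smul]

/-- Data presenting the invertible sheaf `L` as the tensor product of the invertible sheaves `P p`.
Over each affine open `W` there is a set `X W` whose elements `x` give a section `comp x p` of each
`P p` and their product `prod x`, a section of `L`. Only some tuples of sections need a product; it is
required that over each affine open there are partitions of unity `∑ k, ψ p k (b p k) = 1` for the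
`P p` such that the tuples of the `b p k` have products, and such that the products of the forms
`ψ p k` are defined on `L`. -/
structure ProductLine {κ : Type} [Fintype κ] (L : AffMod t) (P : κ → AffMod t) where
  X : T.affineOpens → Type u
  comp : ∀ {W}, X W → ∀ p, (P p).obj W
  prod : ∀ {W}, X W → L.obj W
  evalSymmetric : ∀ W, EvalSymmetric (Sec t W) (L.obj W)
  evalSymmetric_comp : ∀ p W, EvalSymmetric (Sec t W) ((P p).obj W)
  exists_frame : ∀ U, ∃ (K : κ → Type u) (_ : ∀ p, Fintype (K p))
    (ψ : ∀ p, K p → DualSec (P p) U) (b : ∀ p, K p → (P p).obj U)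
    (a : (∀ p, K p) → X U) (Ψ : (∀ p, K p) → DualSec L U),
    (∀ p, ∑ k, (ψ p k).form U le_rfl (b p k) = 1) ∧ (∀ J p, comp (a J) p = b p (J p)) ∧
      ∀ J W hW (x : X W), (Ψ J).form W hW (prod x) = ∏ p, (ψ p (J p)).form W hW (comp x p)

namespace ProductLine

variable {κ : Type} [Fintype κ] [DecidableEq κ] {L : AffMod t} {P : κ → AffMod t}
  (S : ProductLine L P)

/-- The products of the elements of partitions of unity form a partition of unity for `L`. -/
theorem sum_frame {U : T.affineOpens} {K : κ → Type u} [∀ p, Fintype (K p)]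
    {ψ : ∀ p, K p → DualSec (P p) U} {b : ∀ p, K p → (P p).obj U}
    {a : (∀ p, K p) → S.X U} {Ψ : (∀ p, K p) → DualSec L U}
    (hψ : ∀ p, ∑ k, (ψ p k).form U le_rfl (b p k) = 1)
    (ha : ∀ J p, S.comp (a J) p = b p (J p))
    (hΨ : ∀ J W hW (x : S.X W),
      (Ψ J).form W hW (S.prod x) = ∏ p, (ψ p (J p)).form W hW (S.comp x p)) :
    ∑ J, (Ψ J).form U le_rfl (S.prod (a J)) = 1 := by
  calc ∑ J, (Ψ J).form U le_rfl (S.prod (a J))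
      = ∑ J : ∀ p, K p, ∏ p, (ψ p (J p)).form U le_rfl (b p (J p)) := by
        refine Finset.sum_congr rfl fun J _ ↦ ?_
        rw [hΨ]
        exact Finset.prod_congr rfl fun p _ ↦ by rw [ha]
    _ = ∏ p, ∑ k, (ψ p k).form U le_rfl (b p k) :=
        (Fintype.prod_sum fun p k ↦ (ψ p k).form U le_rfl (b p k)).symm
    _ = 1 := Finset.prod_eq_one fun p _ ↦ hψ p

/-- A section of `L^∨` is determined by its values on products. -/
theorem dual_ext {U : T.affineOpens} {φ φ' : DualSec L U}
    (h : ∀ x : S.X U, φ.form U le_rfl (S.prod x) = φ'.form U le_rfl (S.prod x)) : φ = φ' := by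
  obtain ⟨K, _, ψ, b, a, Ψ, hψ, ha, hΨ⟩ := S.exists_frame U
  have h1 := S.sum_frame hψ ha hΨ
  rw [← DualSec.eq_sum_smul S.evalSymmetric h1 φ, ← DualSec.eq_sum_smul S.evalSymmetric h1 φ']
  exact Finset.sum_congr rfl fun J _ ↦ by rw [h]

/-- Over an affine open, `L^∨` is the tensor product of the `(P p)^∨`. The product of forms is
expanded along the partitions of unity, and on products of sections it is the product of values. -/
theorem exists_equiv (U : T.affineOpens) :
    ∃ e : DualSec L U ≃ₗ[Sec t U] PiTensorProduct (Sec t U) fun p ↦ DualSec (P p) U,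
      ∀ (φ : ∀ p, DualSec (P p) U) (W : T.affineOpens) (hW : W ≤ U) (x : S.X W),
        (e.symm (PiTensorProduct.tprod _ φ)).form W hW (S.prod x) =
          ∏ p, (φ p).form W hW (S.comp x p) := by
  obtain ⟨K, _, ψ, b, a, Ψ, hψ, ha, hΨ⟩ := S.exists_frame U
  have h1 := S.sum_frame hψ ha hΨ
  let f : DualSec L U →ₗ[Sec t U] PiTensorProduct (Sec t U) fun p ↦ DualSec (P p) U :=
    ∑ J, (DualSec.eval (S.prod (a J))).smulRight
      (PiTensorProduct.tprod (Sec t U) fun p ↦ ψ p (J p))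
  let g' : MultilinearMap (Sec t U) (fun p ↦ DualSec (P p) U) (DualSec L U) :=
    ∑ J : ∀ p, K p, ((MultilinearMap.mkPiAlgebra (Sec t U) κ (Sec t U)).compLinearMap
      fun p ↦ DualSec.eval (b p (J p))).smulRight (Ψ J)
  let g := PiTensorProduct.lift g'
  have hf : ∀ φ, f φ = ∑ J, φ.form U le_rfl (S.prod (a J)) •
      PiTensorProduct.tprod (Sec t U) fun p ↦ ψ p (J p) := fun φ ↦ by
    rw [LinearMap.sum_apply]
    rfl
  have hg : ∀ φ, g (PiTensorProduct.tprod (Sec t U) φ) =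
      ∑ J, (∏ p, (φ p).form U le_rfl (b p (J p))) • Ψ J := fun φ ↦ by
    rw [PiTensorProduct.lift.tprod, sum_apply]
    rfl
  have hgW : ∀ (φ : ∀ p, DualSec (P p) U) (W : T.affineOpens) (hW : W ≤ U) (x : S.X W),
      (g (PiTensorProduct.tprod _ φ)).form W hW (S.prod x) =
        ∏ p, (φ p).form W hW (S.comp x p) := by
    intro φ W hW x
    rw [hg, DualSec.sum_form]
    calc ∑ J, ((∏ p, (φ p).form U le_rfl (b p (J p))) • Ψ J).form W hW (S.prod x)
        = ∑ J : ∀ p, K p, ∏ p, ((φ p).form U le_rfl (b p (J p)) • ψ p (J p)).form W hW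
            (S.comp x p) := by
          refine Finset.sum_congr rfl fun J _ ↦ ?_
          simp only [DualSec.smul_form, LinearMap.smul_apply, smul_eq_mul, hΨ,
            Finset.prod_mul_distrib, map_prod]
      _ = ∏ p, ∑ k, ((φ p).form U le_rfl (b p k) • ψ p k).form W hW (S.comp x p) :=
          (Fintype.prod_sum fun p k ↦
            ((φ p).form U le_rfl (b p k) • ψ p k).form W hW (S.comp x p)).symm
      _ = ∏ p, (φ p).form W hW (S.comp x p) := by
          refine Finset.prod_congr rfl fun p _ ↦ ?_
          rw [← DualSec.sum_form, DualSec.eq_sum_smul (S.evalSymmetric_comp p) (hψ p)]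
  refine ⟨LinearEquiv.ofLinearMap f g ?_ ?_, hgW⟩
  · refine PiTensorProduct.ext (MultilinearMap.ext fun φ ↦ ?_)
    change f (g (PiTensorProduct.tprod _ φ)) = PiTensorProduct.tprod _ φ
    rw [hf]
    simp only [hgW, ha]
    have h2 : φ = fun p ↦ ∑ k, (φ p).form U le_rfl (b p k) • ψ p k := funext fun p ↦
      (DualSec.eq_sum_smul (S.evalSymmetric_comp p) (hψ p) (φ p)).symm
    conv_rhs => rw [h2]
    rw [MultilinearMap.map_sum]
    refine Finset.sum_congr rfl fun J _ ↦ ?_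
    rw [MultilinearMap.map_smul_univ]
  · refine LinearMap.ext fun φ ↦ ?_
    change g (f φ) = φ
    rw [hf, map_sum]
    conv_rhs => rw [← DualSec.eq_sum_smul S.evalSymmetric h1 φ]
    refine Finset.sum_congr rfl fun J _ ↦ ?_
    rw [map_smul]
    congr 1
    refine S.dual_ext fun x ↦ ?_
    rw [hgW, hΨ]

/-- The isomorphism `L^∨ ≃ ⨂ (P p)^∨`, characterized by its values on products of sections; this
characterization makes it independent of the partitions of unity, hence compatible with
restriction. -/
theorem exists_iso : ∃ Φ : Iso (dual L) (bigTensor fun p ↦ dual (P p)),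
    ∀ (U : T.affineOpens) (s : DualSec L U) (σ : ∀ p, DualSec (P p) U),
      (∀ x : S.X U, s.form U le_rfl (S.prod x) = ∏ p, (σ p).form U le_rfl (S.comp x p)) →
      Φ.app U s = PiTensorProduct.tprod (Sec t U) σ := by
  choose e he using S.exists_equiv
  have key : ∀ {U V : T.affineOpens} (h : U ≤ V)
      (z : PiTensorProduct (Sec t V) fun p ↦ DualSec (P p) V),
      (e U).symm (piTensorMap (fun p ↦ DualSec.res (M := P p) h) z) =
        DualSec.res h ((e V).symm z) := by
    intro U V h z
    induction z using PiTensorProduct.induction_on with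
    | smul_tprod c φ =>
      rw [map_smulₛₗ, map_smul, map_smul, map_smulₛₗ]
      congr 1
      rw [piTensorMap_tprod]
      refine S.dual_ext fun x ↦ ?_
      rw [he]
      exact (he V φ U h x).symm
    | add x y hx hy => simp only [map_add, hx, hy]
  have key' : ∀ {U V : T.affineOpens} (h : U ≤ V) (φ : DualSec L V),
      e U (DualSec.res h φ) = piTensorMap (fun p ↦ DualSec.res (M := P p) h) (e V φ) := by
    intro U V h φ
    rw [← LinearEquiv.eq_symm_apply, key, LinearEquiv.symm_apply_apply]
  refine ⟨⟨e, fun h φ ↦ key' h φ⟩, fun U s σ hs ↦ ?_⟩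
  refine (LinearEquiv.eq_symm_apply (e U)).1 (S.dual_ext fun x ↦ ?_)
  rw [hs, he]

end ProductLine

end AffMod

end ProductLine

/-! ### Determinants of orthogonal sums -/

section DeterminantLine

/-- The determinant of a block diagonal matrix with square blocks of various sizes. -/
theorem det_sigma_of_offDiag_eq_zero {B : Type*} [CommRing B] {κ : Type*} [Fintype κ]
    [DecidableEq κ] {d : κ → ℕ} (N : Matrix (Σ p, Fin (d p)) (Σ p, Fin (d p)) B)
    (h : ∀ i j, i.1 ≠ j.1 → N i j = 0) :
    N.det = ∏ p, Matrix.det (.of fun i j : Fin (d p) ↦ N ⟨p, i⟩ ⟨p, j⟩) := by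
  let _ : LinearOrder κ := LinearOrder.lift' (Fintype.equivFin κ) (Fintype.equivFin κ).injective
  have ht : N.BlockTriangular Sigma.fst := fun i j hij ↦ h i j (ne_of_gt hij)
  rw [ht.det_fintype]
  refine Finset.prod_congr rfl fun p _ ↦ ?_
  rw [← Matrix.det_submatrix_equiv_self (Equiv.sigmaSubtype p).symm]
  rfl

variable {R : Type u} [CommRing R] {T : Scheme.{u}} {t : T ⟶ Spec (CommRingCat.of R)}

namespace AffMod

/-- The sheaf `M` is locally free of rank `d`. Instead of quasi-coherence only its consequence for
linear forms is recorded: a form on the sections over `U` extends to the smaller affine opens. -/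
structure IsVectorBundle (M : AffMod t) (d : ℕ) : Prop where
  finite : ∀ U, Module.Finite (Sec t U) (M.obj U)
  projective : ∀ U, Module.Projective (Sec t U) (M.obj U)
  rank : ∀ U (p : PrimeSpectrum (Sec t U)), Module.rankAtStalk (M.obj U) p = d
  exists_dualSec : ∀ U (g : Module.Dual (Sec t U) (M.obj U)),
    ∃ φ : DualSec M U, φ.form U le_rfl = g

/-- The sheaf `det M ⊗ det N`, for `M` and `N` of rank `d`. -/
abbrev detLine (d : ℕ) (M N : AffMod t) : AffMod t := (ext d M).tensor (ext d N)

/-- The section `(x₁ ∧ ⋯ ∧ x_d) ⊗ (y₁ ∧ ⋯ ∧ y_d)`. -/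
def wedge {d : ℕ} {M N : AffMod t} {U : T.affineOpens} (x : Fin d → M.obj U)
    (y : Fin d → N.obj U) : (detLine d M N).obj U :=
  show ⋀[Sec t U]^d (M.obj U) ⊗[Sec t U] ⋀[Sec t U]^d (N.obj U) from
    exteriorPower.ιMulti (Sec t U) d x ⊗ₜ exteriorPower.ιMulti (Sec t U) d y

theorem evalSymmetric_detLine {d : ℕ} {M N : AffMod t} (hM : M.IsVectorBundle d)
    (hN : N.IsVectorBundle d) (U : T.affineOpens) :
    EvalSymmetric (Sec t U) ((detLine d M N).obj U) := by
  have := hM.finite U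
  have := hM.projective U
  have := hN.finite U
  have := hN.projective U
  exact (evalSymmetric_exteriorPower (hM.rank U)).tensor (evalSymmetric_exteriorPower (hN.rank U))

/-- A bilinear pairing `M × N → O_T` over the affine open `U`. -/
structure LocalPairing (M N : AffMod t) (U : T.affineOpens) where
  form : ∀ W, W ≤ U → (M.obj W →ₗ[Sec t W] N.obj W →ₗ[Sec t W] Sec t W)
  compat : ∀ {W W' : T.affineOpens} (h : W' ≤ W) (hW : W ≤ U) (x : M.obj W) (y : N.obj W),
    form W' (h.trans hW) (M.res h x) (N.res h y) = resSec t h (form W hW x y)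

namespace LocalPairing

variable {M N : AffMod t} {U : T.affineOpens}

/-- The determinant of a pairing, a section of `(det M ⊗ det N)^∨`. -/
def det (β : LocalPairing M N U) (d : ℕ) : DualSec (detLine d M N) U :=
  ⟨fun W hW ↦ detForm d (β.form W hW), fun h hW z ↦
    detForm_map d _ _ (M.res h) (N.res h) (fun x y ↦ β.compat h hW x y) z⟩

theorem det_wedge (β : LocalPairing M N U) {d : ℕ} {W : T.affineOpens} (hW : W ≤ U)
    (x : Fin d → M.obj W) (y : Fin d → N.obj W) :
    (β.det d).form W hW (wedge x y) = Matrix.det (.of fun i j ↦ β.form W hW (x i) (y j)) :=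
  detForm_ιMulti d (β.form W hW) x y

/-- The pairing `∑ g i ⊗ h i` given by two families of linear forms. -/
def ofForms {d : ℕ} (g : Fin d → DualSec M U) (h : Fin d → DualSec N U) :
    LocalPairing M N U where
  form := fun W hW ↦ ∑ i, ((g i).form W hW).smulRight ((h i).form W hW)
  compat := fun h' hW x y ↦ by
    simp only [LinearMap.sum_apply, LinearMap.smulRight_apply, LinearMap.smul_apply, smul_eq_mul,
      map_sum, map_mul]
    exact Finset.sum_congr rfl fun i _ ↦
      congrArg₂ (· * ·) ((g i).compat h' hW x) ((h i).compat h' hW y)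

theorem ofForms_form {d : ℕ} (g : Fin d → DualSec M U) (h : Fin d → DualSec N U)
    {W : T.affineOpens} (hW : W ≤ U) (x : M.obj W) (y : N.obj W) :
    (ofForms g h).form W hW x y = ∑ i, (g i).form W hW x * (h i).form W hW y := by
  simp only [ofForms, LinearMap.sum_apply, LinearMap.smulRight_apply, LinearMap.smul_apply,
    smul_eq_mul]

variable {κ : Type} [Fintype κ] {N₁ N₂ : κ → AffMod t}

/-- The orthogonal sum of a family of pairings. -/
def orthogonalSum (D : Decomposition M N₁) (D' : Decomposition N N₂)
    (β : ∀ p, LocalPairing (N₁ p) (N₂ p) U) : LocalPairing M N U where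
  form := fun W hW ↦ ∑ p, ((β p).form W hW).compl₁₂ ((D.proj p).app W) ((D'.proj p).app W)
  compat := fun h hW x y ↦ by
    simp only [LinearMap.sum_apply, LinearMap.compl₁₂_apply, map_sum, Hom.naturality]
    exact Finset.sum_congr rfl fun p _ ↦ (β p).compat h hW _ _

theorem orthogonalSum_incl_self [DecidableEq κ] (D : Decomposition M N₁)
    (D' : Decomposition N N₂) (β : ∀ p, LocalPairing (N₁ p) (N₂ p) U) {W : T.affineOpens}
    (hW : W ≤ U) (p : κ) (x : (N₁ p).obj W) (y : (N₂ p).obj W) :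
    (orthogonalSum D D' β).form W hW ((D.incl p).app W x) ((D'.incl p).app W y) =
      (β p).form W hW x y := by
  simp only [orthogonalSum, LinearMap.sum_apply, LinearMap.compl₁₂_apply]
  rw [Finset.sum_eq_single p, D.proj_incl_self, D'.proj_incl_self]
  · intro q _ hq
    rw [D.proj_incl_ne W hq, map_zero, LinearMap.zero_apply]
  · simp

theorem orthogonalSum_incl_ne (D : Decomposition M N₁)
    (D' : Decomposition N N₂) (β : ∀ p, LocalPairing (N₁ p) (N₂ p) U) {W : T.affineOpens}
    (hW : W ≤ U) {p q : κ} (hpq : p ≠ q) (x : (N₁ p).obj W) (y : (N₂ q).obj W) :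
    (orthogonalSum D D' β).form W hW ((D.incl p).app W x) ((D'.incl q).app W y) = 0 := by
  simp only [orthogonalSum, LinearMap.sum_apply, LinearMap.compl₁₂_apply]
  refine Finset.sum_eq_zero fun r _ ↦ ?_
  by_cases hr : r = p
  · rw [D'.proj_incl_ne W (hr.trans_ne hpq), map_zero]
  · rw [D.proj_incl_ne W hr, map_zero, LinearMap.zero_apply]

end LocalPairing

/-- There is a partition of unity for `det M ⊗ det N` over `U` consisting of multiples of determinants
of pairings. -/
theorem IsVectorBundle.exists_frame {d : ℕ} {M N : AffMod t} (hM : M.IsVectorBundle d)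
    (hN : N.IsVectorBundle d) (U : T.affineOpens) :
    ∃ (K : Type u) (_ : Fintype K) (r : K → Sec t U) (β : K → LocalPairing M N U)
      (x : K → Fin d → M.obj U) (y : K → Fin d → N.obj U),
      ∑ k, (r k • (β k).det d).form U le_rfl (wedge (x k) (y k)) = 1 := by
  have := hM.finite U
  have := hM.projective U
  have := hN.finite U
  have := hN.projective U
  obtain ⟨K, _, r, x, y, g, h, e⟩ := exists_sum_det_mul_det_eq_one (hM.rank U) (hN.rank U)
  choose g' hg' using fun k i ↦ hM.exists_dualSec U (g k i)
  choose h' hh' using fun k i ↦ hN.exists_dualSec U (h k i)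
  refine ⟨K, inferInstance, r, fun k ↦ LocalPairing.ofForms (g' k) (h' k), x, y, ?_⟩
  rw [← e]
  refine Finset.sum_congr rfl fun k _ ↦ ?_
  -- The matrix of the pairing `∑ g i ⊗ h i` is the product of the matrices of the two families.
  rw [DualSec.smul_form, LinearMap.smul_apply, LocalPairing.det_wedge, smul_eq_mul, resSec_refl,
    ← Matrix.det_transpose (.of fun i j ↦ g k i (x k j)), ← Matrix.det_mul]
  congr 2
  ext i j
  simp only [Matrix.of_apply, LocalPairing.ofForms_form, hg', hh', Matrix.mul_apply,
    Matrix.transpose_apply]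

section BlockWedge

variable {κ : Type} [Fintype κ] [DecidableEq κ] {M M' : AffMod t} {N N' : κ → AffMod t}
  {d : κ → ℕ} {n : ℕ} (σ : Fin n ≃ Σ p, Fin (d p))

/-- The product in `det M ⊗ det M'` of the sections `wedge (x p) (y p)`
of `det (N p) ⊗ det (N' p)`, for `M = ⨁ N p` and `M' = ⨁ N' p`. -/
def blockWedge (D : Decomposition M N) (D' : Decomposition M' N') {U : T.affineOpens}
    (x : ∀ p, Fin (d p) → (N p).obj U) (y : ∀ p, Fin (d p) → (N' p).obj U) :
    (detLine n M M').obj U :=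
  wedge (fun i ↦ (D.incl (σ i).1).app U (x (σ i).1 (σ i).2))
    (fun i ↦ (D'.incl (σ i).1).app U (y (σ i).1 (σ i).2))

/-- The determinant of an orthogonal sum is the product of the determinants. -/
theorem detForm_blockWedge (D : Decomposition M N) (D' : Decomposition M' N') {U : T.affineOpens}
    (β : M.obj U →ₗ[Sec t U] M'.obj U →ₗ[Sec t U] Sec t U)
    (γ : ∀ p, (N p).obj U →ₗ[Sec t U] (N' p).obj U →ₗ[Sec t U] Sec t U)
    (hself : ∀ p x y, β ((D.incl p).app U x) ((D'.incl p).app U y) = γ p x y)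
    (hne : ∀ p q, p ≠ q → ∀ x y, β ((D.incl p).app U x) ((D'.incl q).app U y) = 0)
    (x : ∀ p, Fin (d p) → (N p).obj U) (y : ∀ p, Fin (d p) → (N' p).obj U) :
    detForm n β (blockWedge σ D D' x y) =
      ∏ p, detForm (d p) (γ p) (wedge (x p) (y p)) := by
  refine (detForm_ιMulti n β _ _).trans ?_
  let P : Matrix (Σ p, Fin (d p)) (Σ p, Fin (d p)) (Sec t U) := .of fun i j ↦
    β ((D.incl i.1).app U (x i.1 i.2)) ((D'.incl j.1).app U (y j.1 j.2))
  refine (Matrix.det_submatrix_equiv_self σ P).trans ?_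
  rw [det_sigma_of_offDiag_eq_zero P fun i j hij ↦ hne _ _ hij _ _]
  refine Finset.prod_congr rfl fun p _ ↦ Eq.trans ?_ (detForm_ιMulti (d p) (γ p) _ _).symm
  congr 1
  ext i j
  exact hself p _ _

/-- For decompositions `M = ⨁ N p` and `M' = ⨁ N' p`, the invertible sheaf `det M ⊗ det M'` is the
tensor product of the sheaves `det (N p) ⊗ det (N' p)`. -/
def productLine (D : Decomposition M N) (D' : Decomposition M' N') (hM : M.IsVectorBundle n)
    (hM' : M'.IsVectorBundle n) (hN : ∀ p, (N p).IsVectorBundle (d p))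
    (hN' : ∀ p, (N' p).IsVectorBundle (d p)) :
    ProductLine (detLine n M M') fun p ↦ detLine (d p) (N p) (N' p) where
  X := fun W ↦ (∀ p, Fin (d p) → (N p).obj W) × (∀ p, Fin (d p) → (N' p).obj W)
  comp := fun x p ↦ wedge (x.1 p) (x.2 p)
  prod := fun x ↦ blockWedge σ D D' x.1 x.2
  evalSymmetric := evalSymmetric_detLine hM hM'
  evalSymmetric_comp := fun p ↦ evalSymmetric_detLine (hN p) (hN' p)
  exists_frame := fun U ↦ by
    choose K hK r β x y h using fun p ↦ (hN p).exists_frame (hN' p) U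
    refine ⟨K, hK, fun p k ↦ r p k • (β p k).det (d p), fun p k ↦ wedge (x p k) (y p k),
      fun J ↦ (fun p ↦ x p (J p), fun p ↦ y p (J p)),
      fun J ↦ (∏ p, r p (J p)) • (LocalPairing.orthogonalSum D D' fun p ↦ β p (J p)).det n,
      h, fun J p ↦ rfl, fun J W hW z ↦ ?_⟩
    simp only [DualSec.smul_form, LinearMap.smul_apply, smul_eq_mul, map_prod,
      Finset.prod_mul_distrib]
    congr 1
    exact detForm_blockWedge σ D D' _ (fun p ↦ (β p (J p)).form W hW)
      (fun p x y ↦ LocalPairing.orthogonalSum_incl_self D D' _ hW p x y)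
      (fun p q hpq x y ↦ LocalPairing.orthogonalSum_incl_ne D D' _ hW hpq x y) z.1 z.2

/-- The determinant of an orthogonal sum of pairings of vector bundles corresponds to the tensor
product of the determinants. -/
theorem Pairing.IsOrthogonalSum.exists_det_iso {β : Pairing M M'}
    {γ : ∀ p, Pairing (N p) (N' p)} {D : Decomposition M N} {D' : Decomposition M' N'}
    (h : β.IsOrthogonalSum γ D D') (hM : M.IsVectorBundle n)
    (hM' : M'.IsVectorBundle n) (hN : ∀ p, (N p).IsVectorBundle (d p))
    (hN' : ∀ p, (N' p).IsVectorBundle (d p)) (hn : n = ∑ p, d p) :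
    ∃ Φ : Iso (dual (detLine n M M')) (bigTensor fun p ↦ dual (detLine (d p) (N p) (N' p))),
      ∀ U, Φ.app U (β.det n U) =
        PiTensorProduct.tprod (Sec t U) fun p ↦ (γ p).det (d p) U := by
  let σ : Fin n ≃ Σ p, Fin (d p) := (Fintype.equivFinOfCardEq (by simp [hn])).symm
  obtain ⟨Φ, hΦ⟩ := (productLine σ D D' hM hM' hN hN').exists_iso
  exact ⟨Φ, fun U ↦ hΦ U (β.det n U) (fun p ↦ (γ p).det (d p) U) fun x ↦
    detForm_blockWedge σ D D' (β.form U) (fun p ↦ (γ p).form U) (h.form_self U)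
      (fun p q hpq ↦ h.form_ne U hpq) x.1 x.2⟩

end BlockWedge

end AffMod

end DeterminantLine

/-! ### The rank of the covariants of a cover -/

section RankOfCovariants

/-- Two split idempotents conjugate under `e` have isomorphic images. -/
def splitEquiv {S X Y P Q : Type*} [CommRing S] [AddCommGroup X] [Module S X] [AddCommGroup Y]
    [Module S Y] [AddCommGroup P] [Module S P] [AddCommGroup Q] [Module S Q] (e : P ≃ₗ[S] Q)
    (j : X →ₗ[S] P) (π : P →ₗ[S] X) (j' : Y →ₗ[S] Q) (π' : Q →ₗ[S] Y)
    (h : ∀ x, π (j x) = x) (h' : ∀ y, π' (j' y) = y) (he : ∀ z, e (j (π z)) = j' (π' (e z))) :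
    X ≃ₗ[S] Y where
  toFun := fun x ↦ π' (e (j x))
  map_add' := fun x y ↦ by simp only [map_add]
  map_smul' := fun c x ↦ by simp only [map_smul, RingHom.id_apply]
  invFun := fun y ↦ π (e.symm (j' y))
  left_inv := fun x ↦ by
    change π (e.symm (j' (π' (e (j x))))) = x
    rw [← he, e.symm_apply_apply, h, h]
  right_inv := fun y ↦ by
    change π' (e (j (π (e.symm (j' y))))) = y
    rw [he, e.apply_symm_apply, h', h']

variable {R H : Type u} [CommRing R] [CommRing H] [HopfAlgebra R H]
variable {ι : Type*} [Fintype ι] [DecidableEq ι] {κ : ι → Type} [∀ i, Fintype (κ i)]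
  [∀ i, DecidableEq (κ i)] {c : ∀ i, Matrix (κ i) (κ i) H}

namespace MatrixBasis

variable (𝓑 : MatrixBasis R c)

/-- The inclusion in `H` of a column of the matrix `c i`. -/
def column (i : ι) (k : κ i) : (κ i → R) →ₗ[R] H :=
  Fintype.linearCombination R fun l ↦ c i l k

/-- The coordinates of an element of `H` along a column of the matrix `c i`. -/
def columnCoord (i : ι) (k : κ i) : H →ₗ[R] κ i → R :=
  LinearMap.pi fun l ↦ 𝓑.basis.coord ⟨i, l, k⟩

theorem columnCoord_column (i : ι) (k : κ i) (y : κ i → R) :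
    𝓑.columnCoord i k (column (c := c) i k y) = y := by
  funext l
  rw [column, Fintype.linearCombination_apply, columnCoord, LinearMap.pi_apply, map_sum,
    Finset.sum_eq_single l]
  · rw [map_smul, 𝓑.coord_apply ⟨i, l, k⟩ ⟨i, l, k⟩]
    simp
  · intro m _ hm
    rw [map_smul, 𝓑.coord_apply ⟨i, l, k⟩ ⟨i, m, k⟩, if_neg (by simpa using hm), smul_zero]
  · simp

/-- The projection of the regular comodule onto a column. -/
theorem column_columnCoord (i : ι) (k : κ i) (h : H) :
    column (c := c) i k (𝓑.columnCoord i k h) =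
      coef R H (𝓑.basis.coord ⟨i, k, k⟩) (Coalgebra.comul (R := R) h) := by
  have : column (c := c) i k ∘ₗ 𝓑.columnCoord i k =
      coef R H (𝓑.basis.coord ⟨i, k, k⟩) ∘ₗ Coalgebra.comul (R := R) := by
    refine 𝓑.basis.ext fun ⟨j, a, b⟩ ↦ ?_
    rw [𝓑.basis_apply, LinearMap.comp_apply, LinearMap.comp_apply, (𝓑.mul j).comul, map_sum]
    simp only [coef_tmul]
    rw [column, Fintype.linearCombination_apply]
    simp only [columnCoord, LinearMap.pi_apply, 𝓑.coord_apply _ ⟨j, a, b⟩]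
    have h2 : ∀ m, 𝓑.basis.coord ⟨i, k, k⟩ (c j m b) =
      if (⟨j, m, b⟩ : Σ i, κ i × κ i) = ⟨i, k, k⟩ then 1 else 0 := fun m ↦
        𝓑.coord_apply ⟨i, k, k⟩ ⟨j, m, b⟩
    simp only [h2]
    by_cases hij : j = i
    · subst hij
      by_cases hb : b = k
      · subst hb
        simp
      · simp [hb]
    · simp [hij]
  exact LinearMap.congr_fun this h

end MatrixBasis

variable {B A : Type u} [CommRing B] [Algebra R B] [CommRing A] [Algebra R A] [Algebra B A]
  [IsScalarTower R B A]
variable {V : ι → Type u} [∀ i, AddCommGroup (V i)] [∀ i, Module R (V i)]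
  {ρ : ∀ i, V i →ₗ[R] V i ⊗[R] H} {e : ∀ i, Module.Basis (κ i) R (V i)}
  {α : A →ₐ[B] A ⊗[R] H} (hα : IsCoaction α.toLinearMap)
  (𝓑 : MatrixBasis R c) (hρ : ∀ i k, ρ i (e i k) = ∑ l, e i l ⊗ₜ[R] c i l k)

/-- The idempotent of `A` that projects to the copy of `Ω_V` belonging to a basis vector of `V`. -/
theorem omegaCoord_omegaProj (p : Σ i, κ i) (a : A) :
    omegaCoord (e p.1) α (ρ p.1) p.2 (omegaProj 𝓑 hρ α hα p a) =
      coef B A (𝓑.dual.basis.coord ⟨p.1, p.2, p.2⟩) (α a) := by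
  rw [omegaCoord_eq 𝓑 hρ, omegaProj, LinearMap.comp_apply, LinearEquiv.coe_coe,
    LinearEquiv.apply_symm_apply]
  rfl

section

variable {C : Type u} [CommRing C] [Algebra R C] [Algebra B C] [IsScalarTower R B C]

/-- Contraction commutes with base change. -/
theorem coef_assoc_symm {N N' : Type u} [AddCommGroup N] [Module B N] [Module R N]
    [IsScalarTower R B N] [AddCommGroup N'] [Module R N'] (f : N' →ₗ[R] R)
    (g : N →ₗ[B] N ⊗[R] N') (x : C ⊗[B] N) :
    coef C (C ⊗[B] N) f
      ((AlgebraTensorModule.assoc R B C C N N').symm (g.lTensor C x)) =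
      (coef B N f ∘ₗ g).lTensor C x := by
  induction x with
  | zero => simp
  | add x y hx hy => simp only [map_add, hx, hy]
  | tmul c a =>
    rw [LinearMap.lTensor_tmul, LinearMap.lTensor_tmul, LinearMap.comp_apply]
    generalize g a = w
    induction w with
    | zero => simp
    | add x y hx hy => simp only [map_add, TensorProduct.tmul_add, hx, hy]
    | tmul n h =>
      rw [AlgebraTensorModule.assoc_symm_tmul, coef_tmul, coef_tmul,
        TensorProduct.tmul_smul]

/-- If `A` becomes isomorphic to the regular comodule over `C`, then `Ω_V` becomes free of rank
`rk V` over `C`: the idempotents of `A` and of `R[G]` whose images are `Ω_V` and a column of matrix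
coefficients correspond to each other. -/
def omegaBaseChangeEquiv (f : C ⊗[B] A ≃ₗ[C] C ⊗[R] H)
    (hf : ∀ x : C ⊗[B] A, (f.toLinearMap.restrictScalars R).rTensor H
        ((AlgebraTensorModule.assoc R B C C A H).symm (α.toLinearMap.lTensor C x)) =
      (TensorProduct.assoc R C H H).symm
        ((Coalgebra.comul (R := R) (A := H)).lTensor C (f x))) (p : Σ i, κ i) :
    C ⊗[B] invTensor α.toLinearMap (ρ p.1) ≃ₗ[C] C ⊗[R] (κ p.1 → R) :=
  splitEquiv f
    ((omegaCoord (e p.1) α (ρ p.1) p.2).baseChange C)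
    ((omegaProj 𝓑 hρ α hα p).baseChange C)
    ((MatrixBasis.column (c := fun i ↦ dualMatrix R (c i)) p.1 p.2).baseChange C)
    ((𝓑.dual.columnCoord p.1 p.2).baseChange C)
    (fun x ↦ by
      induction x with
      | zero => simp
      | add x y hx hy => simp only [map_add, hx, hy]
      | tmul a x =>
        rw [LinearMap.baseChange_tmul, LinearMap.baseChange_tmul,
          omegaProj_omegaCoord_self 𝓑 hρ hα])
    (fun x ↦ by
      induction x with
      | zero => simp
      | add x y hx hy => simp only [map_add, hx, hy]
      | tmul a x =>
        rw [LinearMap.baseChange_tmul, LinearMap.baseChange_tmul, 𝓑.dual.columnCoord_column])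
    (fun x ↦ by
      set φ := 𝓑.dual.basis.coord ⟨p.1, p.2, p.2⟩
      have h1 : ∀ z : C ⊗[B] A, (omegaCoord (e p.1) α (ρ p.1) p.2).baseChange C
          ((omegaProj 𝓑 hρ α hα p).baseChange C z) =
          (coef B A φ ∘ₗ α.toLinearMap).lTensor C z := by
        intro z
        induction z with
        | zero => simp
        | add x y hx hy => simp only [map_add, hx, hy]
        | tmul a x =>
          rw [LinearMap.baseChange_tmul, LinearMap.baseChange_tmul,
            omegaCoord_omegaProj hα 𝓑 hρ, LinearMap.lTensor_tmul]
          rfl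
      have h2 : ∀ z : C ⊗[R] H,
          (MatrixBasis.column (c := fun i ↦ dualMatrix R (c i)) p.1 p.2).baseChange C
          ((𝓑.dual.columnCoord p.1 p.2).baseChange C z) =
          (coef R H φ ∘ₗ Coalgebra.comul (R := R)).lTensor C z := by
        intro z
        induction z with
        | zero => simp
        | add x y hx hy => simp only [map_add, hx, hy]
        | tmul a x =>
          rw [LinearMap.baseChange_tmul, LinearMap.baseChange_tmul,
            𝓑.dual.column_columnCoord, LinearMap.lTensor_tmul]
          rfl
      rw [h1, h2, ← coef_assoc_symm (C := C) φ α.toLinearMap x]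
      have h3 := congrArg (coef C (C ⊗[R] H) φ) (hf x)
      rw [coef_rTensor (B := C) (M := C ⊗[B] A)] at h3
      refine h3.trans ?_
      exact coef_assoc_symm (C := C) φ (Coalgebra.comul (R := R) (A := H)) (f x))

/-- If `A` is locally isomorphic to the regular comodule, then `Ω_V` has rank `rk V`. -/
theorem rankAtStalk_invTensor (hα : IsCoaction α.toLinearMap) (𝓑 : MatrixBasis R c)
    (hρ : ∀ i k, ρ i (e i k) = ∑ l, e i l ⊗ₜ[R] c i l k) [Module.Finite B A] [Module.Projective B A]
    [Module.FaithfullyFlat B C] (f : C ⊗[B] A ≃ₗ[C] C ⊗[R] H)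
    (hf : ∀ x : C ⊗[B] A, (f.toLinearMap.restrictScalars R).rTensor H
        ((AlgebraTensorModule.assoc R B C C A H).symm (α.toLinearMap.lTensor C x)) =
      (TensorProduct.assoc R C H H).symm
        ((Coalgebra.comul (R := R) (A := H)).lTensor C (f x))) (p : Σ i, κ i)
    [Module.Finite B (invTensor α.toLinearMap (ρ p.1))]
    [Module.Projective B (invTensor α.toLinearMap (ρ p.1))] (P : PrimeSpectrum B) :
    Module.rankAtStalk (invTensor α.toLinearMap (ρ p.1)) P = Fintype.card (κ p.1) := by
  obtain ⟨Q, rfl⟩ := PrimeSpectrum.comap_surjective_of_faithfullyFlat (B := C) P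
  have : Nontrivial C := ⟨0, 1, fun h ↦ Q.2.ne_top
    ((Ideal.eq_top_iff_one _).2 (h ▸ Q.asIdeal.zero_mem))⟩
  rw [← Module.rankAtStalk_baseChange,
    Module.rankAtStalk_eq_of_equiv (omegaBaseChangeEquiv hα 𝓑 hρ f hf p),
    Module.rankAtStalk_eq_finrank_of_free]
  have : Module.finrank C (C ⊗[R] (κ p.1 → R)) = Fintype.card (κ p.1) := by
    rw [Module.finrank_eq_card_basis ((Pi.basisFun R (κ p.1)).baseChange C)]
  simpa using this

end

end RankOfCovariants

/-! ### The discriminant of a cover -/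

section VectorBundles

namespace AffMod

variable {R : Type u} [CommRing R] {T : Scheme.{u}} {t : T ⟶ Spec (CommRingCat.of R)}

/-- A summand of a vector bundle is a vector bundle. -/
theorem Decomposition.isVectorBundle {κ : Type} [Fintype κ] {M : AffMod t} {N : κ → AffMod t}
    (D : Decomposition M N) {n : ℕ} (hM : M.IsVectorBundle n) (p : κ) {d : ℕ}
    (hd : ∀ U, Module.Finite (Sec t U) ((N p).obj U) → Module.Projective (Sec t U) ((N p).obj U) →
      ∀ q : PrimeSpectrum (Sec t U), Module.rankAtStalk ((N p).obj U) q = d) :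
    (N p).IsVectorBundle d := by
  have hf : ∀ U, Module.Finite (Sec t U) ((N p).obj U) := fun U ↦ by
    have := hM.finite U
    exact Module.Finite.of_surjective ((D.proj p).app U) fun x ↦ ⟨_, D.proj_incl_self U p x⟩
  have hp : ∀ U, Module.Projective (Sec t U) ((N p).obj U) := fun U ↦ by
    have := hM.projective U
    exact Module.Projective.of_split ((D.incl p).app U) ((D.proj p).app U)
      (LinearMap.ext fun x ↦ D.proj_incl_self U p x)
  refine ⟨hf, hp, fun U ↦ hd U (hf U) (hp U), fun U g ↦ ?_⟩
  obtain ⟨φ, hφ⟩ := hM.exists_dualSec U (g ∘ₗ (D.proj p).app U)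
  refine ⟨(D.incl p).dualMap.app U φ, LinearMap.ext fun x ↦ ?_⟩
  refine (LinearMap.congr_fun hφ _).trans ?_
  rw [LinearMap.comp_apply, D.proj_incl_self]

end AffMod

variable {R H : Type u} [CommRing R] [CommRing H] [HopfAlgebra R H]
  {T : Scheme.{u}} {t : T ⟶ Spec (CommRingCat.of R)}

/-- Linear forms on the sections of `A` over an affine open extend to the smaller affine opens,
because `A` is quasi-coherent. -/
theorem LocFreeAlg.exists_dualSec (A : LocFreeAlg t) (U : T.affineOpens)
    (g : Module.Dual (Sec t U) (A.obj U)) :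
    ∃ φ : AffMod.DualSec A.toMod U, φ.form U le_rfl = g := by
  choose f hf using fun (W : T.affineOpens) (hW : W ≤ U) ↦ (A.quasiCoherent hW).exists_dual g
  refine ⟨⟨f, fun {W W'} h hW x ↦ ?_⟩, LinearMap.ext fun x ↦ ?_⟩
  -- Both sides of the compatibility are linear over the sections on `W` if those act on the sections
  -- on `W'` through restriction.
  · let _ : Module (Sec t W) (Sec t W') := Module.compHom _ (resSec t h)
    let g₁ : A.obj W →ₗ[Sec t W] Sec t W' :=
      { toFun := fun x ↦ f W' (h.trans hW) (A.toMod.res h x)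
        map_add' := fun x y ↦
          (congrArg _ (map_add (A.toMod.res h) x y)).trans (map_add (f W' (h.trans hW)) _ _)
        map_smul' := fun c x ↦
          (congrArg _ (map_smulₛₗ (A.toMod.res h) c x)).trans
            (map_smul (f W' (h.trans hW)) _ _) }
    let g₂ : A.obj W →ₗ[Sec t W] Sec t W' :=
      { toFun := fun x ↦ resSec t h (f W hW x)
        map_add' := fun x y ↦ by rw [map_add, map_add]
        map_smul' := fun c x ↦ by
          rw [map_smul, smul_eq_mul, map_mul]
          rfl }
    -- The two forms agree on the sections restricted from `U`, which generate.
    refine LinearMap.congr_fun ((A.quasiCoherent hW).hom_ext g₁ g₂ fun m ↦ ?_) x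
    change f W' (h.trans hW) (A.res h (A.res hW m)) = resSec t h (f W hW (A.res hW m))
    rw [A.res_trans]
    refine (hf W' (h.trans hW) m).trans ?_
    rw [← resSec_trans t h hW]
    exact congrArg _ (hf W hW m).symm
  · have h1 := hf U le_rfl x
    refine Eq.trans ?_ (h1.trans (resSec_refl t U _))
    exact congrArg _ (A.res_refl U x).symm

theorem EquivAlg.isVectorBundle {A : EquivAlg t H} {n : ℕ} (hrk : A.HasRank n) :
    A.toMod.IsVectorBundle n :=
  ⟨A.finite, A.projective, hrk, A.exists_dualSec⟩

end VectorBundles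

section Covers

variable {R H : Type u} [CommRing R] [IsLocalRing R] [CommRing H] [HopfAlgebra R H]
  [Module.Finite R H] [Algebra.Etale R H]
  {ι : Type} [Fintype ι] [DecidableEq ι] (I : GoodLinearlyReductive R H ι)
  {T : Scheme.{u}} {t : T ⟶ Spec (CommRingCat.of R)} {A : EquivAlg t H}

namespace GoodLinearlyReductive

/-- For a cover, `Ω_V` is locally free of rank `rk V`. -/
theorem isVectorBundle_Omega (hrk : A.HasRank (Module.finrank R H)) (hcov : A.IsGCover)
    (p : I.Idx) : (A.Omega (I.V p.1).carrier (I.V p.1).coact).IsVectorBundle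
      (Module.finrank R (I.V p.1).carrier) :=
  (I.decomposition A).isVectorBundle (EquivAlg.isVectorBundle hrk) p fun U h₁ h₂ q ↦ by
    obtain ⟨C, _, _, _, _, _, _, f, hf⟩ := hcov U
    have : Module.Finite (Sec t U) (invTensor (A.coact U).toLinearMap (I.V p.1).coact) := h₁
    have : Module.Projective (Sec t U) (invTensor (A.coact U).toLinearMap (I.V p.1).coact) := h₂
    exact (rankAtStalk_invTensor (A.isCoaction U) I.matrixBasis I.coact_vecBasis f hf p q).trans
      (Fintype.card_fin _)

/-- For a cover, `Ω_{V^∨}` is locally free of rank `rk V`. -/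
theorem isVectorBundle_Omega_dual (hrk : A.HasRank (Module.finrank R H)) (hcov : A.IsGCover)
    (p : I.Idx) :
    (A.Omega (Module.Dual R (I.V p.1).carrier) (dualCoact (I.V p.1))).IsVectorBundle
      (Module.finrank R (I.V p.1).carrier) :=
  (I.dualDecomposition A).isVectorBundle (EquivAlg.isVectorBundle hrk) p fun U h₁ h₂ q ↦ by
    obtain ⟨C, _, _, _, _, _, _, f, hf⟩ := hcov U
    have : Module.Finite (Sec t U) (invTensor (A.coact U).toLinearMap (dualCoact (I.V p.1))) := h₁
    have : Module.Projective (Sec t U)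
      (invTensor (A.coact U).toLinearMap (dualCoact (I.V p.1))) := h₂
    exact (rankAtStalk_invTensor (A.isCoaction U) I.matrixBasis.dual I.dualCoact_vecBasis f hf p
      q).trans (Fintype.card_fin _)

/-- The isomorphism of discriminant sheaves, sending the discriminant of `A` to the product of the
determinants of the `ξ_V`. The ranks match because `rk G = ∑ (rk V)²`. -/
theorem exists_discr_iso (hA : A.InvEqBase) (hrk : A.HasRank (Module.finrank R H))
    (hcov : A.IsGCover) :
    ∃ Φ : AffMod.Iso (A.discrSheaf (Module.finrank R H))
        (AffMod.bigTensor fun p : I.Idx ↦ A.discrSheafV (I.V p.1)),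
      ∀ U : T.affineOpens, Φ.app U (A.discr (Module.finrank R H) U) =
        PiTensorProduct.tprod (Sec t U) (fun p : I.Idx ↦ EquivAlg.discrV hA (I.V p.1) U) :=
  (I.isOrthogonalSum hA hrk).exists_det_iso (EquivAlg.isVectorBundle hrk)
    (EquivAlg.isVectorBundle hrk) (I.isVectorBundle_Omega hrk hcov)
    (I.isVectorBundle_Omega_dual hrk hcov) (by
      rw [I.finrank_eq_sum, Fintype.sum_sigma]
      refine Finset.sum_congr rfl fun i _ ↦ ?_
      exact (Fin.sum_const _ _).symm)

end GoodLinearlyReductive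

end Covers

end

end GCov

theorem lemma4p6 {R : Type u} [CommRing R] [IsLocalRing R]
    {H : Type u} [CommRing H] [HopfAlgebra R H] [Module.Finite R H] [Algebra.Etale R H]
    {ι : Type} [Fintype ι] [DecidableEq ι] (I : GCov.GoodLinearlyReductive R H ι)
    {T : Scheme.{u}} (t : T ⟶ Spec (CommRingCat.of R)) (A : GCov.EquivAlg t H)
    (hA : A.InvEqBase) (hrk : A.HasRank (Module.finrank R H)) :
    (∃ e : GCov.AffMod.Iso A.kerTrace
        (GCov.AffMod.directSum fun i : {i : ι // i ≠ I.triv} ↦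
          GCov.AffMod.twist (I.V i).carrier (A.Omega (I.V i).carrier (I.V i).coact)),
      ∀ (U : T.affineOpens) y,
        A.coact U ((GCov.AffMod.kerIncl A.trace).app U ((e.app U).symm y)) =
          (((GCov.AffMod.kerIncl A.trace).app U ∘ₗ (e.app U).symm.toLinearMap).restrictScalars
            R).rTensor H
              (GCov.AffMod.directSumCoact _ U
                (fun i : {i : ι // i ≠ I.triv} ↦ GCov.AffMod.twistCoact (I.V i) _ U) y)) ∧
    Nonempty (GCov.AffMod.Iso A.Q
      (GCov.AffMod.directSum fun i : ι ↦
        GCov.AffMod.twist (I.V i).carrier (GCov.EquivAlg.QV hA (I.V i)))) ∧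
    (A.IsGCover →
      ∃ Φ : GCov.AffMod.Iso (A.discrSheaf (Module.finrank R H))
          (GCov.AffMod.bigTensor
            fun p : (Σ i : ι, Fin (Module.finrank R (I.V i).carrier)) ↦ A.discrSheafV (I.V p.1)),
        ∀ U : T.affineOpens,
          Φ.app U (A.discr (Module.finrank R H) U) =
            PiTensorProduct.tprod (GCov.Sec t U)
              (fun p : (Σ i : ι, Fin (Module.finrank R (I.V i).carrier)) ↦
                GCov.EquivAlg.discrV hA (I.V p.1) U)) :=
  ⟨⟨I.kerTraceIso hA hrk, I.kerTraceIso_equivariant A hA hrk⟩, ⟨I.cokerIso hA hrk⟩,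
    I.exists_discr_iso hA hrk⟩
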